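/- **Setting.** Let $(\mathcal X,\Sigma)$ and $(\hat{\mathcal X},\hat\Sigma)$ be measurable spaces, let $\mathcal H$ be a separable (possibly infinite-dimensional) complex Hilbert space, and let $\mathcal T(\mathcal H)$ be the Banach space of trace-class operators with the trace norm $\|A\|_1=\mathrm{tr}\,(A^*A)^{1/2}$. A ccq wiretap channel is a pair $(W,D)$, where $W$ is a stochastic kernel from $\mathcal X$ to $\hat{\mathcal X}$ (the legitimate channel) and $D$ is a map from $\mathcal X$ to the set of density operators on $\mathcal H$ (positive trace-class operators of trace one), measurable with respect to the Borel $\sigma$-algebra of the trace norm (the eavesdropper's channel). Put $W^n(\cdot,x^n)=\bigotimes_{i}W(\cdot,x_i)$ and $D^n(x^n)=\bigotimes_{i}D(x_i)$, a density operator on $\mathcal H^{\otimes n}$. All logarithms are natural. Let $P$ be a probability distribution on $\mathcal X$, let $X\sim P$, let $\hat X$ be the output of $W$ for the input $X$, and let $\hat P$ be the distribution of $\hat X$. Assume that the information density exists: $W(\cdot,x)\ll\hat P$ for $P$-almost every $x$, and $i_P(x;\hat x)=\log\frac{dW(\cdot,x)}{d\hat P}(\hat x)$ for a jointly measurable version of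 the Radon–Nikodym derivatives. Let $$I(P,W)=\mathbb E\, i_P(X;\hat X),\qquad D_P=\mathbb E\,D(X),\qquad I(P,D)=\mathbb E\,\mathrm{tr}\big(D(X)\log D(X)\big)-\mathrm{tr}\big(D_P\log D_P\big),$$ where expectations of trace-class operators are Bochner integrals in $\mathcal T(\mathcal H)$, and $I(P,D)=\infty$ by convention if $D(X)\log D(X)\notin\mathcal T(\mathcal H)$ on a non-null set or $D_P\log D_P\notin\mathcal T(\mathcal H)$. A wiretap code of size $M$ and block length $n$ consists of a stochastic kernel $\mathrm{Enc}$ from $\{1,\dots,M\}$ to $\mathcal X^n$ and a measurable map $\mathrm{Dec}:\hat{\mathcal X}^n\to\{1,\dots,M\}$. Its rate is $\log(M)/n$. It has average error $\varepsilon$ if $$\frac1M\sum_{m=1}^M\int W^n\big(\{\mathrm{Dec}\ne m\},x^n\big)\,\mathrm{Enc}(dx^n,m)\le\varepsilon .$$ It has distinguishing security level $\delta$ if $\|D^n\circ\mathrm{Enc}(m_1)-D^n\circ\mathrm{Enc}(m_2)\|_1\le\delta$ for all $m_1,m_2\in\{1,\dots,M\}$, where $D^n\circ\mathrm{Enc}(m)=\int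 D^n(x^n)\,\mathrm{Enc}(dx^n,m)$. **Theorem.** Suppose that - there is $\alpha_{\min}\in(0,1)$ such that $D(x)^{\alpha_{\min}}$ is trace class for $P$-almost every $x$ and $D_P^{\alpha_{\min}}$ is trace class; - there is $t>0$ such that $\mathbb E\exp\big(t\, i_P(X;\hat X)\big)<\infty$. Let $R\in\mathbb R$ with $R<I(P,W)-I(P,D)$. Then there are $\gamma_1,\gamma_2\in(0,\infty)$ such that for all sufficiently large $n$ there is a wiretap code for $(W,D)$ of block length $n$ which has rate at least $R$, average error $\exp(-\gamma_1 n)$ and distinguishing security level $\exp(-\gamma_2 n)$. -/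

import Mathlib

open MeasureTheory ProbabilityTheory Filter UniformSpace
open scoped ENNReal TensorProduct

noncomputable section

namespace Wiretap

/-! ### Trace-class operators -/

section HilbertSchmidt

variable {H : Type*} [NormedAddCommGroup H] [InnerProductSpace ℂ H] [CompleteSpace H]

/-- The sum of the squared norms `∑ᵢ ‖T bᵢ‖²` along a Hilbert basis. -/
def hsSq {ι : Type*} (b : HilbertBasis ι ℂ H) (T : H →L[ℂ] H) : ℝ≥0∞ :=
  ∑' i, ‖T (b i)‖ₑ ^ 2

set_option linter.unusedSectionVars false in
theorem enorm_sq_eq_tsum {ι : Type*} (b : HilbertBasis ι ℂ H) (v : H) :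
    ‖v‖ₑ ^ 2 = ∑' i, ‖inner ℂ (b i) v‖ₑ ^ 2 := by
  have h := b.hasSum_inner_mul_inner v v
  have h2 : HasSum (fun i => ‖inner ℂ (b i) v‖ ^ 2) (‖v‖ ^ 2) := by
    have h3 := Complex.hasSum_re h
    have h4 : (inner ℂ v v : ℂ).re = ‖v‖ ^ 2 := by
      rw [inner_self_eq_norm_sq_to_K]; norm_cast
    rw [h4] at h3
    refine h3.congr_fun ?_ 
    intro i
    rw [← inner_conj_symm v (b i), Complex.conj_mul']
    norm_cast
  have h5 := ENNReal.ofReal_tsum_of_nonneg (fun i => by positivity) h2.summable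
  rw [h2.tsum_eq] at h5
  simp only [ENNReal.ofReal_pow (norm_nonneg _), ofReal_norm] at h5
  exact h5

theorem hsSq_adjoint {ι κ : Type*} (b : HilbertBasis ι ℂ H) (c : HilbertBasis κ ℂ H)
    (T : H →L[ℂ] H) : hsSq c (ContinuousLinearMap.adjoint T) = hsSq b T := by
  unfold hsSq
  simp_rw [fun i => enorm_sq_eq_tsum b (ContinuousLinearMap.adjoint T (c i)),
    fun i => enorm_sq_eq_tsum c (T (b i))]
  rw [ENNReal.tsum_comm]
  refine tsum_congr fun i => tsum_congr fun j => ?_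
  rw [ContinuousLinearMap.adjoint_inner_right, ← ofReal_norm, ← ofReal_norm, norm_inner_symm]

theorem hsSq_indep {ι κ : Type*} (b : HilbertBasis ι ℂ H) (c : HilbertBasis κ ℂ H)
    (T : H →L[ℂ] H) : hsSq b T = hsSq c T := by
  rw [← hsSq_adjoint b b T, hsSq_adjoint c b T]

set_option linter.unusedSectionVars false in
theorem hsSq_comp_le {ι : Type*} (b : HilbertBasis ι ℂ H) (K T : H →L[ℂ] H) (hK : ‖K‖ ≤ 1) :
    hsSq b (K * T) ≤ hsSq b T := by
  refine ENNReal.tsum_le_tsum fun i => ?_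
  gcongr
  rw [← ofReal_norm, ← ofReal_norm]
  refine ENNReal.ofReal_le_ofReal ?_
  exact (K.le_opNorm _).trans (mul_le_of_le_one_left (norm_nonneg _) hK)

theorem inner_eq_enorm_sq {T S : H →L[ℂ] H} (h : star S * S = T) (v : H) :
    inner ℂ v (T v) = (‖S v‖ : ℂ) ^ 2 := by
  rw [← h, mul_apply_eq_comp, ContinuousLinearMap.star_eq_adjoint,
    ContinuousLinearMap.adjoint_inner_right, inner_self_eq_norm_sq_to_K]
  rfl

theorem ofReal_re_inner {T S : H →L[ℂ] H} (h : star S * S = T) (v : H) :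
    ENNReal.ofReal (inner ℂ v (T v)).re = ‖S v‖ₑ ^ 2 := by
  rw [inner_eq_enorm_sq h, ← ofReal_norm, ← ENNReal.ofReal_pow (norm_nonneg _)]
  norm_cast

theorem exists_sqrt {T : H →L[ℂ] H} (hT : 0 ≤ T) :
    ∃ S : H →L[ℂ] H, star S = S ∧ S * S = T :=
  ⟨CFC.sqrt T, (CFC.sqrt_nonneg T).isSelfAdjoint.star_eq, CFC.sqrt_mul_sqrt_self T hT⟩

theorem norm_abs_apply (A : H →L[ℂ] H) (v : H) : ‖CFC.abs A v‖ = ‖A v‖ := by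
  have h1 := inner_eq_enorm_sq (S := CFC.abs A) (T := star A * A)
    (by rw [(CFC.abs_nonneg A).isSelfAdjoint.star_eq, CFC.abs_mul_abs]) v
  rw [inner_eq_enorm_sq rfl v] at h1
  have h2 : ‖A v‖ ^ 2 = ‖CFC.abs A v‖ ^ 2 := by exact_mod_cast h1
  exact ((sq_eq_sq₀ (norm_nonneg _) (norm_nonneg _)).1 h2).symm

/-- Polar decomposition, with a contraction as the left factor. -/
theorem exists_polar (A : H →L[ℂ] H) :
    ∃ W : H →L[ℂ] H, ‖W‖ ≤ 1 ∧ W * CFC.abs A = A ∧ star W * A = CFC.abs A := by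
  set B := CFC.abs A with hB
  set K : Submodule ℂ H := (LinearMap.range (B : H →ₗ[ℂ] H)).topologicalClosure with hK
  have : CompleteSpace K := (Submodule.isClosed_topologicalClosure _).completeSpace_coe
  have hmem : ∀ x, B x ∈ K := fun x => Submodule.le_topologicalClosure _ ⟨x, rfl⟩
  let e : H →ₗ[ℂ] K := (B : H →ₗ[ℂ] H).codRestrict K hmem
  have hd : DenseRange e := by
    rw [DenseRange, Subtype.dense_iff]
    intro x hx
    have : x ∈ closure (LinearMap.range (B : H →ₗ[ℂ] H) : Set H) := hx
    refine closure_mono ?_ this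
    rintro _ ⟨y, rfl⟩
    exact ⟨e y, ⟨y, rfl⟩, rfl⟩
  have hn : ∀ x, ‖(A : H →ₗ[ℂ] H) x‖ ≤ 1 * ‖e x‖ := by
    intro x
    rw [one_mul]
    exact (norm_abs_apply A x).ge
  let W0 : K →L[ℂ] H := (A : H →ₗ[ℂ] H).extendOfNorm e
  have hW0 : ∀ x, W0 (e x) = A x := fun x => LinearMap.extendOfNorm_eq hd ⟨1, hn⟩ x
  let W : H →L[ℂ] H := W0 ∘L K.orthogonalProjectionOnto
  have hWn : ‖W‖ ≤ 1 := by
    refine ContinuousLinearMap.opNorm_le_bound _ zero_le_one fun x => ?_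
    have h1 := LinearMap.norm_extendOfNorm_apply_le (f := (A : H →ₗ[ℂ] H)) (e := e) hd 1 hn
      (K.orthogonalProjectionOnto x)
    refine h1.trans ?_
    rw [one_mul, one_mul]
    exact K.norm_orthogonalProjectionOnto_apply_le x
  have hWB : W * B = A := by
    ext x
    have h1 : K.orthogonalProjectionOnto (B x) = e x := by
      have := K.orthogonalProjectionOnto_mem_subspace_eq_self (e x)
      exact this
    change W0 (K.orthogonalProjectionOnto (B x)) = A x
    rw [h1, hW0]
  refine ⟨W, hWn, hWB, ?_⟩
  ext x
  rw [← sub_eq_zero, ← norm_le_zero_iff]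
  have hA : A x = W (B x) := by rw [← mul_apply_eq_comp, hWB]
  have h2 : ‖(star W * A) x‖ ≤ ‖B x‖ := by
    have : ‖star W‖ ≤ 1 := by rwa [norm_star]
    calc ‖star W (A x)‖ ≤ ‖star W‖ * ‖A x‖ := (star W).le_opNorm _
      _ ≤ ‖A x‖ := mul_le_of_le_one_left (norm_nonneg _) this
      _ = ‖B x‖ := (norm_abs_apply A x).symm
  have h3 : RCLike.re (inner ℂ ((star W * A) x) (B x)) = ‖B x‖ ^ 2 := by
    rw [mul_apply_eq_comp, ContinuousLinearMap.star_eq_adjoint,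
      ContinuousLinearMap.adjoint_inner_left, ← hA, inner_self_eq_norm_sq_to_K,
      ← norm_abs_apply]
    norm_cast
  have h4 := norm_sub_sq (𝕜 := ℂ) ((star W * A) x) (B x)
  rw [h3] at h4
  have h5 : ‖(star W * A) x‖ ^ 2 ≤ ‖B x‖ ^ 2 := by gcongr
  have h6 : ‖(star W * A) x - B x‖ ^ 2 ≤ 0 := by linarith
  nlinarith [norm_nonneg ((star W * A) x - B x)]

end HilbertSchmidt

section TraceNorm

variable (H : Type*) [NormedAddCommGroup H] [InnerProductSpace ℂ H] [CompleteSpace H]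

/-- A fixed orthonormal (Hilbert) basis of `H`, indexed by the set of its vectors. -/
def stdIndex : Set H := (exists_hilbertBasis ℂ H).choose

/-- A fixed orthonormal (Hilbert) basis of `H`; traces do not depend on it. -/
def stdBasis : HilbertBasis (stdIndex H) ℂ H := (exists_hilbertBasis ℂ H).choose_spec.choose

variable {H}

/-- The trace norm `tr (A* A)^{1/2} = ∑ᵢ ⟪bᵢ, |A| bᵢ⟫ ∈ [0, ∞]` of a bounded operator. -/
def traceNorm (A : H →L[ℂ] H) : ℝ≥0∞ :=
  ∑' i, ENNReal.ofReal (inner ℂ (stdBasis H i) (CFC.abs A (stdBasis H i))).re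

/-- `A` is trace class if `tr (A* A)^{1/2} < ∞`. -/
def IsTraceClass (A : H →L[ℂ] H) : Prop := traceNorm A < ∞

/-- The trace `∑ᵢ ⟪bᵢ, A bᵢ⟫`, for trace-class operators `A`. -/
def trace (A : H →L[ℂ] H) : ℂ := ∑' i, inner ℂ (stdBasis H i) (A (stdBasis H i))

theorem traceNorm_of_sqrt {ι : Type*} (b : HilbertBasis ι ℂ H) {A S : H →L[ℂ] H}
    (h : star S * S = CFC.abs A) : traceNorm A = hsSq b S := by
  rw [hsSq_indep b (stdBasis H)]
  exact tsum_congr fun i => ofReal_re_inner h _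

theorem tsum_inner_le_traceNorm (A V : H →L[ℂ] H) (hV : ‖V‖ ≤ 1) :
    ∑' i, ‖inner ℂ (stdBasis H i) (V (A (stdBasis H i)))‖ₑ ≤ traceNorm A := by
  obtain ⟨W, hW, hWA, -⟩ := exists_polar A
  obtain ⟨S, hS, hSS⟩ := exists_sqrt (CFC.abs_nonneg A)
  have hSS' : star S * S = CFC.abs A := by rw [hS, hSS]
  set K := V * W with hKdef
  have hK : ‖K‖ ≤ 1 := (norm_mul_le V W).trans (mul_le_one₀ hV (norm_nonneg _) hW)
  have key : ∀ v : H, ‖inner ℂ v (V (A v))‖ₑ ≤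
      2⁻¹ * (‖ContinuousLinearMap.adjoint (K * S) v‖ₑ ^ 2 + ‖S v‖ₑ ^ 2) := by
    intro v
    have h1 : inner ℂ v (V (A v)) = inner ℂ (ContinuousLinearMap.adjoint (K * S) v) (S v) := by
      rw [ContinuousLinearMap.adjoint_inner_left]
      congr 1
      conv_lhs => rw [← hWA, ← hSS]
      rfl
    rw [h1, ← ofReal_norm, ← ofReal_norm, ← ofReal_norm,
      ← ENNReal.ofReal_pow (norm_nonneg _), ← ENNReal.ofReal_pow (norm_nonneg _),
      ← ENNReal.ofReal_add (by positivity) (by positivity)]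
    have h2 : (2⁻¹ : ℝ≥0∞) = ENNReal.ofReal 2⁻¹ := by
      rw [ENNReal.ofReal_inv_of_pos (by norm_num)]; simp
    rw [h2, ← ENNReal.ofReal_mul (by norm_num)]
    refine ENNReal.ofReal_le_ofReal ?_
    refine (norm_inner_le_norm _ _).trans ?_
    nlinarith [sq_nonneg (‖ContinuousLinearMap.adjoint (K * S) v‖ - ‖S v‖)]
  refine (ENNReal.tsum_le_tsum fun i => key _).trans ?_
  rw [ENNReal.tsum_mul_left, ENNReal.tsum_add]
  change 2⁻¹ * (hsSq (stdBasis H) _ + hsSq (stdBasis H) S) ≤ _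
  rw [hsSq_adjoint (stdBasis H), traceNorm_of_sqrt (stdBasis H) hSS']
  calc 2⁻¹ * (hsSq (stdBasis H) (K * S) + hsSq (stdBasis H) S)
      ≤ 2⁻¹ * (hsSq (stdBasis H) S + hsSq (stdBasis H) S) := by
        gcongr; exact hsSq_comp_le _ _ _ hK
    _ = hsSq (stdBasis H) S := by
        rw [← two_mul, ← mul_assoc, ENNReal.inv_mul_cancel (by norm_num) (by norm_num), one_mul]

theorem traceNorm_add_le (A B : H →L[ℂ] H) : traceNorm (A + B) ≤ traceNorm A + traceNorm B := by
  obtain ⟨W, hW, -, hWA⟩ := exists_polar (A + B)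
  have hW' : ‖star W‖ ≤ 1 := by rwa [norm_star]
  refine le_trans ?_ (add_le_add (tsum_inner_le_traceNorm A _ hW')
    (tsum_inner_le_traceNorm B _ hW'))
  rw [← ENNReal.tsum_add]
  refine ENNReal.tsum_le_tsum fun i => ?_
  rw [← hWA, mul_apply_eq_comp, add_apply, map_add,
    inner_add_right]
  refine le_trans (ENNReal.ofReal_le_ofReal (Complex.re_le_norm _)) ?_
  rw [ofReal_norm]
  exact enorm_add_le _ _

theorem traceNorm_smul (r : ℂ) (A : H →L[ℂ] H) : traceNorm (r • A) = ‖r‖ₑ * traceNorm A := by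
  unfold traceNorm
  rw [← ENNReal.tsum_mul_left]
  refine tsum_congr fun i => ?_
  rw [CFC.abs_smul, ← ofReal_norm, ← ENNReal.ofReal_mul (norm_nonneg _)]
  congr 1
  rw [smul_apply, inner_smul_right_eq_smul, Complex.real_smul,
    Complex.re_ofReal_mul]

theorem traceNorm_zero : traceNorm (0 : H →L[ℂ] H) = 0 := by simp [traceNorm]

theorem traceNorm_neg (A : H →L[ℂ] H) : traceNorm (-A) = traceNorm A := by
  simp [traceNorm]

theorem enorm_le_traceNorm (A : H →L[ℂ] H) : ‖A‖ₑ ≤ traceNorm A := by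
  obtain ⟨S, hS, hSS⟩ := exists_sqrt (CFC.abs_nonneg A)
  have hSS' : star S * S = CFC.abs A := by rw [hS, hSS]
  rw [traceNorm_of_sqrt (stdBasis H) hSS']
  have h0 : ‖A‖ₑ = ‖S‖ₑ ^ 2 := by
    rw [← ofReal_norm, ← ofReal_norm, ← ENNReal.ofReal_pow (norm_nonneg _),
      ← CFC.norm_abs, ← hSS', CStarRing.norm_star_mul_self, sq]
  rw [h0]
  by_cases htop : hsSq (stdBasis H) S = ∞
  · rw [htop]; exact le_top
  have h1 : ∀ v, ‖S v‖ₑ ^ 2 ≤ hsSq (stdBasis H) S * ‖v‖ₑ ^ 2 := by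
    intro v
    rw [enorm_sq_eq_tsum (stdBasis H) (S v), hsSq, ← ENNReal.tsum_mul_right]
    refine ENNReal.tsum_le_tsum fun i => ?_
    have : inner ℂ (stdBasis H i) (S v) = inner ℂ (S (stdBasis H i)) v := by
      conv_rhs => rw [← hS, ContinuousLinearMap.star_eq_adjoint,
        ContinuousLinearMap.adjoint_inner_left]
    rw [this, ← mul_pow, ← ofReal_norm, ← ofReal_norm, ← ofReal_norm,
      ← ENNReal.ofReal_mul (norm_nonneg _)]
    gcongr
    exact norm_inner_le_norm _ _
  set c := (hsSq (stdBasis H) S).toReal with hc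
  have hc' : hsSq (stdBasis H) S = ENNReal.ofReal c := (ENNReal.ofReal_toReal htop).symm
  have h2 : ‖S‖ ≤ Real.sqrt c := by
    refine ContinuousLinearMap.opNorm_le_bound _ (Real.sqrt_nonneg _) fun v => ?_
    have h3 := h1 v
    rw [hc', ← ofReal_norm, ← ofReal_norm, ← ENNReal.ofReal_pow (norm_nonneg _),
      ← ENNReal.ofReal_pow (norm_nonneg _), ← ENNReal.ofReal_mul ENNReal.toReal_nonneg,
      ENNReal.ofReal_le_ofReal_iff (by positivity)] at h3
    rw [← Real.sqrt_sq (norm_nonneg v), ← Real.sqrt_mul ENNReal.toReal_nonneg]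
    exact Real.le_sqrt_of_sq_le h3
  rw [hc', ← ofReal_norm, ← ENNReal.ofReal_pow (norm_nonneg _)]
  refine ENNReal.ofReal_le_ofReal ?_
  calc ‖S‖ ^ 2 ≤ Real.sqrt c ^ 2 := by gcongr
    _ = c := Real.sq_sqrt ENNReal.toReal_nonneg

theorem lowerSemicontinuous_traceNorm :
    LowerSemicontinuous (traceNorm : (H →L[ℂ] H) → ℝ≥0∞) := by
  refine lowerSemicontinuous_tsum fun i => Continuous.lowerSemicontinuous ?_
  refine ENNReal.continuous_ofReal.comp (Complex.continuous_re.comp ?_)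
  have h : Continuous (fun A : H →L[ℂ] H => CFC.abs A (stdBasis H i)) :=
    (ContinuousLinearMap.apply ℂ H (stdBasis H i)).continuous.comp CFC.continuous_abs
  exact continuous_const.inner h

/-- For positive operators trace norm and trace are computed by any square root, along any
orthonormal basis. -/
theorem traceNorm_of_nonneg {ι : Type*} (b : HilbertBasis ι ℂ H) {A S : H →L[ℂ] H}
    (h : star S * S = A) : traceNorm A = hsSq b S :=
  traceNorm_of_sqrt b (by rw [CFC.abs_of_nonneg A (h ▸ star_mul_self_nonneg S), h])

theorem trace_of_nonneg {A : H →L[ℂ] H} (hA : 0 ≤ A) :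
    trace A = ((traceNorm A).toReal : ℂ) := by
  obtain ⟨S, hS, hSS⟩ := exists_sqrt hA
  have hSS' : star S * S = A := by rw [hS, hSS]
  have h1 := traceNorm_of_nonneg (stdBasis H) hSS'
  rw [h1, hsSq, ENNReal.tsum_toReal_eq
    (fun i => by simp), Complex.ofReal_tsum]
  refine tsum_congr fun i => ?_
  rw [inner_eq_enorm_sq hSS']
  simp

end TraceNorm

section TraceClass

variable (H : Type*) [NormedAddCommGroup H] [InnerProductSpace ℂ H] [CompleteSpace H]

/-- The subspace of trace-class operators. -/
def traceClassSubmodule : Submodule ℂ (H →L[ℂ] H) where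
  carrier := {A | IsTraceClass A}
  zero_mem' := by simp [IsTraceClass, traceNorm_zero]
  add_mem' {A B} hA hB := (traceNorm_add_le A B).trans_lt (ENNReal.add_lt_top.2 ⟨hA, hB⟩)
  smul_mem' r A hA := by
    change traceNorm (r • A) < ∞
    rw [traceNorm_smul]
    exact ENNReal.mul_lt_top enorm_lt_top hA

/-- The space of trace-class operators on `H`, normed by the trace norm. -/
def TraceClass : Type _ := traceClassSubmodule H

variable {H}

namespace TraceClass

instance : AddCommGroup (TraceClass H) := inferInstanceAs (AddCommGroup (traceClassSubmodule H))

instance : Module ℂ (TraceClass H) := inferInstanceAs (Module ℂ (traceClassSubmodule H))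

/-- The underlying bounded operator. -/
def op (A : TraceClass H) : H →L[ℂ] H := (traceClassSubmodule H).subtype A

/-- A bounded operator of finite trace norm, as an element of the trace class. -/
def mk (A : H →L[ℂ] H) (h : IsTraceClass A) : TraceClass H :=
  (⟨A, h⟩ : traceClassSubmodule H)

theorem op_mk (A : H →L[ℂ] H) (h : IsTraceClass A) : (mk A h).op = A := rfl

theorem isTraceClass (A : TraceClass H) : IsTraceClass A.op := A.2

theorem op_injective : Function.Injective (op : TraceClass H → (H →L[ℂ] H)) :=
  Subtype.val_injective

theorem op_zero : (0 : TraceClass H).op = 0 := rfl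

theorem op_add (A B : TraceClass H) : (A + B).op = A.op + B.op := rfl

theorem op_neg (A : TraceClass H) : (-A).op = -A.op := rfl

theorem op_sub (A B : TraceClass H) : (A - B).op = A.op - B.op := rfl

theorem op_smul (r : ℂ) (A : TraceClass H) : (r • A).op = r • A.op := rfl

/-- The trace norm is a norm on the trace class. -/
def addGroupNorm : AddGroupNorm (TraceClass H) where
  toFun A := (traceNorm A.op).toReal
  map_zero' := by simp [op_zero, traceNorm_zero]
  add_le' A B := by
    rw [op_add, ← ENNReal.toReal_add A.isTraceClass.ne B.isTraceClass.ne]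
    exact ENNReal.toReal_mono
      (ENNReal.add_lt_top.2 ⟨A.isTraceClass, B.isTraceClass⟩).ne (traceNorm_add_le _ _)
  neg' A := by rw [op_neg, traceNorm_neg]
  eq_zero_of_map_eq_zero' A hA := by
    have h : traceNorm A.op = 0 :=
      ((ENNReal.toReal_eq_zero_iff _).1 hA).resolve_right A.isTraceClass.ne
    have h2 := enorm_le_traceNorm A.op
    rw [h, nonpos_iff_eq_zero, enorm_eq_zero] at h2
    exact op_injective h2

instance : NormedAddCommGroup (TraceClass H) := addGroupNorm.toNormedAddCommGroup

theorem norm_def (A : TraceClass H) : ‖A‖ = (traceNorm A.op).toReal := rfl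

instance : NormedSpace ℂ (TraceClass H) where
  norm_smul_le r A := by
    rw [norm_def, norm_def, op_smul, traceNorm_smul, ENNReal.toReal_mul]
    simp

theorem norm_op_le (A : TraceClass H) : ‖A.op‖ ≤ ‖A‖ := by
  have h := enorm_le_traceNorm A.op
  rw [norm_def, ← toReal_enorm]
  exact ENNReal.toReal_mono A.isTraceClass.ne h

/-- The trace class is a Banach space. -/
instance : CompleteSpace (TraceClass H) := by
  refine Metric.complete_of_cauchySeq_tendsto fun u hu => ?_
  have hu' : CauchySeq fun n => (u n).op := by
    rw [Metric.cauchySeq_iff] at hu ⊢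
    intro ε hε
    obtain ⟨N, hN⟩ := hu ε hε
    refine ⟨N, fun m hm n hn => lt_of_le_of_lt ?_ (hN m hm n hn)⟩
    rw [dist_eq_norm, dist_eq_norm, ← op_sub]
    exact norm_op_le _
  obtain ⟨A, hA⟩ := cauchySeq_tendsto_of_complete hu'
  have key : ∀ ε > 0, ∃ N, ∀ n ≥ N, traceNorm ((u n).op - A) ≤ ENNReal.ofReal ε := by
    intro ε hε
    rw [Metric.cauchySeq_iff] at hu
    obtain ⟨N, hN⟩ := hu ε hε
    refine ⟨N, fun n hn => ?_⟩
    have hcl : IsClosed {B : H →L[ℂ] H | traceNorm ((u n).op - B) ≤ ENNReal.ofReal ε} :=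
      (lowerSemicontinuous_traceNorm.comp
        (continuous_const.sub continuous_id)).isClosed_preimage _
    refine hcl.mem_of_tendsto hA ?_
    filter_upwards [eventually_ge_atTop N] with m hm
    have h1 := hN n hn m hm
    rw [dist_eq_norm, norm_def, op_sub] at h1
    exact (ENNReal.le_ofReal_iff_toReal_le (u n - u m).isTraceClass.ne hε.le).2 h1.le
  have hAt : IsTraceClass A := by
    obtain ⟨N, hN⟩ := key 1 one_pos
    have h1 : A = (u N).op - ((u N).op - A) := by abel
    have h2 : (u N).op - A ∈ traceClassSubmodule H :=
      (hN N le_rfl).trans_lt ENNReal.ofReal_lt_top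
    have h3 : A ∈ traceClassSubmodule H := by
      rw [h1]; exact Submodule.sub_mem _ (u N).isTraceClass h2
    exact h3
  refine ⟨mk A hAt, ?_⟩
  rw [Metric.tendsto_atTop]
  intro ε hε
  obtain ⟨N, hN⟩ := key (ε / 2) (by positivity)
  refine ⟨N, fun n hn => ?_⟩
  rw [dist_eq_norm, norm_def, op_sub, op_mk]
  refine lt_of_le_of_lt (ENNReal.toReal_le_of_le_ofReal (by positivity) (hN n hn)) (by linarith)

/-- Measurability of maps into the trace class refers to the Borel σ-algebra of the trace norm. -/
instance : MeasurableSpace (TraceClass H) := borel _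

instance : BorelSpace (TraceClass H) := ⟨rfl⟩

end TraceClass

variable (H)

/-- Density operators: positive trace-class operators of trace one. As a subtype of `TraceClass H`
they carry the trace-norm topology and its Borel σ-algebra. -/
abbrev DensityOp : Type _ := {A : TraceClass H // 0 ≤ A.op ∧ trace A.op = 1}

variable {H}

/-- The bounded operator underlying a density operator. -/
def DensityOp.op (ρ : DensityOp H) : H →L[ℂ] H := TraceClass.op ρ.1

theorem DensityOp.op_nonneg (ρ : DensityOp H) : 0 ≤ ρ.op := ρ.2.1

theorem DensityOp.traceNorm_op (ρ : DensityOp H) : traceNorm ρ.op = 1 := by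
  have h := ρ.2.2
  rw [trace_of_nonneg ρ.2.1] at h
  have h1 : (traceNorm ρ.op).toReal = 1 := by exact_mod_cast h
  rwa [ENNReal.toReal_eq_one_iff] at h1

/-- A positive operator of trace norm one is a density operator. -/
def DensityOp.mk' (A : H →L[ℂ] H) (h0 : 0 ≤ A) (h1 : traceNorm A = 1) : DensityOp H :=
  ⟨TraceClass.mk A (by rw [IsTraceClass, h1]; exact ENNReal.one_lt_top),
    h0, by change trace A = 1; rw [trace_of_nonneg h0, h1]; simp⟩

end TraceClass

/-! ### Hilbert space tensor products -/

section Tensor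

variable {H K : Type*} [NormedAddCommGroup H] [InnerProductSpace ℂ H] [CompleteSpace H]
  [NormedAddCommGroup K] [InnerProductSpace ℂ K] [CompleteSpace K]

variable (H K) in
/-- The Hilbert space tensor product. -/
abbrev HilbertTensor : Type _ := Completion (H ⊗[ℂ] K)

/-- The elementary tensor `u ⊗ v`. -/
def htmul (u : H) (v : K) : HilbertTensor H K := ((u ⊗ₜ[ℂ] v : H ⊗[ℂ] K) : HilbertTensor H K)

/-- The operator `A ⊗ B` on the Hilbert space tensor product. -/
def tensorOp (A : H →L[ℂ] H) (B : K →L[ℂ] K) : HilbertTensor H K →L[ℂ] HilbertTensor H K :=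
  (TensorProduct.mapL A B).completion

set_option linter.unusedSectionVars false in
theorem tensorOp_htmul (A : H →L[ℂ] H) (B : K →L[ℂ] K) (u : H) (v : K) :
    tensorOp A B (htmul u v) = htmul (A u) (B v) := by
  unfold tensorOp htmul
  rw [ContinuousLinearMap.completion_apply_coe, TensorProduct.mapL_tmul]

set_option linter.unusedSectionVars false in
theorem inner_htmul (u u' : H) (v v' : K) :
    inner ℂ (htmul u v) (htmul u' v') = inner ℂ u u' * inner ℂ v v' := by
  unfold htmul
  rw [Completion.inner_coe, TensorProduct.inner_tmul]

set_option linter.unusedSectionVars false in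
theorem enorm_htmul (u : H) (v : K) : ‖htmul u v‖ₑ = ‖u‖ₑ * ‖v‖ₑ := by
  unfold htmul
  rw [← ofReal_norm, Completion.norm_coe, TensorProduct.norm_tmul,
    ENNReal.ofReal_mul (norm_nonneg _), ofReal_norm, ofReal_norm]

set_option linter.unusedSectionVars false in
set_option linter.unusedSectionVars false in
theorem dense_span_htmul :
    (Submodule.span ℂ {x : HilbertTensor H K | ∃ u v, x = htmul u v}).topologicalClosure = ⊤ := by
  rw [eq_top_iff]
  intro x _
  refine closure_mono (s := Set.range ((↑) : H ⊗[ℂ] K → HilbertTensor H K)) ?_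
    (Completion.denseRange_coe x)
  rintro _ ⟨y, rfl⟩
  induction y using TensorProduct.induction_on with
  | zero => rw [Completion.coe_zero]; exact Submodule.zero_mem _
  | tmul u v => exact Submodule.subset_span ⟨u, v, rfl⟩
  | add y z hy hz => rw [Completion.coe_add]; exact Submodule.add_mem _ hy hz

theorem ext_htmul {T S : HilbertTensor H K →L[ℂ] HilbertTensor H K}
    (h : ∀ u v, T (htmul u v) = S (htmul u v)) : T = S := by
  refine ContinuousLinearMap.ext_on (s := {x | ∃ u v, x = htmul u v}) ?_ ?_
  · rw [Submodule.dense_iff_topologicalClosure_eq_top]; exact dense_span_htmul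
  · rintro _ ⟨u, v, rfl⟩; exact h u v

theorem tensorOp_mul (A A' : H →L[ℂ] H) (B B' : K →L[ℂ] K) :
    tensorOp A B * tensorOp A' B' = tensorOp (A * A') (B * B') := by
  refine ext_htmul fun u v => ?_
  rw [mul_apply_eq_comp, tensorOp_htmul, tensorOp_htmul, tensorOp_htmul]
  rfl

theorem tensorOp_star (A : H →L[ℂ] H) (B : K →L[ℂ] K) :
    star (tensorOp A B) = tensorOp (star A) (star B) := by
  refine ext_htmul fun u v => ?_
  have hd : Dense (Submodule.span ℂ {x : HilbertTensor H K | ∃ u v, x = htmul u v} :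
      Set (HilbertTensor H K)) := by
    rw [Submodule.dense_iff_topologicalClosure_eq_top]; exact dense_span_htmul
  refine hd.eq_of_inner_left (𝕜 := ℂ) fun x hx => ?_
  induction hx using Submodule.span_induction with
  | mem x hx =>
    obtain ⟨u', v', rfl⟩ := hx
    rw [ContinuousLinearMap.star_eq_adjoint, ContinuousLinearMap.adjoint_inner_left,
      tensorOp_htmul, tensorOp_htmul, inner_htmul, inner_htmul,
      ContinuousLinearMap.star_eq_adjoint, ContinuousLinearMap.adjoint_inner_left,
      ContinuousLinearMap.star_eq_adjoint, ContinuousLinearMap.adjoint_inner_left]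
  | zero => rw [inner_zero_right, inner_zero_right]
  | add x y _ _ hx hy => rw [inner_add_right, inner_add_right, hx, hy]
  | smul a x _ hx => rw [inner_smul_right, inner_smul_right, hx]

/-- Elementary tensors of Hilbert bases form a Hilbert basis. -/
def tensorBasis {ι κ : Type*} (b : HilbertBasis ι ℂ H) (c : HilbertBasis κ ℂ K) :
    HilbertBasis (ι × κ) ℂ (HilbertTensor H K) :=
  HilbertBasis.mk (v := fun p : ι × κ => htmul (b p.1) (c p.2))
    (by
      classical
      rw [orthonormal_iff_ite]
      rintro ⟨i, j⟩ ⟨i', j'⟩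
      rw [inner_htmul, orthonormal_iff_ite.1 b.orthonormal, orthonormal_iff_ite.1 c.orthonormal]
      by_cases h1 : i = i' <;> by_cases h2 : j = j' <;> simp [h1, h2])
    (by
      set V := (Submodule.span ℂ
        (Set.range fun p : ι × κ => htmul (b p.1) (c p.2))).topologicalClosure with hV
      have hcl : IsClosed (V : Set (HilbertTensor H K)) :=
        Submodule.isClosed_topologicalClosure _
      have hc1 : ∀ u : H, Continuous fun v : K => htmul u v := fun u =>
        (Completion.continuous_coe _).comp (TensorProduct.mkL ℂ H K u).continuous
      have hc2 : ∀ v : K, Continuous fun u : H => htmul u v := fun v =>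
        (Completion.continuous_coe _).comp ((TensorProduct.mkL ℂ H K).flip v).continuous
      have hadd1 : ∀ (u : H) (v w : K), htmul u (v + w) = htmul u v + htmul u w := by
        intro u v w; unfold htmul; rw [TensorProduct.tmul_add, Completion.coe_add]
      have hsm1 : ∀ (a : ℂ) (u : H) (v : K), htmul u (a • v) = a • htmul u v := by
        intro a u v; unfold htmul; rw [TensorProduct.tmul_smul, Completion.coe_smul]
      have hadd2 : ∀ (u w : H) (v : K), htmul (u + w) v = htmul u v + htmul w v := by
        intro u v w; unfold htmul; rw [TensorProduct.add_tmul, Completion.coe_add]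
      have hsm2 : ∀ (a : ℂ) (u : H) (v : K), htmul (a • u) v = a • htmul u v := by
        intro a u v; unfold htmul; rw [← TensorProduct.smul_tmul', Completion.coe_smul]
      have step1 : ∀ i v, htmul (b i) v ∈ V := by
        intro i v
        let L : Submodule ℂ K :=
          { carrier := {v | htmul (b i) v ∈ V}
            zero_mem' := by
              have : htmul (b i) (0 : K) = 0 := by
                unfold htmul; rw [TensorProduct.tmul_zero, Completion.coe_zero]
              simp only [Set.mem_ofPred_eq, this]; exact V.zero_mem
            add_mem' := fun {v w} hv hw => by
              simp only [Set.mem_ofPred_eq, hadd1]; exact V.add_mem hv hw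
            smul_mem' := fun a v hv => by
              simp only [Set.mem_ofPred_eq, hsm1]; exact V.smul_mem a hv }
        have hLc : IsClosed (L : Set K) := hcl.preimage (hc1 (b i))
        have hL : Submodule.span ℂ (Set.range c) ≤ L := by
          rw [Submodule.span_le]
          rintro _ ⟨j, rfl⟩
          exact Submodule.le_topologicalClosure _ (Submodule.subset_span ⟨(i, j), rfl⟩)
        have := Submodule.topologicalClosure_minimal _ hL hLc
        rw [c.dense_span] at this
        exact this (Submodule.mem_top (x := v))
      have step2 : ∀ u v, htmul u v ∈ V := by
        intro u v
        let L : Submodule ℂ H :=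
          { carrier := {u | htmul u v ∈ V}
            zero_mem' := by
              have : htmul (0 : H) v = 0 := by
                unfold htmul; rw [TensorProduct.zero_tmul, Completion.coe_zero]
              simp only [Set.mem_ofPred_eq, this]; exact V.zero_mem
            add_mem' := fun {u w} hv hw => by
              simp only [Set.mem_ofPred_eq, hadd2]; exact V.add_mem hv hw
            smul_mem' := fun a u hv => by
              simp only [Set.mem_ofPred_eq, hsm2]; exact V.smul_mem a hv }
        have hLc : IsClosed (L : Set H) := hcl.preimage (hc2 v)
        have hL : Submodule.span ℂ (Set.range b) ≤ L := by
          rw [Submodule.span_le]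
          rintro _ ⟨i, rfl⟩
          exact step1 i v
        have := Submodule.topologicalClosure_minimal _ hL hLc
        rw [b.dense_span] at this
        exact this (Submodule.mem_top (x := u))
      rw [← dense_span_htmul (H := H) (K := K)]
      refine Submodule.topologicalClosure_minimal _ ?_ hcl
      rw [Submodule.span_le]
      rintro _ ⟨u, v, rfl⟩
      exact step2 u v)

theorem tensorBasis_apply {ι κ : Type*} (b : HilbertBasis ι ℂ H) (c : HilbertBasis κ ℂ K)
    (p : ι × κ) : tensorBasis b c p = htmul (b p.1) (c p.2) := by
  unfold tensorBasis
  rw [HilbertBasis.coe_mk]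

theorem tensorOp_nonneg_and_traceNorm {A : H →L[ℂ] H} {B : K →L[ℂ] K} (hA : 0 ≤ A) (hB : 0 ≤ B) :
    0 ≤ tensorOp A B ∧ traceNorm (tensorOp A B) = traceNorm A * traceNorm B := by
  obtain ⟨S, hS, hSS⟩ := exists_sqrt hA
  obtain ⟨T, hT, hTT⟩ := exists_sqrt hB
  have hSS' : star S * S = A := by rw [hS, hSS]
  have hTT' : star T * T = B := by rw [hT, hTT]
  have h : star (tensorOp S T) * tensorOp S T = tensorOp A B := by
    rw [tensorOp_star, tensorOp_mul, hSS', hTT']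
  refine ⟨h ▸ star_mul_self_nonneg (tensorOp S T), ?_⟩
  rw [traceNorm_of_nonneg (tensorBasis (stdBasis H) (stdBasis K)) h,
    traceNorm_of_nonneg (stdBasis H) hSS', traceNorm_of_nonneg (stdBasis K) hTT']
  unfold hsSq
  simp_rw [tensorBasis_apply, tensorOp_htmul, enorm_htmul, mul_pow]
  rw [ENNReal.tsum_prod (f := fun i j => ‖S (stdBasis H i)‖ₑ ^ 2 * ‖T (stdBasis K j)‖ₑ ^ 2)]
  simp_rw [ENNReal.tsum_mul_left, ENNReal.tsum_mul_right]

/-- The product state `ρ ⊗ σ`. -/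
def DensityOp.tensor (ρ : DensityOp H) (σ : DensityOp K) : DensityOp (HilbertTensor H K) :=
  DensityOp.mk' (tensorOp ρ.op σ.op) (tensorOp_nonneg_and_traceNorm ρ.op_nonneg σ.op_nonneg).1
    (by rw [(tensorOp_nonneg_and_traceNorm ρ.op_nonneg σ.op_nonneg).2, ρ.traceNorm_op,
      σ.traceNorm_op, one_mul])

end Tensor

section TensorPower

/-- A complex Hilbert space, as a bundled object. -/
structure HilbertSpace.{u} where
  carrier : Type u
  [normedAddCommGroup : NormedAddCommGroup carrier]
  [innerProductSpace : InnerProductSpace ℂ carrier]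
  [completeSpace : CompleteSpace carrier]

attribute [instance] HilbertSpace.normedAddCommGroup HilbertSpace.innerProductSpace
  HilbertSpace.completeSpace

universe u

variable (H : Type u) [NormedAddCommGroup H] [InnerProductSpace ℂ H] [CompleteSpace H]

/-- The Hilbert space `H^{⊗ n}`: one-dimensional for `n = 0`, and
`H^{⊗ (n+1)} = H ⊗ H^{⊗ n}`. -/
def hilbertPower : ℕ → HilbertSpace.{u}
  | 0 => ⟨EuclideanSpace ℂ PUnit.{u + 1}⟩
  | n + 1 => ⟨HilbertTensor H (hilbertPower n).carrier⟩

/-- The underlying space of `H^{⊗ n}`. -/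
abbrev TensorPower (n : ℕ) : Type u := (hilbertPower H n).carrier

theorem traceNorm_one_unit :
    traceNorm (1 : EuclideanSpace ℂ PUnit.{u + 1} →L[ℂ] EuclideanSpace ℂ PUnit.{u + 1}) = 1 := by
  rw [traceNorm_of_nonneg (EuclideanSpace.basisFun PUnit.{u + 1} ℂ).toHilbertBasis
    (S := 1) (by simp), hsSq]
  have h : ∀ i : PUnit.{u + 1}, ‖(EuclideanSpace.basisFun PUnit.{u + 1} ℂ).toHilbertBasis i‖ₑ = 1 :=
    fun i => (EuclideanSpace.basisFun PUnit.{u + 1} ℂ).toHilbertBasis.orthonormal.enorm_eq_one i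
  simp only [one_apply_eq_self, h]
  simp

variable {H}

/-- The product state `ρ₀ ⊗ ⋯ ⊗ ρₙ₋₁` on `H^{⊗ n}`. -/
def productState : (n : ℕ) → (Fin n → DensityOp H) → DensityOp (TensorPower H n)
  | 0, _ => DensityOp.mk' (H := EuclideanSpace ℂ PUnit.{u + 1}) 1 zero_le_one traceNorm_one_unit
  | n + 1, ρ => DensityOp.tensor (ρ 0) (productState n (Fin.tail ρ))

end TensorPower

/-! ### Information quantities -/

section Information

variable {X Y : Type*} [MeasurableSpace X] [MeasurableSpace Y]

/-- `f` is a jointly measurable version of the Radon-Nikodym derivatives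
`x ↦ dW(·, x) / dP̂`, where `P̂ = W ∘ₘ P` is the output distribution of the channel `W` under the
input distribution `P`; in particular, `W(·, x)` is absolutely continuous with respect to `P̂` for
`P`-almost every `x`. -/
structure IsOutputDensity (P : Measure X) (W : Kernel X Y) (f : X → Y → ℝ≥0∞) : Prop where
  measurable : Measurable (Function.uncurry f)
  absolutelyContinuous : ∀ᵐ x ∂P, W x ≪ W ∘ₘ P
  ae_eq_rnDeriv : ∀ᵐ x ∂P, f x =ᵐ[W ∘ₘ P] (W x).rnDeriv (W ∘ₘ P)

/-- The information density `log (dW(·, x) / dP̂) (y)`, in nats. -/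
def infoDensity (f : X → Y → ℝ≥0∞) (x : X) (y : Y) : ℝ := Real.log (f x y).toReal

/-- The mutual information `I(P, W)`: the expectation of the information density under the joint
law `P ⊗ₘ W` of channel input and output. -/
def mutualInfo (P : Measure X) (W : Kernel X Y) (f : X → Y → ℝ≥0∞) : ℝ :=
  ∫ p, infoDensity f p.1 p.2 ∂(P ⊗ₘ W)

variable {H : Type*} [NormedAddCommGroup H] [InnerProductSpace ℂ H] [CompleteSpace H]

/-- The output state `D_P = 𝔼 D(X)` of a classical-quantum channel, as a Bochner integral in the
trace class. -/
def averageState (P : Measure X) (D : X → DensityOp H) : TraceClass H := ∫ x, (D x).1 ∂P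

/-- The operator `A log A` (with `0 log 0 = 0`). -/
def mulLogOp (A : H →L[ℂ] H) : H →L[ℂ] H := cfc (fun t : ℝ => t * Real.log t) A

open Classical in
/-- The quantum mutual information `I(P, D) = 𝔼 tr (D(X) log D(X)) - tr (D_P log D_P)`, set to `∞`
if `D(X) log D(X)` fails to be trace class on a non-null set or `D_P log D_P` is not trace class. -/
def quantumInfo (P : Measure X) (D : X → DensityOp H) : EReal :=
  if (∀ᵐ x ∂P, IsTraceClass (mulLogOp (D x).op)) ∧
      IsTraceClass (mulLogOp (averageState P D).op) then
    ((∫ x, (trace (mulLogOp (D x).op)).re ∂P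
      - (trace (mulLogOp (averageState P D).op)).re : ℝ) : EReal)
  else ⊤

end Information

/-! ### Wiretap codes -/

section Codes

/-- A wiretap code of size `M` and block length `n`, for a channel with input alphabet `X` and
legitimate output alphabet `Y`: a stochastic encoder and a deterministic (measurable) decoder. The
decoder forces `M ≥ 1` as soon as `Y` is nonempty. -/
structure WiretapCode (X Y : Type*) [MeasurableSpace X] [MeasurableSpace Y] (n M : ℕ) where
  enc : Kernel (Fin M) (Fin n → X)
  isMarkovKernel_enc : IsMarkovKernel enc
  dec : (Fin n → Y) → Fin M
  measurable_dec : Measurable dec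

variable {X Y : Type*} [MeasurableSpace X] [MeasurableSpace Y] {n M : ℕ}

/-- The memoryless extension `Wⁿ(·, xⁿ) = ∏ᵢ W(·, xᵢ)`. -/
def channelPower (W : Kernel X Y) (x : Fin n → X) : Measure (Fin n → Y) :=
  Measure.pi fun i => W (x i)

namespace WiretapCode

/-- The rate `log M / n`, in nats per channel use. -/
def rate (_C : WiretapCode X Y n M) : ℝ := Real.log M / n

/-- The average over uniformly distributed messages of the probability of a decoding error. -/
def averageError (C : WiretapCode X Y n M) (W : Kernel X Y) : ℝ≥0∞ :=
  (∑ m, ∫⁻ x, channelPower W x {y | C.dec y ≠ m} ∂(C.enc m)) / M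

variable {H : Type*} [NormedAddCommGroup H] [InnerProductSpace ℂ H] [CompleteSpace H]

/-- The eavesdropper's state `Dⁿ ∘ Enc(m) = ∫ D(x₁) ⊗ ⋯ ⊗ D(xₙ) Enc(dxⁿ, m)`, as a Bochner integral
in the trace class of `H^{⊗ n}`. -/
def eavesdropperState (C : WiretapCode X Y n M) (D : X → DensityOp H) (m : Fin M) :
    TraceClass (TensorPower H n) :=
  ∫ x, (productState n fun i => D (x i)).1 ∂(C.enc m)

/-- The code has distinguishing security level `δ`: any two messages lead to eavesdropper states
at trace-norm distance at most `δ`. -/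
def HasSecurityLevel (C : WiretapCode X Y n M) (D : X → DensityOp H) (δ : ℝ) : Prop :=
  ∀ m₁ m₂ : Fin M, ‖C.eavesdropperState D m₁ - C.eavesdropperState D m₂‖ ≤ δ

end WiretapCode

end Codes

end Wiretap

end

/-! The proof combines random coding with a threshold decoder for reliability and soft covering for
secrecy. Write `E = ∫ tr (D log D) dP` and `S = -tr (D_P log D_P)`, so that `I(P, D) = E + S`. For
`R > 0` draw codewords independently from `Pⁿ`, `L ≈ exp (n (E + S + 5δ))` for each of `2 * M`
messages with `M ≈ exp (n R)`; a message is encoded by a uniformly chosen one of its codewords.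

Reliability: a codeword is accepted if its likelihood ratio exceeds `exp (n (I - 2δ))`. The true
codeword is rarely rejected, by Markov's inequality for a small negative power of the ratio: the
moment generating function of the information density has derivative `I` at `0`
(`exists_mgf_neg_le`). An independent codeword has likelihood ratio of mean at most one, so Markov's
inequality and a union bound over about `exp (n (I - 3δ))` codewords control confusion
(`lintegral_errorBound_le`).

Secrecy: replace each product state by a truncation, with its eigenvalues clipped at `r ≈ exp (n E)`
and then compressed by an operator that suppresses the spectral part of the average state below `θ ≈
exp (-n S)`. The difference of the averages of two messages becomes a centred sum of independent
operators. Its Hilbert-Schmidt variance is of order `r / L`, and Cauchy-Schwarz passes to the trace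
norm at the price `1 / θ` (`lintegral_traceNorm_weighted_sum_le`). The exponent of `r / (L * θ)` is
negative by the choice of `L`.

The truncation loss is bounded, in the manner of Chernoff, by `tr ρ ^ (1 + s')` and `tr D_P ^ (1 -
s)`, which are multiplicative on tensor products and whose first order behaviour at exponent one is
the entropy (`exists_averageLoss_le`). In infinite dimension the first expansion is obtained by
Fatou's lemma, the second by bounding the remainder with the trace-class power of `D_P`.

One codebook satisfies both averaged bounds up to a factor two, and discarding the worse half of the
messages makes security uniform (`exists_wiretapCode`). -/

noncomputable section

namespace Wiretap

set_option linter.unusedSectionVars false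

/-! ### Inequalities between trace norm and Hilbert-Schmidt norm. -/

section TraceCalculus

variable {H : Type*} [NormedAddCommGroup H] [InnerProductSpace ℂ H] [CompleteSpace H]

/-- Expand `c⁻¹ * (c * ‖u‖ - ‖v‖) ^ 2 ≥ 0`. The free weight `c` replaces the square roots of the
Cauchy-Schwarz inequality and is later used to balance a large factor against a small one. -/
theorem enorm_mul_enorm_le {E F : Type*} [NormedAddCommGroup E] [NormedAddCommGroup F]
    {c : ℝ} (hc : 0 < c) (u : E) (v : F) :
    ‖u‖ₑ * ‖v‖ₑ ≤ 2⁻¹ * (ENNReal.ofReal c * ‖u‖ₑ ^ 2 + ENNReal.ofReal c⁻¹ * ‖v‖ₑ ^ 2) := by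
  have h2 : (2⁻¹ : ℝ≥0∞) = ENNReal.ofReal 2⁻¹ := by
    rw [ENNReal.ofReal_inv_of_pos (by norm_num)]; simp
  have hci : 0 < c⁻¹ := inv_pos.2 hc
  rw [← ofReal_norm, ← ofReal_norm, h2, ← ENNReal.ofReal_pow (norm_nonneg _),
    ← ENNReal.ofReal_pow (norm_nonneg _), ← ENNReal.ofReal_mul (norm_nonneg _),
    ← ENNReal.ofReal_mul hc.le, ← ENNReal.ofReal_mul hci.le,
    ← ENNReal.ofReal_add (by positivity) (by positivity), ← ENNReal.ofReal_mul (by norm_num)]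
  refine ENNReal.ofReal_le_ofReal ?_
  have h := mul_nonneg hci.le (sq_nonneg (c * ‖u‖ - ‖v‖))
  have h3 : c⁻¹ * (c * ‖u‖ - ‖v‖) ^ 2 = c * ‖u‖ ^ 2 - 2 * (‖u‖ * ‖v‖) + c⁻¹ * ‖v‖ ^ 2 := by
    field_simp
    ring
  linarith

theorem hsSq_mul_le {ι : Type*} (b : HilbertBasis ι ℂ H) (T K : H →L[ℂ] H) (hK : ‖K‖ ≤ 1) :
    hsSq b (T * K) ≤ hsSq b T := by
  rw [← hsSq_adjoint b b (T * K), ← hsSq_adjoint b b T, ← ContinuousLinearMap.star_eq_adjoint,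
    ← ContinuousLinearMap.star_eq_adjoint, star_mul]
  exact hsSq_comp_le b _ _ (by rwa [norm_star])

theorem hsSq_star {ι : Type*} (b : HilbertBasis ι ℂ H) (T : H →L[ℂ] H) :
    hsSq b (star T) = hsSq b T := by
  rw [ContinuousLinearMap.star_eq_adjoint, hsSq_adjoint b b]

/-- A weighted form of the Cauchy-Schwarz inequality for the trace norm. -/
theorem traceNorm_mul_le_hsSq {c : ℝ} (hc : 0 < c) (S T : H →L[ℂ] H) :
    traceNorm (S * T) ≤ 2⁻¹ * (ENNReal.ofReal c * hsSq (stdBasis H) S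
      + ENNReal.ofReal c⁻¹ * hsSq (stdBasis H) T) := by
  obtain ⟨W, hW, -, hWA⟩ := exists_polar (S * T)
  have key : ∀ v : H, ENNReal.ofReal (inner ℂ v (CFC.abs (S * T) v)).re ≤
      2⁻¹ * (ENNReal.ofReal c * ‖(star S * W) v‖ₑ ^ 2 + ENNReal.ofReal c⁻¹ * ‖T v‖ₑ ^ 2) := by
    intro v
    -- Since `|S T| = W* S T`, the diagonal entry is `⟪S* W v, T v⟫`.
    refine le_trans ?_ (enorm_mul_enorm_le hc _ _)
    rw [← hWA, ← ofReal_norm, ← ofReal_norm, ← ENNReal.ofReal_mul (norm_nonneg _)]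
    refine ENNReal.ofReal_le_ofReal ((Complex.re_le_norm _).trans ?_)
    refine le_trans (le_of_eq ?_) (norm_inner_le_norm (𝕜 := ℂ) ((star S * W) v) (T v))
    congr 1
    rw [mul_apply_eq_comp, mul_apply_eq_comp, mul_apply_eq_comp,
      ContinuousLinearMap.star_eq_adjoint,
      ContinuousLinearMap.star_eq_adjoint, ContinuousLinearMap.adjoint_inner_left,
      ContinuousLinearMap.adjoint_inner_right]
  refine (ENNReal.tsum_le_tsum fun i => key _).trans ?_
  rw [ENNReal.tsum_mul_left, ENNReal.tsum_add, ENNReal.tsum_mul_left, ENNReal.tsum_mul_left]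
  refine mul_le_mul' le_rfl (add_le_add (mul_le_mul' le_rfl ?_) le_rfl)
  refine (hsSq_mul_le (stdBasis H) (star S) W hW).trans ?_
  rw [hsSq_star]

theorem two_inv_mul_add_self (a : ℝ≥0∞) : 2⁻¹ * (a + a) = a := by
  rw [← two_mul, ← mul_assoc, ENNReal.inv_mul_cancel (by norm_num) (by norm_num), one_mul]

/-- With `A = W |A|` and `|A| = S * S`, the product splits as `(W S) (S V)`, and contractions do not
increase the Hilbert-Schmidt norm of `S`, whose square is the trace norm of `A`. -/
theorem traceNorm_mul_le_right (A V : H →L[ℂ] H) (hV : ‖V‖ ≤ 1) :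
    traceNorm (A * V) ≤ traceNorm A := by
  obtain ⟨W, hW, hWA, -⟩ := exists_polar A
  obtain ⟨S, hS, hSS⟩ := exists_sqrt (CFC.abs_nonneg A)
  have hSS' : star S * S = CFC.abs A := by rw [hS, hSS]
  have h1 : A * V = (W * S) * (S * V) := by
    conv_lhs => rw [← hWA, ← hSS]
    simp only [mul_assoc]
  rw [h1, traceNorm_of_sqrt (stdBasis H) hSS']
  refine (traceNorm_mul_le_hsSq one_pos _ _).trans ?_
  rw [inv_one, ENNReal.ofReal_one, one_mul, one_mul]
  conv_rhs => rw [← two_inv_mul_add_self (hsSq (stdBasis H) S)]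
  gcongr
  · exact hsSq_comp_le _ _ _ hW
  · exact hsSq_mul_le _ _ _ hV

theorem traceNorm_mul_le_left (V A : H →L[ℂ] H) (hV : ‖V‖ ≤ 1) :
    traceNorm (V * A) ≤ traceNorm A := by
  obtain ⟨W, hW, hWA, -⟩ := exists_polar A
  obtain ⟨S, hS, hSS⟩ := exists_sqrt (CFC.abs_nonneg A)
  have hSS' : star S * S = CFC.abs A := by rw [hS, hSS]
  have h1 : V * A = (V * W * S) * S := by
    conv_lhs => rw [← hWA, ← hSS]
    simp only [mul_assoc]
  rw [h1, traceNorm_of_sqrt (stdBasis H) hSS']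
  refine (traceNorm_mul_le_hsSq one_pos _ _).trans ?_
  rw [inv_one, ENNReal.ofReal_one, one_mul, one_mul]
  conv_rhs => rw [← two_inv_mul_add_self (hsSq (stdBasis H) S)]
  gcongr
  exact hsSq_comp_le _ _ _ ((norm_mul_le V W).trans (mul_le_one₀ hV (norm_nonneg _) hW))

theorem traceNorm_eq_tsum {A : H →L[ℂ] H} (hA : 0 ≤ A) :
    traceNorm A = ∑' i, ENNReal.ofReal (inner ℂ (stdBasis H i) (A (stdBasis H i))).re := by
  unfold traceNorm
  rw [CFC.abs_of_nonneg A hA]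

theorem re_inner_nonneg {A : H →L[ℂ] H} (hA : 0 ≤ A) (v : H) : 0 ≤ (inner ℂ v (A v)).re := by
  obtain ⟨S, hS, hSS⟩ := exists_sqrt hA
  rw [inner_eq_enorm_sq (S := S) (by rw [hS, hSS]) v]
  norm_cast
  positivity

theorem re_inner_mono {A B : H →L[ℂ] H} (h : A ≤ B) (v : H) :
    (inner ℂ v (A v)).re ≤ (inner ℂ v (B v)).re := by
  have := re_inner_nonneg (sub_nonneg.2 h) v
  rw [sub_apply, inner_sub_right, Complex.sub_re] at this
  linarith

theorem traceNorm_mono {A B : H →L[ℂ] H} (hA : 0 ≤ A) (h : A ≤ B) : traceNorm A ≤ traceNorm B := by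
  rw [traceNorm_eq_tsum hA, traceNorm_eq_tsum (hA.trans h)]
  exact ENNReal.tsum_le_tsum fun i => ENNReal.ofReal_le_ofReal (re_inner_mono h _)

theorem traceNorm_add {A B : H →L[ℂ] H} (hA : 0 ≤ A) (hB : 0 ≤ B) :
    traceNorm (A + B) = traceNorm A + traceNorm B := by
  rw [traceNorm_eq_tsum hA, traceNorm_eq_tsum hB, traceNorm_eq_tsum (add_nonneg hA hB),
    ← ENNReal.tsum_add]
  refine tsum_congr fun i => ?_
  rw [← ENNReal.ofReal_add (re_inner_nonneg hA _) (re_inner_nonneg hB _), add_apply,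
    inner_add_right, Complex.add_re]

theorem traceNorm_real_smul {r : ℝ} (hr : 0 ≤ r) (A : H →L[ℂ] H) :
    traceNorm (r • A) = ENNReal.ofReal r * traceNorm A := by
  have : r • A = (r : ℂ) • A := (RCLike.real_smul_eq_coe_smul (K := ℂ) r A)
  rw [this, traceNorm_smul, ← ofReal_norm, Complex.norm_real, Real.norm_of_nonneg hr]

theorem hsSq_eq_traceNorm (S : H →L[ℂ] H) : hsSq (stdBasis H) S = traceNorm (star S * S) :=
  (traceNorm_of_nonneg _ rfl).symm

/-- The right side depends linearly on `S * S`, so it can be averaged over a random state `S * S`;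
on the left the state is hidden behind its square root. -/
theorem hsSq_mul_sqrt {B S : H →L[ℂ] H} (hB : star B = B) (hS : star S = S) :
    hsSq (stdBasis H) (B * S) = ∑' i, ENNReal.ofReal
      (inner ℂ (B (stdBasis H i)) ((S * S) (B (stdBasis H i)))).re := by
  rw [← hsSq_star, star_mul, hB, hS]
  refine tsum_congr fun i => ?_
  rw [ofReal_re_inner (S := S) (by rw [hS])]
  rfl

theorem hsSq_mul_sqrt_eq_traceNorm {B S : H →L[ℂ] H} (hB : star B = B) (hS : star S = S) :
    hsSq (stdBasis H) (B * S) = traceNorm (B * (S * S) * B) := by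
  rw [← hsSq_star, hsSq_eq_traceNorm]
  simp only [star_mul, hB, hS, mul_assoc]

/-- A form of the gentle measurement lemma. -/
theorem traceNorm_sub_conj_le {c : ℝ} (hc : 0 < c) {G S : H →L[ℂ] H} (hG : star G = G)
    (hG1 : ‖G‖ ≤ 1) (hS : star S = S) (hS1 : hsSq (stdBasis H) S ≤ 1) :
    traceNorm (S * S - G * (S * S) * G) ≤ ENNReal.ofReal c
      + ENNReal.ofReal c⁻¹ * hsSq (stdBasis H) ((1 - G) * S) := by
  have hci : 0 < c⁻¹ := inv_pos.2 hc
  -- In each summand one factor has Hilbert-Schmidt norm at most one and the other measures what `G`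
  -- removes from the state.
  have h1 : S * S - G * (S * S) * G = (1 - G) * S * S + (G * S) * (S * (1 - G)) := by
    noncomm_ring
  have h2 : hsSq (stdBasis H) (S * (1 - G)) = hsSq (stdBasis H) ((1 - G) * S) := by
    rw [← hsSq_star, star_mul, star_sub, star_one, hG, hS]
  rw [h1]
  refine (traceNorm_add_le _ _).trans ?_
  conv_rhs => rw [← two_inv_mul_add_self (_ + _), mul_add]
  refine add_le_add ?_ ?_
  · refine (traceNorm_mul_le_hsSq hci _ _).trans ?_
    rw [inv_inv, add_comm]
    gcongr
    exact mul_le_of_le_one_right' hS1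
  · refine (traceNorm_mul_le_hsSq hc _ _).trans ?_
    rw [h2]
    gcongr
    exact mul_le_of_le_one_right' ((hsSq_comp_le _ _ _ hG1).trans hS1)

/-- Cauchy-Schwarz for `G * (A * G)`. Here `hsSq G` plays the role of the dimension of the range of
`G`: it is the price for replacing the trace norm by the Hilbert-Schmidt norm, in which variances
can be computed. -/
theorem traceNorm_conj_le_hsSq {c : ℝ} (hc : 0 < c) {G A : H →L[ℂ] H} (hG1 : ‖G‖ ≤ 1) :
    traceNorm (G * A * G) ≤ 2⁻¹ * (ENNReal.ofReal c * hsSq (stdBasis H) G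
      + ENNReal.ofReal c⁻¹ * hsSq (stdBasis H) A) := by
  rw [mul_assoc]
  refine (traceNorm_mul_le_hsSq hc _ _).trans ?_
  gcongr
  exact hsSq_mul_le _ _ _ hG1

theorem traceNorm_conj_le {G A : H →L[ℂ] H} (hG1 : ‖G‖ ≤ 1) :
    traceNorm (G * A * G) ≤ traceNorm A :=
  (traceNorm_mul_le_right _ _ hG1).trans (traceNorm_mul_le_left _ _ hG1)

theorem traceNorm_conj_le_of_le {G A : H →L[ℂ] H} (hG : star G = G) (hA : 0 ≤ A) {r : ℝ}
    (hr : 0 ≤ r) (hAr : A ≤ r • 1) :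
    traceNorm (G * A * G) ≤ ENNReal.ofReal r * hsSq (stdBasis H) G := by
  have h1 : 0 ≤ G * A * G := by
    have := star_left_conjugate_nonneg hA G
    rwa [hG] at this
  have h2 : G * A * G ≤ r • (G * G) := by
    have := star_left_conjugate_le_conjugate hAr G
    rwa [hG, mul_smul_comm, mul_one, smul_mul_assoc] at this
  refine (traceNorm_mono h1 h2).trans ?_
  rw [traceNorm_real_smul hr, hsSq_eq_traceNorm, hG]

end TraceCalculus

/-! ### Spectral truncations by continuous functional calculus. -/

section FunctionalCalculus

variable {H : Type*} [NormedAddCommGroup H] [InnerProductSpace ℂ H] [CompleteSpace H]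

theorem cfc_mono_of_nonneg {A : H →L[ℂ] H} (hA : 0 ≤ A) {f g : ℝ → ℝ}
    (h : ∀ t, 0 ≤ t → f t ≤ g t) (hf : Continuous f) (hg : Continuous g) : cfc f A ≤ cfc g A :=
  cfc_mono (fun _ hx => h _ (spectrum_nonneg_of_nonneg hA hx)) hf.continuousOn hg.continuousOn

theorem spectrum_subset_Icc {A : H →L[ℂ] H} (hA : 0 ≤ A) (h1 : ‖A‖ ≤ 1) :
    spectrum ℝ A ⊆ Set.Icc 0 1 := by
  intro x hx
  refine ⟨spectrum_nonneg_of_nonneg hA hx, ?_⟩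
  have h2 : A ≤ algebraMap ℝ (H →L[ℂ] H) 1 := by
    rw [map_one]
    exact (CStarAlgebra.norm_le_one_iff_of_nonneg A hA).1 h1
  exact (le_algebraMap_iff_spectrum_le (ha := hA.isSelfAdjoint)).1 h2 x hx

theorem cfc_mono_of_le_one {A : H →L[ℂ] H} (hA : 0 ≤ A) (h1 : ‖A‖ ≤ 1) {f g : ℝ → ℝ}
    (h : ∀ t, 0 ≤ t → t ≤ 1 → f t ≤ g t) (hf : Continuous f) (hg : Continuous g) :
    cfc f A ≤ cfc g A :=
  cfc_mono (fun _ hx => h _ (spectrum_subset_Icc hA h1 hx).1 (spectrum_subset_Icc hA h1 hx).2)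
    hf.continuousOn hg.continuousOn

theorem DensityOp.norm_op_le_one (ρ : DensityOp H) : ‖ρ.op‖ ≤ 1 := by
  have h := enorm_le_traceNorm ρ.op
  rw [ρ.traceNorm_op, ← ofReal_norm] at h
  exact ENNReal.ofReal_le_one.1 h

/-- The part of a positive operator below the level `r`. -/
def lowPart (r : ℝ) (A : H →L[ℂ] H) : H →L[ℂ] H := cfc (fun t : ℝ => min t r) A

theorem continuous_min_const (r : ℝ) : Continuous fun t : ℝ => min t r := by fun_prop

theorem lowPart_nonneg {r : ℝ} (hr : 0 ≤ r) {A : H →L[ℂ] H} (hA : 0 ≤ A) : 0 ≤ lowPart r A :=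
  cfc_nonneg fun _ hx => le_min (spectrum_nonneg_of_nonneg hA hx) hr

theorem lowPart_le_self (r : ℝ) {A : H →L[ℂ] H} (hA : 0 ≤ A) : lowPart r A ≤ A := by
  conv_rhs => rw [← cfc_id ℝ A hA.isSelfAdjoint]
  exact cfc_mono_of_nonneg hA (fun t _ => min_le_left t r) (continuous_min_const r) continuous_id

theorem lowPart_le_smul (r : ℝ) {A : H →L[ℂ] H} (hA : 0 ≤ A) : lowPart r A ≤ r • 1 := by
  rw [← Algebra.algebraMap_eq_smul_one]
  exact cfc_le_algebraMap _ _ _ (fun x _ => min_le_right x r)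
    (continuous_min_const r).continuousOn hA.isSelfAdjoint

theorem star_lowPart (r : ℝ) (A : H →L[ℂ] H) : star (lowPart r A) = lowPart r A :=
  (cfc_predicate (R := ℝ) (p := IsSelfAdjoint) _ A).star_eq

/-- Scalar inequality `min t r ^ 2 ≤ r * t`. -/
theorem hsSq_lowPart_le {r : ℝ} (hr : 0 ≤ r) {A : H →L[ℂ] H} (hA : 0 ≤ A) :
    hsSq (stdBasis H) (lowPart r A) ≤ ENNReal.ofReal r * traceNorm A := by
  have hc := continuous_min_const r
  have h0 : star (lowPart r A) * lowPart r A = cfc (fun t : ℝ => min t r * min t r) A := by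
    rw [star_lowPart, lowPart, cfc_mul _ _ A hc.continuousOn hc.continuousOn]
  rw [hsSq_eq_traceNorm, ← traceNorm_real_smul hr]
  refine traceNorm_mono (star_mul_self_nonneg _) ?_
  rw [h0]
  have h1 : r • A = cfc (fun t : ℝ => r * t) A := by
    conv_lhs => rw [← cfc_id ℝ A hA.isSelfAdjoint]
    rw [← cfc_const_mul r _ A]; rfl
  rw [h1]
  refine cfc_mono_of_nonneg hA (fun t ht => ?_) (hc.mul hc) (by fun_prop)
  exact mul_le_mul (min_le_right _ _) (min_le_left _ _) (le_min ht hr) hr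

theorem rpow_eq_cfc {A : H →L[ℂ] H} (hA : 0 ≤ A) (y : ℝ) :
    A ^ y = cfc (fun t : ℝ => t ^ y) A := CFC.rpow_eq_cfc_real hA

theorem smul_rpow_eq_cfc {A : H →L[ℂ] H} (hA : 0 ≤ A) (r : ℝ) {y : ℝ} (hy : 0 ≤ y) :
    r • A ^ y = cfc (fun t : ℝ => r * t ^ y) A := by
  rw [rpow_eq_cfc hA, ← cfc_const_mul r _ A (Real.continuous_rpow_const hy).continuousOn]

/-- A Chernoff bound for eigenvalues: the excess over `r` is nonzero only for `t > r`, where it is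
at most `t ≤ t * (t / r) ^ s`. The resulting power trace is multiplicative on tensor products. -/
theorem traceNorm_sub_lowPart_le {r s : ℝ} (hr : 0 < r) (hs : 0 ≤ s) {A : H →L[ℂ] H}
    (hA : 0 ≤ A) :
    traceNorm (A - lowPart r A) ≤ ENNReal.ofReal (r ^ (-s)) * traceNorm (A ^ (1 + s)) := by
  have hy : 0 ≤ 1 + s := by linarith
  rw [← traceNorm_real_smul (by positivity)]
  refine traceNorm_mono (sub_nonneg.2 (lowPart_le_self r hA)) ?_
  rw [smul_rpow_eq_cfc hA _ hy]
  have h1 : A - lowPart r A = cfc (fun t : ℝ => t - min t r) A := by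
    rw [lowPart, cfc_sub (fun t => t) _ A continuousOn_id (continuous_min_const r).continuousOn,
      cfc_id' ℝ A hA.isSelfAdjoint]
  rw [h1]
  refine cfc_mono_of_nonneg hA (fun t ht => ?_) (by fun_prop)
    (continuous_const.mul (Real.continuous_rpow_const hy))
  rcases le_or_gt t r with h | h
  · rw [min_eq_left h, sub_self]; positivity
  · rw [min_eq_right h.le]
    have htp : 0 < t := hr.trans h
    have h2 : 1 ≤ (t / r) ^ s := Real.one_le_rpow ((one_le_div hr).2 h.le) hs
    have h3 : r ^ (-s) * t ^ (1 + s) = t * (t / r) ^ s := by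
      rw [Real.rpow_add htp, Real.rpow_one, Real.rpow_neg hr.le, Real.div_rpow ht hr.le]
      field_simp
    rw [h3]
    nlinarith

/-- A smooth version of the spectral projection of a positive operator above the level `r`. -/
def softProj (r : ℝ) (A : H →L[ℂ] H) : H →L[ℂ] H := cfc (fun t : ℝ => min 1 (t / r)) A

theorem continuous_min_one_div (r : ℝ) : Continuous fun t : ℝ => min 1 (t / r) := by fun_prop

theorem star_softProj (r : ℝ) (A : H →L[ℂ] H) : star (softProj r A) = softProj r A :=
  (cfc_predicate (R := ℝ) (p := IsSelfAdjoint) _ A).star_eq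

theorem norm_softProj_le {r : ℝ} (hr : 0 < r) {A : H →L[ℂ] H} (hA : 0 ≤ A) :
    ‖softProj r A‖ ≤ 1 := by
  refine norm_cfc_le zero_le_one fun x hx => ?_
  have := spectrum_nonneg_of_nonneg hA hx
  rw [Real.norm_of_nonneg (by positivity)]
  exact min_le_left _ _

/-- Scalar inequality `min 1 (t / r) ^ 2 ≤ t / r`; it replaces the fact that at most `tr A / r`
eigenvalues lie above `r`, and needs only a continuous function. -/
theorem hsSq_softProj_le {r : ℝ} (hr : 0 < r) {A : H →L[ℂ] H} (hA : 0 ≤ A) :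
    hsSq (stdBasis H) (softProj r A) ≤ ENNReal.ofReal r⁻¹ * traceNorm A := by
  have hc := continuous_min_one_div r
  have h0 : star (softProj r A) * softProj r A
      = cfc (fun t : ℝ => min 1 (t / r) * min 1 (t / r)) A := by
    rw [star_softProj, softProj, cfc_mul _ _ A hc.continuousOn hc.continuousOn]
  rw [hsSq_eq_traceNorm, ← traceNorm_real_smul (by positivity)]
  refine traceNorm_mono (star_mul_self_nonneg _) ?_
  have h1 : r⁻¹ • A = cfc (fun t : ℝ => r⁻¹ * t) A := by
    conv_lhs => rw [← cfc_id ℝ A hA.isSelfAdjoint]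
    rw [← cfc_const_mul r⁻¹ _ A]; rfl
  rw [h0, h1]
  refine cfc_mono_of_nonneg hA (fun t ht => ?_) (hc.mul hc) (by fun_prop)
  have h2 : 0 ≤ t / r := by positivity
  refine (mul_le_mul (min_le_left _ _) (min_le_right _ _) (le_min zero_le_one h2)
    zero_le_one).trans (le_of_eq ?_)
  field_simp

/-- The counterpart for small eigenvalues: `1 - softProj` vanishes for `t ≥ r`, and for `t < r` one
has `t = t ^ s * t ^ (1 - s) ≤ r ^ s * t ^ (1 - s)`. -/
theorem hsSq_one_sub_softProj_mul_le {r s : ℝ} (hr : 0 < r) (hs : 0 ≤ s) (hs1 : s ≤ 1)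
    {A S : H →L[ℂ] H} (hA : 0 ≤ A) (hS : star S = S) (hSS : S * S = A) :
    hsSq (stdBasis H) ((1 - softProj r A) * S)
      ≤ ENNReal.ofReal (r ^ s) * traceNorm (A ^ (1 - s)) := by
  have hy : 0 ≤ 1 - s := by linarith
  have hc := continuous_min_one_div r
  have hc1 : Continuous fun t : ℝ => 1 - min 1 (t / r) := by fun_prop
  have hB : star (1 - softProj r A) = 1 - softProj r A := by
    rw [star_sub, star_one, star_softProj]
  have hsa := hA.isSelfAdjoint
  have h1 : 1 - softProj r A = cfc (fun t : ℝ => 1 - min 1 (t / r)) A := by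
    rw [softProj, cfc_sub _ _ A continuousOn_const hc.continuousOn, cfc_const_one ℝ A]
  have h0 : (1 - softProj r A) * A * (1 - softProj r A)
      = cfc (fun t : ℝ => (1 - min 1 (t / r)) * t * (1 - min 1 (t / r))) A := by
    rw [cfc_mul (fun t => (1 - min 1 (t / r)) * t) _ A (hc1.mul continuous_id).continuousOn
      hc1.continuousOn, cfc_mul _ (fun t => t) A hc1.continuousOn continuousOn_id, ← h1, cfc_id' ℝ A hsa]
  rw [hsSq_mul_sqrt_eq_traceNorm hB hS, hSS, ← traceNorm_real_smul (by positivity),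
    smul_rpow_eq_cfc hA _ hy]
  refine traceNorm_mono ?_ ?_
  · have := star_left_conjugate_nonneg hA (1 - softProj r A)
    rwa [hB] at this
  rw [h0]
  refine cfc_mono_of_nonneg hA (fun t ht => ?_) (by fun_prop)
    (continuous_const.mul (Real.continuous_rpow_const hy))
  rcases le_or_gt r t with h | h
  · rw [min_eq_left ((one_le_div hr).2 h), sub_self]
    simp only [zero_mul]
    positivity
  · have h2 : t / r < 1 := (div_lt_one hr).2 h
    have h3 : 0 ≤ t / r := by positivity
    rw [min_eq_right h2.le]
    have h4 : t ≤ r ^ s * t ^ (1 - s) := by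
      rcases ht.eq_or_lt with h5 | h5
      · rw [← h5]; positivity
      · calc t = t ^ s * t ^ (1 - s) := by
              rw [← Real.rpow_add h5]; simp
          _ ≤ r ^ s * t ^ (1 - s) := by gcongr
    refine le_trans ?_ h4
    have h6 : (1 - t / r) * t ≤ t := by nlinarith
    have h7 : 0 ≤ (1 - t / r) * t := mul_nonneg (by linarith) ht
    nlinarith

/-- All density operators have spectrum in the one compact set `[0, 1]`, and the trace norm
dominates the operator norm. This is the source of measurability for functions of a random state. -/
theorem continuousOn_cfc_density (f : ℝ → ℝ) (hf : ContinuousOn f (Set.Icc 0 1)) :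
    Continuous fun ρ : DensityOp H => cfc f ρ.op := by
  have hop : Continuous fun ρ : DensityOp H => ρ.op := by
    have h1 : LipschitzWith 1 (TraceClass.op : TraceClass H → (H →L[ℂ] H)) := by
      refine LipschitzWith.of_dist_le_mul fun A B => ?_
      rw [dist_eq_norm, dist_eq_norm, ← TraceClass.op_sub, NNReal.coe_one, one_mul]
      exact TraceClass.norm_op_le _
    exact h1.continuous.comp continuous_subtype_val
  exact Continuous.cfc' isCompact_Icc f hop
    (fun ρ => spectrum_subset_Icc ρ.op_nonneg ρ.norm_op_le_one) hf
    (fun ρ => ρ.op_nonneg.isSelfAdjoint)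

end FunctionalCalculus

/-! ### First order expansion of `tr ρ ^ (1 ± s)` around the entropy. -/

section Entropy

variable {H : Type*} [NormedAddCommGroup H] [InnerProductSpace ℂ H] [CompleteSpace H]

/-- The operator `-A log A`. -/
def negMulLogOp (A : H →L[ℂ] H) : H →L[ℂ] H := cfc Real.negMulLog A

theorem mulLogOp_eq_neg (A : H →L[ℂ] H) : mulLogOp A = -negMulLogOp A := by
  rw [mulLogOp, negMulLogOp, ← cfc_neg]
  congr 1
  funext t
  simp [Real.negMulLog]

theorem negMulLogOp_nonneg (ρ : DensityOp H) : 0 ≤ negMulLogOp ρ.op :=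
  cfc_nonneg fun _ hx =>
    Real.negMulLog_nonneg (spectrum_subset_Icc ρ.op_nonneg ρ.norm_op_le_one hx).1
      (spectrum_subset_Icc ρ.op_nonneg ρ.norm_op_le_one hx).2

theorem trace_neg (A : H →L[ℂ] H) : trace (-A) = -trace A := by
  unfold trace
  rw [← tsum_neg]
  simp

/-- Holds also when `ρ log ρ` is not trace class: then both sides are zero, by the conventions for
`tsum` and `toReal`. -/
theorem re_trace_mulLogOp (ρ : DensityOp H) :
    (trace (mulLogOp ρ.op)).re = -(traceNorm (negMulLogOp ρ.op)).toReal := by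
  rw [mulLogOp_eq_neg, trace_neg, trace_of_nonneg (negMulLogOp_nonneg ρ)]
  simp

/-- Multiply `(1 - u) * exp u ≤ 1` by `1 + u`. -/
theorem exp_le_one_add_add_sq_mul_exp {u : ℝ} (hu : 0 ≤ u) :
    Real.exp u ≤ 1 + u + u ^ 2 * Real.exp u := by
  have h1 : Real.exp u * (1 - u) ≤ 1 := by
    have := mul_le_mul_of_nonneg_left (Real.one_sub_le_exp_neg u) (Real.exp_pos u).le
    rwa [← Real.exp_add, add_neg_cancel, Real.exp_zero] at this
  nlinarith

/-- Compare `(1 + u) * exp (-u) ≤ 1` with `(1 + u) * (1 - u + u ^ 2) = 1 + u ^ 3`. -/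
theorem exp_neg_le_one_sub_add_sq {u : ℝ} (hu : 0 ≤ u) :
    Real.exp (-u) ≤ 1 - u + u ^ 2 := by
  have h1 : (1 + u) * Real.exp (-u) ≤ 1 := by
    have := mul_le_mul_of_nonneg_right (Real.add_one_le_exp u) (Real.exp_pos (-u)).le
    rw [← Real.exp_add, add_neg_cancel, Real.exp_zero] at this
    linarith
  have h2 : 0 ≤ u ^ 3 := by positivity
  by_contra h
  push Not at h
  nlinarith

/-- Put `t = exp (-l)`, so that `t ^ (1 - s) = t * exp (s * l)`, and expand to second order. The
remainder `l ^ 2 * exp (s * l)` is absorbed into `exp (s₀ * l)`: one half of that exponent bounds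
`exp (s * l)`, the other bounds `l ^ 2`, with `8 / s₀ ^ 2` coming from `x ^ 2 / 2 ≤ exp x` at `x =
s₀ * l / 2`. -/
theorem rpow_one_sub_le {s s₀ t : ℝ} (hs : 0 ≤ s) (hs₀ : s ≤ s₀ / 2) (hpos : 0 < s₀)
    (hs₁ : s₀ < 1) (ht : 0 ≤ t) (ht1 : t ≤ 1) :
    t ^ (1 - s) ≤ t + s * Real.negMulLog t + s ^ 2 * (8 / s₀ ^ 2) * t ^ (1 - s₀) := by
  rcases ht.eq_or_lt with h0 | h0
  · rw [← h0, Real.zero_rpow (by linarith), Real.zero_rpow (by linarith)]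
    simp
  set l := -Real.log t with hl
  have hl0 : 0 ≤ l := by rw [hl]; linarith [Real.log_nonpos ht ht1]
  have hr : ∀ a : ℝ, t ^ (1 - a) = t * Real.exp (a * l) := by
    intro a
    rw [Real.rpow_sub h0, Real.rpow_one, Real.rpow_def_of_pos h0, hl, mul_neg, Real.exp_neg,
      mul_comm a, div_eq_mul_inv]
  have h1 := exp_le_one_add_add_sq_mul_exp (mul_nonneg hs hl0)
  have h2 : l ^ 2 ≤ 8 / s₀ ^ 2 * Real.exp (s₀ / 2 * l) := by
    have h3 := Real.pow_div_factorial_le_exp (s₀ / 2 * l) (by positivity) 2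
    rw [div_mul_eq_mul_div, le_div_iff₀ (by positivity)]
    norm_num at h3
    nlinarith
  have h4 : Real.exp (s * l) ≤ Real.exp (s₀ / 2 * l) :=
    Real.exp_le_exp.2 (mul_le_mul_of_nonneg_right hs₀ hl0)
  have h5 : Real.exp (s₀ * l) = Real.exp (s₀ / 2 * l) * Real.exp (s₀ / 2 * l) := by
    rw [← Real.exp_add]; congr 1; ring
  rw [hr, hr, h5]
  have h6 : l ^ 2 * Real.exp (s * l)
      ≤ 8 / s₀ ^ 2 * (Real.exp (s₀ / 2 * l) * Real.exp (s₀ / 2 * l)) := by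
    rw [← mul_assoc]
    exact mul_le_mul h2 h4 (Real.exp_pos _).le (by positivity)
  have h7 : Real.exp (s * l) ≤ 1 + s * l
      + s ^ 2 * (8 / s₀ ^ 2 * (Real.exp (s₀ / 2 * l) * Real.exp (s₀ / 2 * l))) := by
    nlinarith [mul_le_mul_of_nonneg_left h6 (sq_nonneg s)]
  have h8 : Real.negMulLog t = t * l := by rw [Real.negMulLog, hl]; ring
  rw [h8]
  calc t * Real.exp (s * l) ≤ t * _ := mul_le_mul_of_nonneg_left h7 ht
    _ = _ := by ring

theorem rpow_one_sub_le_add {A : H →L[ℂ] H} (hA : 0 ≤ A) (hA1 : ‖A‖ ≤ 1) {s s₀ : ℝ} (hs : 0 ≤ s)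
    (hs₀ : s ≤ s₀ / 2) (hpos : 0 < s₀) (hs₁ : s₀ < 1) :
    A ^ (1 - s) ≤ A + s • negMulLogOp A + (s ^ 2 * (8 / s₀ ^ 2)) • A ^ (1 - s₀) := by
  have e1 : s • negMulLogOp A = cfc (fun t => s * Real.negMulLog t) A := by
    rw [negMulLogOp, cfc_const_mul s _ A Real.continuous_negMulLog.continuousOn]
  have hα : 0 ≤ 1 - s₀ := by linarith
  have c1 : Continuous fun t => s * Real.negMulLog t :=
    continuous_const.mul Real.continuous_negMulLog
  have c2 : Continuous fun t : ℝ => s ^ 2 * (8 / s₀ ^ 2) * t ^ (1 - s₀) :=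
    continuous_const.mul (Real.continuous_rpow_const hα)
  have c3 : Continuous fun t => t + s * Real.negMulLog t := continuous_id.add c1
  have e2 : A + s • negMulLogOp A = cfc (fun t => t + s * Real.negMulLog t) A := by
    rw [e1, cfc_add A (fun t => t) _ continuousOn_id c1.continuousOn,
      cfc_id' ℝ A hA.isSelfAdjoint]
  rw [e2, smul_rpow_eq_cfc hA _ hα, rpow_eq_cfc hA,
    ← cfc_add A _ _ c3.continuousOn c2.continuousOn]
  exact cfc_mono_of_le_one hA hA1 (fun t ht ht1 => rpow_one_sub_le hs hs₀ hpos hs₁ ht ht1)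
    (Real.continuous_rpow_const (by linarith)) (c3.add c2)

/-- The Rényi type quantity `tr ρ^{1-s}` is at most `exp (s (S(ρ) + δ))` for small `s`. -/
theorem eventually_traceNorm_rpow_one_sub_le (ρ : DensityOp H) {α : ℝ} (hα : 0 < α) (hα1 : α < 1)
    (hρ : IsTraceClass (ρ.op ^ α)) (hlog : IsTraceClass (mulLogOp ρ.op)) {δ : ℝ} (hδ : 0 < δ) :
    ∀ᶠ m : ℕ in atTop, traceNorm (ρ.op ^ (1 - 1 / (m : ℝ)))
      ≤ ENNReal.ofReal (Real.exp ((-(trace (mulLogOp ρ.op)).re + δ) / m)) := by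
  set c := (traceNorm (ρ.op ^ α)).toReal with hc
  have hc' : traceNorm (ρ.op ^ α) = ENNReal.ofReal c := (ENNReal.ofReal_toReal hρ.ne).symm
  have hc0 : 0 ≤ c := ENNReal.toReal_nonneg
  set S := -(trace (mulLogOp ρ.op)).re with hS
  have hη : traceNorm (negMulLogOp ρ.op) = ENNReal.ofReal S := by
    rw [hS, re_trace_mulLogOp, neg_neg, ENNReal.ofReal_toReal]
    have h := hlog.ne
    rwa [mulLogOp_eq_neg, traceNorm_neg] at h
  have hS0 : 0 ≤ S := by
    rw [hS, re_trace_mulLogOp, neg_neg]; exact ENNReal.toReal_nonneg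
  set K := 8 / (1 - α) ^ 2 with hK
  have hK0 : 0 ≤ K := by positivity
  have hlim : Tendsto (fun m : ℕ => 1 / (m : ℝ)) atTop (nhds 0) :=
    tendsto_one_div_atTop_nhds_zero_nat
  have hlim2 : Tendsto (fun m : ℕ => 1 / (m : ℝ) * (K * c)) atTop (nhds 0) := by
    simpa using hlim.mul_const (K * c)
  -- The first condition allows the expansion with `s₀ = 1 - α`, whose remainder is then a multiple
  -- of `ρ ^ α`; the second makes this remainder at most `s * δ`. Exponents are of the form `1 / m`
  -- because powers of tensor products are computed for rational exponents.
  filter_upwards [hlim.eventually_le_const (show 0 < (1 - α) / 2 by linarith),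
    hlim2.eventually_le_const hδ] with m hm1 hm2
  set s := 1 / (m : ℝ) with hs
  have hs0 : 0 ≤ s := by positivity
  have h1s : 0 ≤ 1 - s := by linarith
  have hop : ρ.op ^ (1 - s) ≤ ρ.op + s • negMulLogOp ρ.op + (s ^ 2 * K) • ρ.op ^ α := by
    have h := rpow_one_sub_le_add ρ.op_nonneg ρ.norm_op_le_one hs0 hm1 (by linarith) (by linarith)
    rwa [sub_sub_cancel] at h
  refine (traceNorm_mono CFC.rpow_nonneg hop).trans ?_
  refine (traceNorm_add_le _ _).trans ((add_le_add (traceNorm_add_le _ _) le_rfl).trans ?_)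
  rw [traceNorm_real_smul hs0, traceNorm_real_smul (by positivity), hc', hη, ρ.traceNorm_op,
    ← ENNReal.ofReal_one, ← ENNReal.ofReal_mul hs0, ← ENNReal.ofReal_mul (by positivity),
    ← ENNReal.ofReal_add zero_le_one (by positivity),
    ← ENNReal.ofReal_add (by positivity) (by positivity)]
  refine ENNReal.ofReal_le_ofReal ?_
  have h1 := Real.add_one_le_exp ((S + δ) / m)
  have h2 : (S + δ) / m = s * S + s * δ := by rw [hs]; ring
  have h3 := mul_le_mul_of_nonneg_left hm2 hs0
  have h4 : s ^ 2 * K * c = s * (s * (K * c)) := by ring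
  rw [h2] at h1 ⊢
  linarith

/-- The trace norm is only lower semicontinuous for the operator norm, which is enough for
measurability. -/
theorem measurable_traceNorm_cfc (f : ℝ → ℝ) (hf : ContinuousOn f (Set.Icc 0 1)) :
    Measurable fun ρ : DensityOp H => traceNorm (cfc f ρ.op) :=
  (lowerSemicontinuous_traceNorm.comp (continuousOn_cfc_density f hf)).measurable

/-- The difference quotients `m (t - t^{1 + 1/m})`, which approximate `-t log t` from below. -/
def entropyQuotient (m : ℕ) (t : ℝ) : ℝ := m * (t - t ^ (1 + 1 / (m : ℝ)))

theorem continuous_rpow_one_add (m : ℕ) : Continuous fun t : ℝ => t ^ (1 + 1 / (m : ℝ)) :=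
  Real.continuous_rpow_const (by positivity)

theorem continuous_entropyQuotient (m : ℕ) : Continuous (entropyQuotient m) :=
  continuous_const.mul (continuous_id.sub (continuous_rpow_one_add m))

theorem entropyQuotient_nonneg (m : ℕ) {t : ℝ} (ht : 0 ≤ t) (ht1 : t ≤ 1) :
    0 ≤ entropyQuotient m t := by
  refine mul_nonneg (Nat.cast_nonneg _) (sub_nonneg.2 ?_)
  conv_rhs => rw [← Real.rpow_one t]
  exact Real.rpow_le_rpow_of_exponent_ge' ht ht1 zero_le_one (by simp)

/-- For `t = exp (-l)` the difference is `m * t * (exp (-l / m) - 1 + l / m) ≤ t * l ^ 2 / m`, and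
`t * l ^ 2 ≤ 2`. Uniformity in `t` gives convergence in operator norm after functional calculus. -/
theorem abs_negMulLog_sub_entropyQuotient_le {m : ℕ} (hm : 0 < m) {t : ℝ} (ht : 0 ≤ t)
    (ht1 : t ≤ 1) : |Real.negMulLog t - entropyQuotient m t| ≤ 2 / m := by
  have hm' : (0 : ℝ) < m := by exact_mod_cast hm
  rcases ht.eq_or_lt with h0 | h0
  · rw [← h0, entropyQuotient, Real.zero_rpow (by positivity)]
    simp only [Real.negMulLog_zero, sub_self, mul_zero, abs_zero]
    positivity
  set l := -Real.log t with hl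
  have hl0 : 0 ≤ l := by rw [hl]; linarith [Real.log_nonpos ht ht1]
  have hu : 0 ≤ l / m := by positivity
  have hr : t ^ (1 + 1 / (m : ℝ)) = t * Real.exp (-(l / m)) := by
    rw [Real.rpow_add h0, Real.rpow_one, Real.rpow_def_of_pos h0, hl]
    congr 2
    ring
  have h1 := exp_neg_le_one_sub_add_sq hu
  have h2 := Real.one_sub_le_exp_neg (l / m)
  have h3 : t * l ^ 2 ≤ 2 := by
    have h4 := Real.pow_div_factorial_le_exp l hl0 2
    have h5 : t * Real.exp l = 1 := by
      rw [hl, Real.exp_neg, Real.exp_log h0, mul_inv_cancel₀ h0.ne']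
    norm_num at h4
    nlinarith
  have e1 : Real.negMulLog t - entropyQuotient m t
      = m * t * (Real.exp (-(l / m)) - (1 - l / m)) := by
    rw [entropyQuotient, hr, Real.negMulLog, hl]
    field_simp
    ring
  have h6 : 0 ≤ Real.exp (-(l / m)) - (1 - l / m) := by linarith
  rw [e1, abs_of_nonneg (by positivity)]
  calc m * t * (Real.exp (-(l / m)) - (1 - l / m)) ≤ m * t * (l / m) ^ 2 := by
        gcongr; linarith
    _ = t * l ^ 2 / m := by field_simp
    _ ≤ 2 / m := by gcongr

/-- Fatou's lemma for the trace: operator norm convergence and lower semicontinuity of the trace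
norm. The entropy may be infinite. -/
theorem traceNorm_negMulLogOp_le_liminf (ρ : DensityOp H) :
    traceNorm (negMulLogOp ρ.op)
      ≤ liminf (fun m : ℕ => traceNorm (cfc (entropyQuotient m) ρ.op)) atTop := by
  have hlim : Tendsto (fun m : ℕ => cfc (entropyQuotient m) ρ.op) atTop
      (nhds (negMulLogOp ρ.op)) := by
    rw [tendsto_iff_norm_sub_tendsto_zero]
    have h2 : Tendsto (fun m : ℕ => 2 / (m : ℝ)) atTop (nhds 0) :=
      tendsto_const_div_atTop_nhds_zero_nat 2
    refine squeeze_zero' (Eventually.of_forall fun _ => norm_nonneg _) ?_ h2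
    filter_upwards [eventually_gt_atTop 0] with m hm
    rw [negMulLogOp, norm_sub_rev, ← cfc_sub _ _ ρ.op Real.continuous_negMulLog.continuousOn
      (continuous_entropyQuotient m).continuousOn]
    refine norm_cfc_le (by positivity) fun x hx => ?_
    have h := spectrum_subset_Icc ρ.op_nonneg ρ.norm_op_le_one hx
    exact abs_negMulLog_sub_entropyQuotient_le hm h.1 h.2
  have h1 := (lowerSemicontinuous_traceNorm (H := H)).le_liminf (negMulLogOp ρ.op)
  exact h1.trans (liminf_le_liminf_of_le hlim)

/-- The scalar identity is `t ^ (1 + 1 / m) + entropyQuotient m t / m = t`; the trace norm is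
additive on positive operators. -/
theorem traceNorm_rpow_one_add_add (ρ : DensityOp H) {m : ℕ} (hm : 0 < m) :
    traceNorm (ρ.op ^ (1 + 1 / (m : ℝ)))
      + ENNReal.ofReal (1 / m) * traceNorm (cfc (entropyQuotient m) ρ.op) = 1 := by
  have hm' : (0 : ℝ) < m := by exact_mod_cast hm
  have h0 : 0 ≤ cfc (entropyQuotient m) ρ.op := cfc_nonneg fun x hx =>
    entropyQuotient_nonneg m (spectrum_subset_Icc ρ.op_nonneg ρ.norm_op_le_one hx).1
      (spectrum_subset_Icc ρ.op_nonneg ρ.norm_op_le_one hx).2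
  rw [← traceNorm_real_smul (by positivity), ← traceNorm_add CFC.rpow_nonneg
    (smul_nonneg (by positivity) h0), ← ρ.traceNorm_op]
  congr 1
  have c2 := continuous_entropyQuotient m
  rw [rpow_eq_cfc ρ.op_nonneg, ← cfc_const_mul _ _ ρ.op c2.continuousOn,
    ← cfc_add ρ.op (fun t : ℝ => t ^ (1 + 1 / (m : ℝ))) (fun t => 1 / (m : ℝ) * entropyQuotient m t)
      (continuous_rpow_one_add m).continuousOn (continuous_const.mul c2).continuousOn]
  conv_rhs => rw [← cfc_id' ℝ ρ.op ρ.op_nonneg.isSelfAdjoint]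
  congr 1
  funext t
  rw [entropyQuotient]
  field_simp
  ring

/-- The expectation of `tr D(X)^{1+s}` is at most `exp (-s (𝔼 S(D(X)) - δ))` for some small `s`. -/
theorem exists_lintegral_traceNorm_rpow_one_add_le {X : Type*} [MeasurableSpace X]
    (P : Measure X) [IsProbabilityMeasure P] {D : X → DensityOp H} (hD : Measurable D)
    {δ : ℝ} (hδ : 0 < δ) :
    ∃ m : ℕ, 0 < m ∧ ∫⁻ x, traceNorm ((D x).op ^ (1 + 1 / (m : ℝ))) ∂P
      ≤ ENNReal.ofReal (Real.exp ((∫ x, (trace (mulLogOp (D x).op)).re ∂P + δ) / m)) := by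
  set E := ∫ x, (trace (mulLogOp (D x).op)).re ∂P with hE
  have hle1 : ∀ m : ℕ, 0 < m → ∫⁻ x, traceNorm ((D x).op ^ (1 + 1 / (m : ℝ))) ∂P ≤ 1 := by
    intro m hm
    calc ∫⁻ x, traceNorm ((D x).op ^ (1 + 1 / (m : ℝ))) ∂P ≤ ∫⁻ x, 1 ∂P :=
          lintegral_mono fun x => by
            rw [← traceNorm_rpow_one_add_add (D x) hm]; exact le_self_add
      _ = 1 := by simp
  -- If `E + δ ≥ 0` the claimed bound is at least one, hence trivial.
  rcases le_or_gt 0 (E + δ) with h | h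
  · refine ⟨1, one_pos, (hle1 1 one_pos).trans ?_⟩
    rw [← ENNReal.ofReal_one]
    exact ENNReal.ofReal_le_ofReal (Real.one_le_exp (by positivity))
  have hmeas : ∀ m : ℕ, Measurable fun x => traceNorm (cfc (entropyQuotient m) (D x).op) :=
    fun m => (measurable_traceNorm_cfc _ (continuous_entropyQuotient m).continuousOn).comp hD
  -- No integrability is needed: a divergent Bochner integral has the value zero, and only this
  -- inequality is used.
  have h1 : ENNReal.ofReal (-E) ≤ ∫⁻ x, traceNorm (negMulLogOp (D x).op) ∂P := by
    calc ENNReal.ofReal (-E) ≤ ‖E‖ₑ := by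
          rw [← ofReal_norm]; exact ENNReal.ofReal_le_ofReal (neg_le_abs E)
      _ ≤ ∫⁻ x, ‖(trace (mulLogOp (D x).op)).re‖ₑ ∂P := enorm_integral_le_lintegral_enorm _
      _ ≤ _ := by
          refine lintegral_mono fun x => ?_
          rw [re_trace_mulLogOp, enorm_neg, ← ofReal_norm,
            Real.norm_of_nonneg ENNReal.toReal_nonneg]
          exact ENNReal.ofReal_toReal_le
  -- Fatou's lemma twice, for the trace and for the average over `x`. Hence the averaged quotient
  -- exceeds `-E - δ` for some `m`, and the average of `traceNorm_rpow_one_add_add` converts this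
  -- into the claim by `1 + u ≤ exp u`.
  have h2 : ENNReal.ofReal (-E)
      ≤ liminf (fun m : ℕ => ∫⁻ x, traceNorm (cfc (entropyQuotient m) (D x).op) ∂P) atTop :=
    h1.trans ((lintegral_mono fun x => traceNorm_negMulLogOp_le_liminf (D x)).trans
      (lintegral_liminf_le hmeas))
  have h3 : ENNReal.ofReal (-E - δ) < ENNReal.ofReal (-E) :=
    (ENNReal.ofReal_lt_ofReal_iff (by linarith)).2 (by linarith)
  obtain ⟨m, hm, hm0⟩ :=
    ((eventually_lt_of_lt_liminf (h3.trans_le h2)).and (eventually_gt_atTop 0)).exists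
  have hm' : (0 : ℝ) < m := by exact_mod_cast hm0
  refine ⟨m, hm0, ?_⟩
  have h4 : ∫⁻ x, traceNorm ((D x).op ^ (1 + 1 / (m : ℝ))) ∂P
      + ENNReal.ofReal (1 / m) * ∫⁻ x, traceNorm (cfc (entropyQuotient m) (D x).op) ∂P = 1 := by
    rw [← lintegral_const_mul _ (hmeas m), ← lintegral_add_right _ ((hmeas m).const_mul _)]
    simp only [traceNorm_rpow_one_add_add _ hm0]
    simp
  have h5 : ∫⁻ x, traceNorm ((D x).op ^ (1 + 1 / (m : ℝ))) ∂P
      + ENNReal.ofReal ((-E - δ) / m) ≤ 1 := by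
    rw [← h4]
    gcongr
    rw [div_eq_mul_inv, mul_comm, ← one_div, ENNReal.ofReal_mul (by positivity)]
    gcongr
  have h6 : ∫⁻ x, traceNorm ((D x).op ^ (1 + 1 / (m : ℝ))) ∂P
      ≤ 1 - ENNReal.ofReal ((-E - δ) / m) := ENNReal.le_sub_of_add_le_right (by simp) h5
  refine h6.trans ?_
  rw [← ENNReal.ofReal_one, ← ENNReal.ofReal_sub _ (div_nonneg (by linarith) hm'.le)]
  refine ENNReal.ofReal_le_ofReal ?_
  have h7 := Real.add_one_le_exp ((E + δ) / m)
  have h8 : (-E - δ) / m = -((E + δ) / m) := by ring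
  linarith

end Entropy

/-! ### Separability of the trace class. -/

section Separability

variable {H : Type*} [NormedAddCommGroup H] [InnerProductSpace ℂ H] [CompleteSpace H]

/-- Distinct basis vectors have distance `√2`, so the balls of radius `1 / 2` around them are
disjoint. -/
theorem countable_of_hilbertBasis [TopologicalSpace.SeparableSpace H] {ι : Type*}
    (b : HilbertBasis ι ℂ H) : Countable ι := by
  have hd : (Set.univ : Set ι).PairwiseDisjoint fun i => Metric.ball (b i) (1 / 2) := by
    intro i _ j _ hij
    refine Metric.ball_disjoint_ball ?_
    have h1 : ‖b i - b j‖ ^ 2 = 2 := by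
      rw [@norm_sub_sq ℂ, b.orthonormal.1 i, b.orthonormal.1 j, b.orthonormal.2 hij]
      norm_num
    rw [dist_eq_norm]
    nlinarith [norm_nonneg (b i - b j)]
  have := hd.countable_of_isOpen (fun _ _ => Metric.isOpen_ball)
    (fun i _ => ⟨b i, Metric.mem_ball_self (by norm_num)⟩)
  exact Set.countable_univ_iff.1 this

instance [TopologicalSpace.SeparableSpace H] : Countable (stdIndex H) :=
  countable_of_hilbertBasis (stdBasis H)

theorem ofReal_two_inv : ENNReal.ofReal 2⁻¹ = 2⁻¹ := by
  rw [ENNReal.ofReal_inv_of_pos (by norm_num)]; simp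

theorem norm_stdBasis (i : stdIndex H) : ‖stdBasis H i‖ = 1 := (stdBasis H).orthonormal.1 i

theorem hsSq_rankOne (u : H) (i : stdIndex H) :
    hsSq (stdBasis H) (InnerProductSpace.rankOne ℂ u (stdBasis H i)) = ‖u‖ₑ ^ 2 := by
  rw [hsSq, tsum_eq_single i]
  · rw [InnerProductSpace.rankOne_apply, inner_self_eq_norm_sq_to_K, norm_stdBasis]
    simp
  · intro j hj
    rw [InnerProductSpace.rankOne_apply, (stdBasis H).orthonormal.2 hj.symm]
    simp

/-- Factor through the projection onto `bᵢ` and use the weighted Cauchy-Schwarz inequality with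
weight `‖u‖⁻¹`, which equalizes the two terms. -/
theorem traceNorm_rankOne_le (u : H) (i : stdIndex H) :
    traceNorm (InnerProductSpace.rankOne ℂ u (stdBasis H i)) ≤ ‖u‖ₑ := by
  rcases eq_or_ne u 0 with rfl | hu
  · simp [traceNorm_zero]
  have hu' : 0 < ‖u‖ := norm_pos_iff.2 hu
  have h1 : InnerProductSpace.rankOne ℂ u (stdBasis H i)
      = InnerProductSpace.rankOne ℂ u (stdBasis H i)
        * InnerProductSpace.rankOne ℂ (stdBasis H i) (stdBasis H i) := by
    ext v
    simp only [mul_apply_eq_comp, InnerProductSpace.rankOne_apply,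
      inner_smul_right, inner_self_eq_norm_sq_to_K, norm_stdBasis]
    simp
  rw [h1]
  refine (traceNorm_mul_le_hsSq (inv_pos.2 hu') _ _).trans ?_
  rw [hsSq_rankOne, hsSq_rankOne, inv_inv, ← ofReal_norm, ← ofReal_norm, norm_stdBasis,
    ENNReal.ofReal_one, one_pow, mul_one, ← ENNReal.ofReal_pow hu'.le,
    ← ENNReal.ofReal_mul (inv_pos.2 hu').le]
  have h2 : ‖u‖⁻¹ * ‖u‖ ^ 2 = ‖u‖ := by field_simp
  rw [h2, two_inv_mul_add_self]

/-- The rank one operators `v ↦ ⟪bᵢ, v⟫ u` in the trace class, as a function of `u`. -/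
def TraceClass.rankOneL (i : stdIndex H) : H →L[ℂ] TraceClass H :=
  LinearMap.mkContinuous
    { toFun := fun u => TraceClass.mk (InnerProductSpace.rankOne ℂ u (stdBasis H i))
        ((traceNorm_rankOne_le u i).trans_lt enorm_lt_top)
      map_add' := fun u v => TraceClass.op_injective (by
        change InnerProductSpace.rankOne ℂ (u + v) _
          = InnerProductSpace.rankOne ℂ u _ + InnerProductSpace.rankOne ℂ v _
        rw [map_add, add_apply])
      map_smul' := fun r u => TraceClass.op_injective (by
        change InnerProductSpace.rankOne ℂ (r • u) _ = r • InnerProductSpace.rankOne ℂ u _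
        rw [map_smul, smul_apply]) } 1
    (fun u => by
      rw [one_mul, TraceClass.norm_def, ← toReal_enorm u]
      exact ENNReal.toReal_mono enorm_ne_top (traceNorm_rankOne_le u i))

theorem TraceClass.op_rankOneL (i : stdIndex H) (u : H) :
    (TraceClass.rankOneL i u).op = InnerProductSpace.rankOne ℂ u (stdBasis H i) := rfl

theorem TraceClass.op_sum {ι : Type*} (s : Finset ι) (A : ι → TraceClass H) :
    (∑ i ∈ s, A i).op = ∑ i ∈ s, (A i).op := by
  classical
  induction s using Finset.induction_on with
  | empty => rfl
  | insert i s hi ih => rw [Finset.sum_insert hi, Finset.sum_insert hi, op_add, ih]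

/-- The orthogonal projection onto the span of finitely many vectors of the standard basis. -/
def finProj (F : Finset (stdIndex H)) : H →L[ℂ] H :=
  ∑ i ∈ F, InnerProductSpace.rankOne ℂ (stdBasis H i) (stdBasis H i)

open Classical in
theorem finProj_stdBasis (F : Finset (stdIndex H)) (j : stdIndex H) :
    finProj F (stdBasis H j) = if j ∈ F then stdBasis H j else 0 := by
  rw [finProj, sum_apply]
  simp only [InnerProductSpace.rankOne_apply, orthonormal_iff_ite.1 (stdBasis H).orthonormal]
  simp

theorem hsSq_mul_one_sub_finProj (S : H →L[ℂ] H) (F : Finset (stdIndex H)) :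
    hsSq (stdBasis H) (S * (1 - finProj F))
      = ∑' i : {i // i ∉ F}, ‖S (stdBasis H i)‖ₑ ^ 2 := by
  classical
  have h := tsum_subtype {i | i ∉ F} fun i => ‖S (stdBasis H i)‖ₑ ^ 2
  refine Eq.trans ?_ h.symm
  refine tsum_congr fun i => ?_
  rw [mul_apply_eq_comp, sub_apply, finProj_stdBasis, one_apply_eq_self]
  by_cases hi : i ∈ F <;> simp [hi, Set.indicator]

/-- For a finite projection `P` onto basis vectors, `A - A P = (W S) (S (1 - P))` with `S * S =
|A|`. The second factor has squared Hilbert-Schmidt norm equal to a tail of the convergent series `∑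
‖S bᵢ‖ ^ 2`. -/
theorem TraceClass.mem_closure_span_rankOneL (A : TraceClass H) :
    A ∈ closure (Submodule.span ℂ (⋃ i, Set.range (TraceClass.rankOneL (H := H) i)) :
      Set (TraceClass H)) := by
  rw [Metric.mem_closure_iff]
  intro ε hε
  obtain ⟨W, hW, hWA, -⟩ := exists_polar A.op
  obtain ⟨S, hS, hSS⟩ := exists_sqrt (CFC.abs_nonneg A.op)
  have hSS' : star S * S = CFC.abs A.op := by rw [hS, hSS]
  have hAS := traceNorm_of_sqrt (stdBasis H) hSS'
  have hfin : hsSq (stdBasis H) S ≠ ∞ := hAS ▸ A.isTraceClass.ne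
  set a := (hsSq (stdBasis H) S).toReal with ha
  have ha0 : 0 ≤ a := ENNReal.toReal_nonneg
  have hSa : hsSq (stdBasis H) S = ENNReal.ofReal a := (ENNReal.ofReal_toReal hfin).symm
  -- This weight gives `c * a ≤ ε`; a tail below `c * ε / 2` then makes the total at most `(ε + ε /
  -- 2) / 2 < ε`.
  set c := ε / (a + 1) with hc
  have hc0 : 0 < c := by positivity
  have htail := ENNReal.tendsto_tsum_compl_atTop_zero hfin
  obtain ⟨F, hF⟩ := (htail.eventually_lt_const
    (show (0 : ℝ≥0∞) < ENNReal.ofReal (c * ε / 2) by positivity)).exists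
  refine ⟨∑ i ∈ F, TraceClass.rankOneL i (A.op (stdBasis H i)), ?_, ?_⟩
  · refine Submodule.sum_mem _ fun i _ => Submodule.subset_span ?_
    exact Set.mem_iUnion.2 ⟨i, _, rfl⟩
  have hop : (∑ i ∈ F, TraceClass.rankOneL i (A.op (stdBasis H i))).op = A.op * finProj F := by
    rw [TraceClass.op_sum, finProj, Finset.mul_sum]
    refine Finset.sum_congr rfl fun i _ => ?_
    ext v
    rw [TraceClass.op_rankOneL, mul_apply_eq_comp, InnerProductSpace.rankOne_apply,
      InnerProductSpace.rankOne_apply, map_smul]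
  have hA : A.op - A.op * finProj F = (W * S) * (S * (1 - finProj F)) := by
    have : A.op = W * (S * S) := by rw [hSS, hWA]
    conv_lhs => rw [this]
    noncomm_ring
  rw [dist_eq_norm, TraceClass.norm_def, TraceClass.op_sub, hop, hA]
  refine lt_of_le_of_lt (ENNReal.toReal_le_of_le_ofReal
    (b := 2⁻¹ * (c * a + c⁻¹ * (c * ε / 2))) (by positivity) ?_) ?_
  · refine (traceNorm_mul_le_hsSq hc0 _ _).trans ?_
    rw [ENNReal.ofReal_mul (by norm_num), ENNReal.ofReal_add (by positivity) (by positivity),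
      ENNReal.ofReal_mul hc0.le, ENNReal.ofReal_mul (inv_pos.2 hc0).le, ← hSa,
      ofReal_two_inv, hsSq_mul_one_sub_finProj]
    refine mul_le_mul' le_rfl (add_le_add (mul_le_mul' le_rfl (hsSq_comp_le _ _ _ hW))
      (mul_le_mul' le_rfl ?_))
    exact hF.le
  · have h1 : c * a ≤ ε := by
      rw [hc, div_mul_eq_mul_div, div_le_iff₀ (by positivity)]
      nlinarith
    have h2 : c⁻¹ * (c * ε / 2) = ε / 2 := by field_simp
    rw [h2]
    linarith

/-- Separability makes Borel measurable families of states strongly measurable, so that their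
Bochner integrals are not degenerate. -/
instance [TopologicalSpace.SeparableSpace H] :
    TopologicalSpace.SeparableSpace (TraceClass H) := by
  have h1 : TopologicalSpace.IsSeparable
      (⋃ i, Set.range (TraceClass.rankOneL (H := H) i)) :=
    TopologicalSpace.IsSeparable.iUnion fun i =>
      TopologicalSpace.isSeparable_range (TraceClass.rankOneL i).continuous
  have h2 := (h1.span (R := ℂ)).closure
  refine TopologicalSpace.isSeparable_univ_iff.1 (h2.mono fun A _ => ?_)
  exact TraceClass.mem_closure_span_rankOneL A

instance [TopologicalSpace.SeparableSpace H] :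
    SecondCountableTopology (TraceClass H) :=
  UniformSpace.secondCountable_of_separable _

end Separability

/-! ### Trace norms and powers of tensor products. -/

section Tensor

variable {H K : Type*} [NormedAddCommGroup H] [InnerProductSpace ℂ H] [CompleteSpace H]
  [NormedAddCommGroup K] [InnerProductSpace ℂ K] [CompleteSpace K]

theorem continuous_htmul : Continuous fun p : H × K => htmul p.1 p.2 :=
  (Completion.continuous_coe _).comp
    ((TensorProduct.mkL ℂ H K).continuous₂)

theorem separableSpace_hilbertTensor [TopologicalSpace.SeparableSpace H]
    [TopologicalSpace.SeparableSpace K] : TopologicalSpace.SeparableSpace (HilbertTensor H K) := by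
  have h1 : TopologicalSpace.IsSeparable {x : HilbertTensor H K | ∃ u v, x = htmul u v} := by
    refine (TopologicalSpace.isSeparable_range (continuous_htmul (H := H) (K := K))).mono ?_
    rintro _ ⟨u, v, rfl⟩
    exact ⟨(u, v), rfl⟩
  have h2 := (h1.span (R := ℂ)).closure
  refine TopologicalSpace.isSeparable_univ_iff.1 (h2.mono fun x _ => ?_)
  have h3 := dense_span_htmul (H := H) (K := K)
  have h4 : x ∈ (Submodule.span ℂ
    {x : HilbertTensor H K | ∃ u v, x = htmul u v}).topologicalClosure := h3 ▸ Submodule.mem_top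
  exact h4

theorem htmul_add_left (u u' : H) (v : K) : htmul (u + u') v = htmul u v + htmul u' v := by
  unfold htmul; rw [TensorProduct.add_tmul, Completion.coe_add]

theorem htmul_add_right (u : H) (v v' : K) : htmul u (v + v') = htmul u v + htmul u v' := by
  unfold htmul; rw [TensorProduct.tmul_add, Completion.coe_add]

theorem htmul_smul_left (a : ℂ) (u : H) (v : K) : htmul (a • u) v = a • htmul u v := by
  unfold htmul; rw [← TensorProduct.smul_tmul', Completion.coe_smul]

theorem htmul_smul_right (a : ℂ) (u : H) (v : K) : htmul u (a • v) = a • htmul u v := by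
  unfold htmul; rw [TensorProduct.tmul_smul, Completion.coe_smul]

theorem tensorOp_add_left (A A' : H →L[ℂ] H) (B : K →L[ℂ] K) :
    tensorOp (A + A') B = tensorOp A B + tensorOp A' B :=
  ext_htmul fun u v => by simp only [add_apply, tensorOp_htmul, htmul_add_left]

theorem tensorOp_add_right (A : H →L[ℂ] H) (B B' : K →L[ℂ] K) :
    tensorOp A (B + B') = tensorOp A B + tensorOp A B' :=
  ext_htmul fun u v => by simp only [add_apply, tensorOp_htmul, htmul_add_right]

theorem tensorOp_smul_left (a : ℂ) (A : H →L[ℂ] H) (B : K →L[ℂ] K) :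
    tensorOp (a • A) B = a • tensorOp A B :=
  ext_htmul fun u v => by simp only [smul_apply, tensorOp_htmul, htmul_smul_left]

theorem tensorOp_smul_right (a : ℂ) (A : H →L[ℂ] H) (B : K →L[ℂ] K) :
    tensorOp A (a • B) = a • tensorOp A B :=
  ext_htmul fun u v => by simp only [smul_apply, tensorOp_htmul, htmul_smul_right]

theorem tensorOp_one : tensorOp (1 : H →L[ℂ] H) (1 : K →L[ℂ] K) = 1 :=
  ext_htmul fun u v => by simp only [one_apply_eq_self, tensorOp_htmul]

theorem tensorOp_pow (A : H →L[ℂ] H) (B : K →L[ℂ] K) (m : ℕ) :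
    tensorOp A B ^ m = tensorOp (A ^ m) (B ^ m) := by
  induction m with
  | zero => simp only [pow_zero, tensorOp_one]
  | succ m ih => rw [pow_succ, ih, tensorOp_mul, ← pow_succ, ← pow_succ]

theorem traceNorm_eq_of_mul_self_eq {A R : H →L[ℂ] H} (hR : 0 ≤ R) (h : R * R = star A * A) :
    traceNorm A = traceNorm R := by
  have h1 : CFC.abs A = R := CFC.sqrt_unique h hR
  unfold traceNorm
  rw [CFC.abs_of_nonneg R hR, h1]

/-- By uniqueness of the positive square root, `|A ⊗ B| = |A| ⊗ |B|`, which reduces the claim to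
positive operators. -/
theorem traceNorm_tensorOp (A : H →L[ℂ] H) (B : K →L[ℂ] K) :
    traceNorm (tensorOp A B) = traceNorm A * traceNorm B := by
  have h := tensorOp_nonneg_and_traceNorm (CFC.abs_nonneg A) (CFC.abs_nonneg B)
  rw [traceNorm_eq_of_mul_self_eq h.1, h.2,
    ← traceNorm_eq_of_mul_self_eq (CFC.abs_nonneg A) (CFC.abs_mul_abs A),
    ← traceNorm_eq_of_mul_self_eq (CFC.abs_nonneg B) (CFC.abs_mul_abs B)]
  rw [tensorOp_star, tensorOp_mul, tensorOp_mul, CFC.abs_mul_abs, CFC.abs_mul_abs]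

/-- The tensor product of trace-class operators. -/
def TraceClass.tensorL : TraceClass H →L[ℂ] TraceClass K →L[ℂ] TraceClass (HilbertTensor H K) :=
  LinearMap.mkContinuous₂
    (LinearMap.mk₂ ℂ
      (fun A B => TraceClass.mk (tensorOp A.op B.op) (by
        rw [IsTraceClass, traceNorm_tensorOp]
        exact ENNReal.mul_lt_top A.isTraceClass B.isTraceClass))
      (fun A A' B => TraceClass.op_injective (tensorOp_add_left A.op A'.op B.op))
      (fun a A B => TraceClass.op_injective (tensorOp_smul_left a A.op B.op))
      (fun A B B' => TraceClass.op_injective (tensorOp_add_right A.op B.op B'.op))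
      (fun a A B => TraceClass.op_injective (tensorOp_smul_right a A.op B.op)))
    1 (fun A B => by
      rw [one_mul, TraceClass.norm_def, TraceClass.norm_def, TraceClass.norm_def,
        ← ENNReal.toReal_mul, ← traceNorm_tensorOp]
      rfl)

theorem DensityOp.coe_tensor (ρ : DensityOp H) (σ : DensityOp K) :
    (ρ.tensor σ).1 = TraceClass.tensorL ρ.1 σ.1 := rfl

/-- The real power of a positive operator. -/
def opRpow (A : H →L[ℂ] H) (y : ℝ) : H →L[ℂ] H := A ^ y

theorem opRpow_pow {R : H →L[ℂ] H} (hR : 0 ≤ R) (p : ℕ) {m : ℕ} (hm : 0 < m) :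
    opRpow (R ^ m) ((p : ℝ) / m) = R ^ p := by
  have hm' : (0 : ℝ) < m := by exact_mod_cast hm
  rw [opRpow, ← CFC.rpow_natCast R m hR,
    CFC.rpow_rpow_of_exponent_nonneg R _ _ hm'.le (by positivity) hR,
    mul_div_cancel₀ _ hm'.ne', CFC.rpow_natCast R p hR]

theorem exists_pow_eq {R : H →L[ℂ] H} (hR : 0 ≤ R) {m : ℕ} (hm : 0 < m) :
    ∃ S : H →L[ℂ] H, 0 ≤ S ∧ S ^ m = R := by
  have hm' : (0 : ℝ) < m := by exact_mod_cast hm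
  refine ⟨R ^ (1 / (m : ℝ)), CFC.rpow_nonneg, ?_⟩
  rw [← CFC.rpow_natCast _ m CFC.rpow_nonneg,
    CFC.rpow_rpow_of_exponent_nonneg R _ _ (by positivity) hm'.le hR,
    one_div_mul_cancel hm'.ne', CFC.rpow_one R hR]

/-- Write `A = S ^ m` and `B = T ^ m`. All powers in the claim become integer powers of `S`, `T` and
`S ⊗ T`, for which multiplicativity is algebra. -/
theorem opRpow_tensorOp {A : H →L[ℂ] H} {B : K →L[ℂ] K} (hA : 0 ≤ A) (hB : 0 ≤ B) (p : ℕ) {m : ℕ}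
    (hm : 0 < m) : opRpow (tensorOp A B) ((p : ℝ) / m)
      = tensorOp (opRpow A ((p : ℝ) / m)) (opRpow B ((p : ℝ) / m)) := by
  obtain ⟨S, hS, rfl⟩ := exists_pow_eq hA hm
  obtain ⟨T, hT, rfl⟩ := exists_pow_eq hB hm
  rw [← tensorOp_pow, opRpow_pow (tensorOp_nonneg_and_traceNorm hS hT).1 p hm, opRpow_pow hS p hm,
    opRpow_pow hT p hm, tensorOp_pow]

end Tensor

/-! ### The average state as a density operator. -/

section Average

variable {H : Type*} [NormedAddCommGroup H] [InnerProductSpace ℂ H] [CompleteSpace H]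

/-- The inclusion of the trace class into the bounded operators. -/
def TraceClass.opL : TraceClass H →L[ℂ] (H →L[ℂ] H) :=
  LinearMap.mkContinuous
    { toFun := TraceClass.op
      map_add' := TraceClass.op_add
      map_smul' := TraceClass.op_smul } 1
    (fun A => by rw [one_mul]; exact TraceClass.norm_op_le A)

/-- The matrix entry `A ↦ ⟪u, A v⟫` as a functional on the trace class. -/
def TraceClass.entryL (u v : H) : TraceClass H →L[ℂ] ℂ :=
  (innerSL ℂ u).comp ((ContinuousLinearMap.apply ℂ H v).comp TraceClass.opL)

theorem TraceClass.entryL_apply (u v : H) (A : TraceClass H) :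
    TraceClass.entryL u v A = inner ℂ u (A.op v) := rfl

theorem DensityOp.norm_coe (ρ : DensityOp H) : ‖ρ.1‖ = 1 := by
  have h : traceNorm ρ.1.op = 1 := ρ.traceNorm_op
  rw [TraceClass.norm_def, h, ENNReal.toReal_one]

theorem DensityOp.inner_eq_ofReal (ρ : DensityOp H) (v : H) :
    inner ℂ v (ρ.op v) = ((inner ℂ v (ρ.op v)).re : ℂ) := by
  obtain ⟨S, hS, hSS⟩ := exists_sqrt ρ.op_nonneg
  rw [inner_eq_enorm_sq (S := S) (by rw [hS, hSS]) v]
  norm_cast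

variable {X : Type*} [MeasurableSpace X]

theorem stronglyMeasurable_density [TopologicalSpace.SeparableSpace H] {D : X → DensityOp H}
    (hD : Measurable D) : StronglyMeasurable fun x => (D x).1 :=
  (measurable_subtype_coe.comp hD).stronglyMeasurable

theorem integrable_density [TopologicalSpace.SeparableSpace H] (P : Measure X) [IsFiniteMeasure P]
    {D : X → DensityOp H} (hD : Measurable D) : Integrable (fun x => (D x).1) P :=
  Integrable.of_bound (stronglyMeasurable_density hD).aestronglyMeasurable 1
    (Eventually.of_forall fun x => (D x).norm_coe.le)

variable [TopologicalSpace.SeparableSpace H] (P : Measure X) [IsProbabilityMeasure P]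
  {D : X → DensityOp H}

theorem inner_averageState (hD : Measurable D) (v : H) :
    inner ℂ v ((averageState P D).op v) = ((∫ x, (inner ℂ v ((D x).op v)).re ∂P : ℝ) : ℂ) := by
  rw [averageState, ← TraceClass.entryL_apply,
    ← (TraceClass.entryL v v).integral_comp_comm (integrable_density P hD), ← integral_complex_ofReal]
  exact integral_congr_ae (Eventually.of_forall fun x => (D x).inner_eq_ofReal v)

theorem measurable_re_inner (hD : Measurable D) (v : H) :
    Measurable fun x => (inner ℂ v ((D x).op v)).re :=
  Complex.measurable_re.comp ((TraceClass.entryL v v).continuous.measurable.comp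
    (measurable_subtype_coe.comp hD))

theorem integrable_re_inner (hD : Measurable D) (v : H) :
    Integrable (fun x => (inner ℂ v ((D x).op v)).re) P :=
  ((TraceClass.entryL v v).integrable_comp (integrable_density P hD)).re

theorem ofReal_re_inner_averageState (hD : Measurable D) (v : H) :
    ENNReal.ofReal (inner ℂ v ((averageState P D).op v)).re
      = ∫⁻ x, ENNReal.ofReal (inner ℂ v ((D x).op v)).re ∂P := by
  rw [inner_averageState P hD, Complex.ofReal_re,
    ofReal_integral_eq_lintegral_ofReal (integrable_re_inner P hD v)]
  exact Eventually.of_forall fun x => re_inner_nonneg (D x).op_nonneg v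

/-- Tonelli's theorem. The vectors are arbitrary because, besides the trace (an orthonormal basis),
the case `v i = (1 - G) bᵢ` is needed: the mean weight removed by `G` is the weight removed from the
average state. -/
theorem tsum_ofReal_inner_averageState (hD : Measurable D) {ι : Type*} [Countable ι] (v : ι → H) :
    ∑' i, ENNReal.ofReal (inner ℂ (v i) ((averageState P D).op (v i))).re
      = ∫⁻ x, ∑' i, ENNReal.ofReal (inner ℂ (v i) ((D x).op (v i))).re ∂P := by
  rw [lintegral_tsum fun i => (measurable_re_inner hD (v i)).ennreal_ofReal.aemeasurable]
  exact tsum_congr fun i => ofReal_re_inner_averageState P hD (v i)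

theorem averageState_op_nonneg (hD : Measurable D) : 0 ≤ (averageState P D).op := by
  rw [ContinuousLinearMap.nonneg_iff_isPositive, ContinuousLinearMap.isPositive_iff_complex]
  intro v
  have h1 : 0 ≤ ∫ x, (inner ℂ v ((D x).op v)).re ∂P :=
    integral_nonneg fun x => re_inner_nonneg (D x).op_nonneg v
  rw [← inner_conj_symm, inner_averageState P hD, Complex.conj_ofReal]
  exact ⟨by simp, by simpa using h1⟩

theorem traceNorm_averageState (hD : Measurable D) : traceNorm (averageState P D).op = 1 := by
  rw [traceNorm_eq_tsum (averageState_op_nonneg P hD), tsum_ofReal_inner_averageState P hD]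
  simp_rw [← fun x => traceNorm_eq_tsum (D x).op_nonneg, DensityOp.traceNorm_op]
  simp

/-- The average of a measurable family of density operators, as a density operator. -/
def averageDensity (hD : Measurable D) : DensityOp H :=
  DensityOp.mk' (averageState P D).op (averageState_op_nonneg P hD) (traceNorm_averageState P hD)

end Average

/-! ### Averages and power traces of product states. -/

theorem integral_prod_clm {X Y E F G : Type*} [MeasurableSpace X] [MeasurableSpace Y]
    [NormedAddCommGroup E] [NormedSpace ℂ E] [CompleteSpace E]
    [NormedAddCommGroup F] [NormedSpace ℂ F] [CompleteSpace F]
    [NormedAddCommGroup G] [NormedSpace ℂ G] [CompleteSpace G]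
    {P : Measure X} [SFinite P] {Q : Measure Y} [SFinite Q] (L : E →L[ℂ] F →L[ℂ] G)
    {f : X → E} {g : Y → F} (hf : Integrable f P) (hg : Integrable g Q)
    (hfg : Integrable (fun z : X × Y => L (f z.1) (g z.2)) (P.prod Q)) :
    ∫ z, L (f z.1) (g z.2) ∂(P.prod Q) = L (∫ x, f x ∂P) (∫ y, g y ∂Q) := by
  rw [integral_prod _ hfg]
  calc ∫ x, ∫ y, L (f x) (g y) ∂Q ∂P = ∫ x, L.flip (∫ y, g y ∂Q) (f x) ∂P :=
        integral_congr_ae (Eventually.of_forall fun x => (L (f x)).integral_comp_comm hg)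
    _ = L.flip (∫ y, g y ∂Q) (∫ x, f x ∂P) := ContinuousLinearMap.integral_comp_comm _ hf

section ProductState

variable {H K L : Type*} [NormedAddCommGroup H] [InnerProductSpace ℂ H] [CompleteSpace H]
  [NormedAddCommGroup K] [InnerProductSpace ℂ K] [CompleteSpace K]
  [NormedAddCommGroup L] [InnerProductSpace ℂ L] [CompleteSpace L]
  [TopologicalSpace.SeparableSpace H] [TopologicalSpace.SeparableSpace K]
  [TopologicalSpace.SeparableSpace L]
  {X Y : Type*} [MeasurableSpace X] [MeasurableSpace Y]

theorem DensityOp.measurable_of_bilinear (T : TraceClass H →L[ℂ] TraceClass K →L[ℂ] TraceClass L)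
    (t : DensityOp H → DensityOp K → DensityOp L) (ht : ∀ ρ σ, (t ρ σ).1 = T ρ.1 σ.1)
    {D : X → DensityOp H} {E : X → DensityOp K} (hD : Measurable D) (hE : Measurable E) :
    Measurable fun x => t (D x) (E x) := by
  refine Measurable.subtype_mk (f := fun x => (t (D x) (E x)).1) ?_
  simp_rw [ht]
  exact T.continuous₂.measurable.comp
    ((measurable_subtype_coe.comp hD).prodMk (measurable_subtype_coe.comp hE))

theorem averageState_prod_of_bilinear
    (T : TraceClass H →L[ℂ] TraceClass K →L[ℂ] TraceClass L)
    (t : DensityOp H → DensityOp K → DensityOp L) (ht : ∀ ρ σ, (t ρ σ).1 = T ρ.1 σ.1)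
    (P : Measure X) [IsProbabilityMeasure P] (Q : Measure Y)
    [IsProbabilityMeasure Q] {D : X → DensityOp H} {E : Y → DensityOp K}
    (hD : Measurable D) (hE : Measurable E) :
    averageState (P.prod Q) (fun z => t (D z.1) (E z.2))
      = (t (averageDensity P hD) (averageDensity Q hE)).1 := by
  have hm : Measurable fun z : X × Y => t (D z.1) (E z.2) :=
    DensityOp.measurable_of_bilinear T t ht (hD.comp measurable_fst) (hE.comp measurable_snd)
  have hi := integrable_density (P.prod Q) hm
  simp_rw [ht] at hi
  rw [averageState, ht]
  simp_rw [ht]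
  exact integral_prod_clm T (integrable_density P hD) (integrable_density Q hE) hi

instance : TopologicalSpace.SeparableSpace (HilbertTensor H K) := separableSpace_hilbertTensor

theorem DensityOp.measurable_tensor {D : X → DensityOp H} {E : X → DensityOp K}
    (hD : Measurable D) (hE : Measurable E) : Measurable fun x => (D x).tensor (E x) :=
  DensityOp.measurable_of_bilinear TraceClass.tensorL DensityOp.tensor DensityOp.coe_tensor hD hE

theorem averageState_prod_tensor (P : Measure X) [IsProbabilityMeasure P] (Q : Measure Y)
    [IsProbabilityMeasure Q] {D : X → DensityOp H} {E : Y → DensityOp K}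
    (hD : Measurable D) (hE : Measurable E) :
    averageState (P.prod Q) (fun z => (D z.1).tensor (E z.2))
      = ((averageDensity P hD).tensor (averageDensity Q hE)).1 :=
  averageState_prod_of_bilinear TraceClass.tensorL DensityOp.tensor DensityOp.coe_tensor P Q hD hE

instance instSeparableSpaceTensorPower : (n : ℕ) →
    TopologicalSpace.SeparableSpace (TensorPower H n)
  | 0 => inferInstanceAs (TopologicalSpace.SeparableSpace (EuclideanSpace ℂ PUnit))
  | n + 1 =>
    have := instSeparableSpaceTensorPower n
    inferInstanceAs (TopologicalSpace.SeparableSpace (HilbertTensor H (TensorPower H n)))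

theorem measurable_productState {D : X → DensityOp H} (hD : Measurable D) (n : ℕ) :
    Measurable fun x : Fin n → X => productState n fun i => D (x i) := by
  induction n with
  | zero => exact measurable_const
  | succ n ih =>
    change Measurable fun x : Fin (n + 1) → X =>
      (D (x 0)).tensor (productState n fun i => D (x i.succ))
    refine DensityOp.measurable_tensor (hD.comp (measurable_pi_apply 0))
      (ih.comp (measurable_pi_lambda _ fun i => measurable_pi_apply i.succ))

/-- Independence: splitting off the first coordinate, Fubini's theorem for the bilinear tensor
product pulls the average into each factor. -/
theorem averageState_productState (P : Measure X) [IsProbabilityMeasure P] {D : X → DensityOp H}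
    (hD : Measurable D) (n : ℕ) :
    averageState (Measure.pi fun _ : Fin n => P) (fun x => productState n fun i => D (x i))
      = (productState n fun _ => averageDensity P hD).1 := by
  induction n with
  | zero =>
    change ∫ x : Fin 0 → X, (productState (H := H) 0 Fin.elim0).1 ∂_
      = (productState (H := H) 0 Fin.elim0).1
    simp
  | succ n ih =>
    have hmp := measurePreserving_piFinSuccAbove (fun _ : Fin (n + 1) => P) 0
    have h1 := averageState_prod_tensor P (Measure.pi fun _ : Fin n => P) hD
      (measurable_productState hD n)
    have h2 := hmp.integral_comp (MeasurableEquiv.measurableEmbedding _) (fun z : X × (Fin n → X) =>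
      ((D z.1).tensor (productState n fun i => D (z.2 i))).1)
    refine (h2.trans h1).trans ?_
    have h3 : averageDensity (Measure.pi fun _ : Fin n => P) (measurable_productState hD n)
        = productState n fun _ => averageDensity P hD := Subtype.ext ih
    rw [h3]
    rfl

/-- Turns power traces of blocks into `n`-th powers of single-letter quantities, hence into
exponents. -/
theorem traceNorm_opRpow_productState (n : ℕ) (ρ : Fin n → DensityOp H) (p : ℕ) {m : ℕ}
    (hm : 0 < m) :
    traceNorm (opRpow (productState n ρ).op ((p : ℝ) / m))
      = ∏ i, traceNorm (opRpow (ρ i).op ((p : ℝ) / m)) := by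
  induction n with
  | zero =>
    rw [Finset.univ_eq_empty, Finset.prod_empty]
    have h : opRpow (1 : EuclideanSpace ℂ PUnit →L[ℂ] EuclideanSpace ℂ PUnit) ((p : ℝ) / m) = 1 :=
      CFC.one_rpow
    change traceNorm (opRpow (1 : EuclideanSpace ℂ PUnit →L[ℂ] EuclideanSpace ℂ PUnit) _) = 1
    rw [h]
    exact traceNorm_one_unit
  | succ n ih =>
    rw [Fin.prod_univ_succ, ← ih]
    change traceNorm (opRpow (tensorOp (ρ 0).op (productState n (Fin.tail ρ)).op) _) = _
    rw [opRpow_tensorOp (ρ 0).op_nonneg (productState n (Fin.tail ρ)).op_nonneg p hm,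
      traceNorm_tensorOp]
    rfl

end ProductState

/-! ### Second moments of weighted sums of independent variables. -/

section WeightedSums

variable {Ω J : Type*} [MeasurableSpace Ω] [Fintype J] (μ : Measure Ω) [IsProbabilityMeasure μ]
  {w : J → ℝ}

/-- Weights of total zero cancel the common mean, so the second moment of the sum is its variance,
which is additive by independence and at most the second moment termwise. -/
theorem integral_sq_weighted_sum_le (hw : ∑ j, w j = 0) {a : Ω → ℝ} (ha : Measurable a) {C : ℝ}
    (hC : ∀ x, |a x| ≤ C) :
    ∫ c : J → Ω, (∑ j, w j * a (c j)) ^ 2 ∂(Measure.pi fun _ => μ)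
      ≤ (∑ j, w j ^ 2) * ∫ x, a x ^ 2 ∂μ := by
  have hL : MemLp a 2 μ := MemLp.of_bound ha.aestronglyMeasurable C
    (Eventually.of_forall fun x => by rw [Real.norm_eq_abs]; exact hC x)
  have hLw : ∀ j, MemLp (fun x => w j * a x) 2 μ := fun j => hL.const_mul (w j)
  have hev : ∀ j : J, MeasurePreserving (fun c : J → Ω => c j) (Measure.pi fun _ => μ) μ :=
    fun j => measurePreserving_eval (fun _ => μ) j
  have hLj : ∀ j : J, MemLp (fun c : J → Ω => w j * a (c j)) 2 (Measure.pi fun _ => μ) :=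
    fun j => (hLw j).comp_measurePreserving (hev j)
  have hvar := variance_sum_pi (μ := fun _ : J => μ) (X := fun j x => w j * a x) hLw
  have hsum : (∑ j, fun c : J → Ω => w j * a (c j)) = fun c => ∑ j, w j * a (c j) := by
    ext c; simp
  have hmean : ∫ c : J → Ω, (∑ j, w j * a (c j)) ∂(Measure.pi fun _ => μ) = 0 := by
    rw [integral_finsetSum _ fun j _ => (hLj j).integrable one_le_two]
    have h1 : ∀ j, ∫ c : J → Ω, w j * a (c j) ∂(Measure.pi fun _ => μ) = w j * ∫ x, a x ∂μ := by
      intro j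
      rw [integral_const_mul, ← (hev j).map_eq,
        integral_map (hev j).measurable.aemeasurable ha.aestronglyMeasurable, (hev j).map_eq]
    simp_rw [h1, ← Finset.sum_mul, hw, zero_mul]
  rw [hsum, variance_of_integral_eq_zero _ hmean] at hvar
  · rw [hvar, Finset.sum_mul]
    refine Finset.sum_le_sum fun j _ => ?_
    rw [variance_const_mul]
    refine mul_le_mul_of_nonneg_left ?_ (sq_nonneg _)
    rw [variance_eq_sub hL]
    simp only [Pi.pow_apply]
    linarith [sq_nonneg (μ[a])]
  · exact (Finset.measurable_sum _ fun j _ =>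
      (ha.comp (measurable_pi_apply j)).const_mul (w j)).aemeasurable

theorem lintegral_sq_weighted_sum_le (hw : ∑ j, w j = 0) {a : Ω → ℝ} (ha : Measurable a) {C : ℝ}
    (hC : ∀ x, |a x| ≤ C) :
    ∫⁻ c : J → Ω, ENNReal.ofReal ((∑ j, w j * a (c j)) ^ 2) ∂(Measure.pi fun _ => μ)
      ≤ ENNReal.ofReal (∑ j, w j ^ 2) * ∫⁻ x, ENNReal.ofReal (a x ^ 2) ∂μ := by
  have hi : Integrable (fun x => a x ^ 2) μ :=
    Integrable.of_bound (ha.pow_const 2).aestronglyMeasurable (C ^ 2)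
      (Eventually.of_forall fun x => by
        rw [Real.norm_eq_abs, abs_pow]
        exact pow_le_pow_left₀ (abs_nonneg _) (hC x) 2)
  have hm : Measurable fun c : J → Ω => ∑ j, w j * a (c j) :=
    Finset.measurable_sum _ fun j _ => (ha.comp (measurable_pi_apply j)).const_mul (w j)
  have hi2 : Integrable (fun c : J → Ω => (∑ j, w j * a (c j)) ^ 2) (Measure.pi fun _ => μ) := by
    refine Integrable.of_bound (hm.pow_const 2).aestronglyMeasurable ((∑ j, |w j| * C) ^ 2)
      (Eventually.of_forall fun c => ?_)
    rw [Real.norm_eq_abs, abs_pow]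
    refine pow_le_pow_left₀ (abs_nonneg _) ?_ 2
    refine (Finset.abs_sum_le_sum_abs _ _).trans (Finset.sum_le_sum fun j _ => ?_)
    rw [abs_mul]
    exact mul_le_mul_of_nonneg_left (hC _) (abs_nonneg _)
  rw [← ofReal_integral_eq_lintegral_ofReal hi (Eventually.of_forall fun x => sq_nonneg _),
    ← ofReal_integral_eq_lintegral_ofReal hi2 (Eventually.of_forall fun x => sq_nonneg _),
    ← ENNReal.ofReal_mul (Finset.sum_nonneg fun _ _ => sq_nonneg _)]
  exact ENNReal.ofReal_le_ofReal (integral_sq_weighted_sum_le μ hw ha hC)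

theorem enorm_sq_eq_re_add_im (z : ℂ) :
    ‖z‖ₑ ^ 2 = ENNReal.ofReal (z.re ^ 2) + ENNReal.ofReal (z.im ^ 2) := by
  rw [← ofReal_norm, ← ENNReal.ofReal_pow (norm_nonneg _),
    ← ENNReal.ofReal_add (sq_nonneg _) (sq_nonneg _), Complex.sq_norm, Complex.normSq_apply]
  congr 1
  ring

theorem lintegral_enorm_sq_weighted_sum_le (hw : ∑ j, w j = 0) {a : Ω → ℂ} (ha : Measurable a)
    {C : ℝ} (hC : ∀ x, ‖a x‖ ≤ C) :
    ∫⁻ c : J → Ω, ‖∑ j, (w j : ℂ) * a (c j)‖ₑ ^ 2 ∂(Measure.pi fun _ => μ)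
      ≤ ENNReal.ofReal (∑ j, w j ^ 2) * ∫⁻ x, ‖a x‖ₑ ^ 2 ∂μ := by
  have hre : Measurable fun x => (a x).re := Complex.measurable_re.comp ha
  have him : Measurable fun x => (a x).im := Complex.measurable_im.comp ha
  have hm : Measurable fun c : J → Ω => ∑ j, w j * (a (c j)).re :=
    Finset.measurable_sum _ fun j _ => (hre.comp (measurable_pi_apply j)).const_mul (w j)
  simp_rw [enorm_sq_eq_re_add_im, Complex.re_sum, Complex.im_sum, Complex.re_ofReal_mul,
    Complex.im_ofReal_mul]
  rw [lintegral_add_left (hm.pow_const 2).ennreal_ofReal,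
    lintegral_add_left (hre.pow_const 2).ennreal_ofReal, mul_add]
  exact add_le_add
    (lintegral_sq_weighted_sum_le μ hw hre fun x => (Complex.abs_re_le_norm _).trans (hC x))
    (lintegral_sq_weighted_sum_le μ hw him fun x => (Complex.abs_im_le_norm _).trans (hC x))

/-- Summation over the matrix entries of an operator; with values in `ℝ≥0∞` sums and integrals
commute without summability conditions. -/
theorem lintegral_tsum_enorm_sq_weighted_sum_le (hw : ∑ j, w j = 0) {ι κ : Type*} [Countable ι]
    [Countable κ] {a : κ → ι → Ω → ℂ} (ha : ∀ k i, Measurable (a k i))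
    {C : ℝ} (hC : ∀ k i x, ‖a k i x‖ ≤ C) :
    ∫⁻ c : J → Ω, ∑' k, ∑' i, ‖∑ j, (w j : ℂ) * a k i (c j)‖ₑ ^ 2 ∂(Measure.pi fun _ => μ)
      ≤ ENNReal.ofReal (∑ j, w j ^ 2) * ∫⁻ x, ∑' k, ∑' i, ‖a k i x‖ₑ ^ 2 ∂μ := by
  have h1 : ∀ k i, Measurable fun c : J → Ω => ‖∑ j, (w j : ℂ) * a k i (c j)‖ₑ ^ 2 :=
    fun k i => Measurable.pow_const (Measurable.enorm (Finset.measurable_sum _ fun j _ =>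
      ((ha k i).comp (measurable_pi_apply j)).const_mul _)) 2
  have h2 : ∀ k i, Measurable fun x => ‖a k i x‖ₑ ^ 2 := fun k i => (ha k i).enorm.pow_const 2
  rw [lintegral_tsum fun k => (Measurable.tsum fun i => h1 k i).aemeasurable,
    lintegral_tsum fun k => (Measurable.tsum fun i => h2 k i).aemeasurable,
    ← ENNReal.tsum_mul_left]
  refine ENNReal.tsum_le_tsum fun k => ?_
  rw [lintegral_tsum fun i => (h1 k i).aemeasurable, lintegral_tsum fun i => (h2 k i).aemeasurable,
    ← ENNReal.tsum_mul_left]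
  exact ENNReal.tsum_le_tsum fun i => lintegral_enorm_sq_weighted_sum_le μ hw (ha k i) (hC k i)

end WeightedSums

/-! ### One-shot soft covering. -/

section Covering

variable {H : Type*} [NormedAddCommGroup H] [InnerProductSpace ℂ H] [CompleteSpace H]
  [TopologicalSpace.SeparableSpace H] {Ω J : Type*} [MeasurableSpace Ω] [Fintype J]
  (μ : Measure Ω) [IsProbabilityMeasure μ] {ρ : Ω → DensityOp H} {w : J → ℝ}

theorem measurable_lowPart_entry (hρ : Measurable ρ) (r : ℝ) (u v : H) :
    Measurable fun x => inner ℂ u (lowPart r (ρ x).op v) := by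
  have h1 := continuousOn_cfc_density (H := H) (fun t => min t r)
    (continuous_min_const r).continuousOn
  have h2 : Continuous fun σ : DensityOp H => inner ℂ u (cfc (fun t => min t r) σ.op v) :=
    continuous_const.inner ((ContinuousLinearMap.apply ℂ H v).continuous.comp h1)
  exact h2.measurable.comp hρ

theorem norm_lowPart_le {r : ℝ} (hr : 0 ≤ r) (σ : DensityOp H) : ‖lowPart r σ.op‖ ≤ 1 :=
  (CStarAlgebra.norm_le_norm_of_nonneg_of_le (lowPart_nonneg hr σ.op_nonneg)
    (lowPart_le_self r σ.op_nonneg)).trans σ.norm_op_le_one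

theorem norm_lowPart_entry_le {r : ℝ} (hr : 0 ≤ r) (σ : DensityOp H) (i k : stdIndex H) :
    ‖inner ℂ (stdBasis H i) (lowPart r σ.op (stdBasis H k))‖ ≤ 1 := by
  refine (norm_inner_le_norm _ _).trans ?_
  have h1 := (lowPart r σ.op).le_opNorm (stdBasis H k)
  rw [norm_stdBasis, mul_one] at h1
  rw [norm_stdBasis, one_mul]
  exact h1.trans (norm_lowPart_le hr _)

theorem hsSq_eq_tsum_tsum (A : H →L[ℂ] H) : hsSq (stdBasis H) A
    = ∑' k, ∑' i, ‖inner ℂ (stdBasis H i) (A (stdBasis H k))‖ₑ ^ 2 :=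
  tsum_congr fun k => enorm_sq_eq_tsum (stdBasis H) (A (stdBasis H k))

theorem inner_sum_smul (A : J → H →L[ℂ] H) (u v : H) :
    inner ℂ u ((∑ j, (w j : ℂ) • A j) v) = ∑ j, (w j : ℂ) * inner ℂ u (A j v) := by
  rw [sum_apply, inner_sum]
  simp only [smul_apply, inner_smul_right]

/-- The variance bound in each matrix entry, combined with the bound `r` on the squared
Hilbert-Schmidt norm of a clipped state. -/
theorem lintegral_hsSq_weighted_sum_le (hρ : Measurable ρ) (hw : ∑ j, w j = 0) {r : ℝ}
    (hr : 0 ≤ r) :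
    ∫⁻ c : J → Ω, hsSq (stdBasis H) (∑ j, (w j : ℂ) • lowPart r (ρ (c j)).op)
      ∂(Measure.pi fun _ => μ) ≤ ENNReal.ofReal (∑ j, w j ^ 2) * ENNReal.ofReal r := by
  have h1 := lintegral_tsum_enorm_sq_weighted_sum_le μ hw
    (a := fun k i x => inner ℂ (stdBasis H i) (lowPart r (ρ x).op (stdBasis H k)))
    (fun k i => measurable_lowPart_entry hρ r _ _)
    (fun k i x => norm_lowPart_entry_le hr (ρ x) i k)
  simp_rw [← inner_sum_smul, ← hsSq_eq_tsum_tsum] at h1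
  refine h1.trans (mul_le_mul' le_rfl ?_)
  calc ∫⁻ x, hsSq (stdBasis H) (lowPart r (ρ x).op) ∂μ ≤ ∫⁻ _, ENNReal.ofReal r ∂μ := by
        refine lintegral_mono fun x => ?_
        refine (hsSq_lowPart_le hr (ρ x).op_nonneg).trans ?_
        rw [(ρ x).traceNorm_op, mul_one]
    _ = _ := by simp

/-- Upper bound for the trace-norm distance of `ρ` to its truncation. -/
def truncationLoss (η r : ℝ) (G : H →L[ℂ] H) (σ : DensityOp H) : ℝ≥0∞ :=
  ENNReal.ofReal η + ENNReal.ofReal η⁻¹ * ∑' i, ENNReal.ofReal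
    (inner ℂ ((1 - G) (stdBasis H i)) (σ.op ((1 - G) (stdBasis H i)))).re
  + traceNorm (σ.op - lowPart r σ.op)

theorem traceNorm_sub_truncation_le {η r : ℝ} (hη : 0 < η) {G : H →L[ℂ] H} (hG : star G = G)
    (hG1 : ‖G‖ ≤ 1) (σ : DensityOp H) :
    traceNorm (σ.op - G * lowPart r σ.op * G) ≤ truncationLoss η r G σ := by
  obtain ⟨S, hS, hSS⟩ := exists_sqrt σ.op_nonneg
  -- Compression by `G` is paid for by the gentle measurement bound, clipping by its own trace-norm
  -- loss, which compression does not increase.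
  have h1 : σ.op - G * lowPart r σ.op * G
      = (S * S - G * (S * S) * G) + G * (σ.op - lowPart r σ.op) * G := by
    rw [hSS]; noncomm_ring
  have hS1 : hsSq (stdBasis H) S ≤ 1 := by
    rw [hsSq_eq_traceNorm, hS, hSS, σ.traceNorm_op]
  have hG' : star (1 - G) = 1 - G := by rw [star_sub, star_one, hG]
  rw [h1, truncationLoss, ← hSS, ← hsSq_mul_sqrt hG' hS, hSS]
  refine (traceNorm_add_le _ _).trans (add_le_add ?_ (traceNorm_conj_le hG1))
  rw [← hSS]
  exact traceNorm_sub_conj_le hη hG hG1 hS hS1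

theorem measurable_truncationLoss (hρ : Measurable ρ) (η r : ℝ) (G : H →L[ℂ] H) :
    Measurable fun x => truncationLoss η r G (ρ x) := by
  unfold truncationLoss
  refine (measurable_const.add (Measurable.const_mul (Measurable.tsum fun i =>
    (measurable_re_inner hρ _).ennreal_ofReal) _)).add ?_
  have h1 : ∀ σ : DensityOp H, σ.op - lowPart r σ.op = cfc (fun t : ℝ => t - min t r) σ.op := by
    intro σ
    rw [lowPart, cfc_sub (fun t => t) _ σ.op continuousOn_id (continuous_min_const r).continuousOn,
      cfc_id' ℝ σ.op σ.op_nonneg.isSelfAdjoint]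
  simp_rw [h1]
  exact (measurable_traceNorm_cfc _
    (continuous_id.sub (continuous_min_const r)).continuousOn).comp hρ

/-- Upper bound for the average trace-norm distance of the states `ρ x` to their truncations. -/
def averageLoss (η r θ s s' : ℝ) (hρ : Measurable ρ) : ℝ≥0∞ :=
  ENNReal.ofReal η + ENNReal.ofReal η⁻¹
      * (ENNReal.ofReal (θ ^ s) * traceNorm (opRpow (averageDensity μ hρ).op (1 - s)))
    + ENNReal.ofReal (r ^ (-s')) * ∫⁻ x, traceNorm (opRpow (ρ x).op (1 + s')) ∂μ

/-- The loss through `G` is linear in the state, so its mean is the loss of the average state, from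
which `G` was built. The clipping loss is bounded for each state separately. -/
theorem lintegral_truncationLoss_le (hρ : Measurable ρ) {η r θ s s' : ℝ}
    (hr : 0 < r) (hθ : 0 < θ) (hs : 0 ≤ s) (hs1 : s ≤ 1) (hs' : 0 ≤ s') :
    ∫⁻ x, truncationLoss η r (softProj θ (averageDensity μ hρ).op) (ρ x) ∂μ
      ≤ averageLoss μ η r θ s s' hρ := by
  set G := softProj θ (averageDensity μ hρ).op with hG
  have hm1 : Measurable fun x => ∑' i, ENNReal.ofReal
      (inner ℂ ((1 - G) (stdBasis H i)) ((ρ x).op ((1 - G) (stdBasis H i)))).re :=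
    Measurable.tsum fun i => (measurable_re_inner hρ _).ennreal_ofReal
  have hm0 : Measurable fun x => ENNReal.ofReal η + ENNReal.ofReal η⁻¹ * ∑' i, ENNReal.ofReal
      (inner ℂ ((1 - G) (stdBasis H i)) ((ρ x).op ((1 - G) (stdBasis H i)))).re :=
    measurable_const.add (hm1.const_mul _)
  unfold truncationLoss averageLoss
  rw [lintegral_add_left hm0, lintegral_add_left measurable_const, lintegral_const_mul _ hm1,
    lintegral_const, measure_univ, mul_one]
  refine add_le_add (add_le_add le_rfl (mul_le_mul' le_rfl ?_)) ?_
  · rw [← tsum_ofReal_inner_averageState μ hρ fun i => (1 - G) (stdBasis H i)]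
    have h0 := (averageDensity μ hρ).op_nonneg
    obtain ⟨S, hS, hSS⟩ := exists_sqrt h0
    have hG' : star (1 - G) = 1 - G := by rw [star_sub, star_one, hG, star_softProj]
    have h1 := hsSq_one_sub_softProj_mul_le hθ hs hs1 h0 hS hSS
    rw [← hG, hsSq_mul_sqrt hG' hS, hSS] at h1
    exact h1
  · have hm2 : Measurable fun x => traceNorm (opRpow (ρ x).op (1 + s')) := by
      have h1 : ∀ x, opRpow (ρ x).op (1 + s') = cfc (fun t : ℝ => t ^ (1 + s')) (ρ x).op :=
        fun x => rpow_eq_cfc (ρ x).op_nonneg _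
      simp_rw [h1]
      exact (measurable_traceNorm_cfc _
        (Real.continuous_rpow_const (by linarith)).continuousOn).comp hρ
    rw [← lintegral_const_mul _ hm2]
    exact lintegral_mono fun x => traceNorm_sub_lowPart_le hr hs' (ρ x).op_nonneg

/-- One-shot soft covering: weighted sums of independent random states, with weights that add up
to zero, are small in trace norm. -/
theorem lintegral_traceNorm_weighted_sum_le (hρ : Measurable ρ) (hw : ∑ j, w j = 0)
    {η r θ s s' : ℝ} (hη : 0 < η) (hr : 0 < r) (hθ : 0 < θ) (hs : 0 ≤ s) (hs1 : s ≤ 1)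
    (hs' : 0 ≤ s') :
    ∫⁻ c : J → Ω, traceNorm (∑ j, (w j : ℂ) • (ρ (c j)).op) ∂(Measure.pi fun _ => μ)
      ≤ ENNReal.ofReal (∑ j, |w j|) * averageLoss μ η r θ s s' hρ
        + ENNReal.ofReal (η + (∑ j, w j ^ 2) * r / (η * θ)) := by
  set G := softProj θ (averageDensity μ hρ).op with hG
  have h0 := (averageDensity μ hρ).op_nonneg
  have hGs : star G = G := star_softProj _ _
  have hG1 : ‖G‖ ≤ 1 := norm_softProj_le hθ h0
  have hGh : hsSq (stdBasis H) G ≤ ENNReal.ofReal θ⁻¹ := by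
    have := hsSq_softProj_le hθ h0
    rwa [(averageDensity μ hρ).traceNorm_op, mul_one] at this
  have hc : 0 < η * θ := mul_pos hη hθ
  have hpt : ∀ c : J → Ω, traceNorm (∑ j, (w j : ℂ) • (ρ (c j)).op)
      ≤ ∑ j, ENNReal.ofReal |w j| * truncationLoss η r G (ρ (c j))
        + (ENNReal.ofReal η + ENNReal.ofReal (η * θ)⁻¹
          * hsSq (stdBasis H) (∑ j, (w j : ℂ) • lowPart r (ρ (c j)).op)) := by
    intro c
    -- Truncation errors are summed by the triangle inequality; only the truncated part exploits
    -- cancellation between the codewords.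
    have h1 : ∑ j, (w j : ℂ) • (ρ (c j)).op
        = ∑ j, (w j : ℂ) • ((ρ (c j)).op - G * lowPart r (ρ (c j)).op * G)
          + G * (∑ j, (w j : ℂ) • lowPart r (ρ (c j)).op) * G := by
      rw [Finset.mul_sum, Finset.sum_mul, ← Finset.sum_add_distrib]
      refine Finset.sum_congr rfl fun j _ => ?_
      rw [mul_smul_comm, smul_mul_assoc, ← smul_add, sub_add_cancel]
    have h2 : ∀ (t : Finset J) (A : J → H →L[ℂ] H),
        traceNorm (∑ j ∈ t, A j) ≤ ∑ j ∈ t, traceNorm (A j) := by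
      classical
      intro t A
      induction t using Finset.induction_on with
      | empty => simp [traceNorm_zero]
      | insert i t hi ih =>
        rw [Finset.sum_insert hi, Finset.sum_insert hi]
        exact (traceNorm_add_le _ _).trans (add_le_add le_rfl ih)
    rw [h1]
    refine (traceNorm_add_le _ _).trans (add_le_add ?_ ?_)
    · refine (h2 _ _).trans (Finset.sum_le_sum fun j _ => ?_)
      rw [traceNorm_smul, ← ofReal_norm, Complex.norm_real, Real.norm_eq_abs]
      exact mul_le_mul' le_rfl (traceNorm_sub_truncation_le hη hGs hG1 _)
    -- As `hsSq G ≤ θ⁻¹`, the weight `η * θ` makes the first Cauchy-Schwarz term at most `η`.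
    · refine (traceNorm_conj_le_hsSq hc hG1).trans ?_
      refine (mul_le_of_le_one_left' (ENNReal.inv_le_one.2 one_le_two)).trans ?_
      refine add_le_add ?_ le_rfl
      refine (mul_le_mul' le_rfl hGh).trans ?_
      rw [← ENNReal.ofReal_mul hc.le, mul_assoc, mul_inv_cancel₀ hθ.ne', mul_one]
  refine (lintegral_mono hpt).trans ?_
  have hloss := measurable_truncationLoss hρ η r G
  have hm : ∀ j : J, Measurable fun c : J → Ω =>
      ENNReal.ofReal |w j| * truncationLoss η r G (ρ (c j)) :=
    fun j => (hloss.comp (measurable_pi_apply j)).const_mul _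
  rw [lintegral_add_left (Finset.measurable_sum _ fun j _ => hm j),
    lintegral_add_left measurable_const, lintegral_finsetSum _ fun j _ => hm j,
    lintegral_const_mul' _ _ ENNReal.ofReal_ne_top, lintegral_const, measure_univ, mul_one]
  refine add_le_add ?_ ?_
  · rw [ENNReal.ofReal_sum_of_nonneg fun _ _ => abs_nonneg _, Finset.sum_mul]
    refine Finset.sum_le_sum fun j _ => ?_
    have hmj : Measurable fun c : J → Ω => truncationLoss η r G (ρ (c j)) :=
      hloss.comp (measurable_pi_apply j)
    rw [lintegral_const_mul _ hmj,
      (measurePreserving_eval (fun _ : J => μ) j).lintegral_comp hloss]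
    exact mul_le_mul' le_rfl (lintegral_truncationLoss_le μ hρ hr hθ hs hs1 hs')
  · have hW : 0 ≤ ∑ j, w j ^ 2 := Finset.sum_nonneg fun _ _ => sq_nonneg _
    rw [ENNReal.ofReal_add hη.le (by positivity)]
    refine add_le_add le_rfl ?_
    refine (mul_le_mul' le_rfl (lintegral_hsSq_weighted_sum_le μ hρ hw hr.le)).trans ?_
    rw [← ENNReal.ofReal_mul hW, ← ENNReal.ofReal_mul (by positivity)]
    refine ENNReal.ofReal_le_ofReal (le_of_eq ?_)
    rw [div_eq_mul_inv, mul_comm]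

/-- A state of trace one is its truncation plus the loss, and the truncation has trace norm at most
`r * hsSq G ≤ r / θ`. Hence a small loss forces `r / θ` not to be small. -/
theorem one_le_averageLoss_add (hρ : Measurable ρ) {η r θ s s' : ℝ} (hη : 0 < η) (hr : 0 < r)
    (hθ : 0 < θ) (hs : 0 ≤ s) (hs1 : s ≤ 1) (hs' : 0 ≤ s') :
    1 ≤ averageLoss μ η r θ s s' hρ + ENNReal.ofReal (r / θ) := by
  set G := softProj θ (averageDensity μ hρ).op with hG
  have h0 := (averageDensity μ hρ).op_nonneg
  have hGs : star G = G := star_softProj _ _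
  have hG1 : ‖G‖ ≤ 1 := norm_softProj_le hθ h0
  have hGh : hsSq (stdBasis H) G ≤ ENNReal.ofReal θ⁻¹ := by
    have := hsSq_softProj_le hθ h0
    rwa [(averageDensity μ hρ).traceNorm_op, mul_one] at this
  have hpt : ∀ x, 1 ≤ truncationLoss η r G (ρ x) + ENNReal.ofReal (r / θ) := by
    intro x
    have h1 := traceNorm_add_le ((ρ x).op - G * lowPart r (ρ x).op * G) (G * lowPart r (ρ x).op * G)
    rw [sub_add_cancel, (ρ x).traceNorm_op] at h1
    refine h1.trans (add_le_add (traceNorm_sub_truncation_le hη hGs hG1 _) ?_)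
    refine (traceNorm_conj_le_of_le hGs (lowPart_nonneg hr.le (ρ x).op_nonneg) hr.le
      (lowPart_le_smul r (ρ x).op_nonneg)).trans ?_
    refine (mul_le_mul' le_rfl hGh).trans ?_
    rw [← ENNReal.ofReal_mul hr.le, div_eq_mul_inv]
  calc (1 : ℝ≥0∞) = ∫⁻ _, 1 ∂μ := by simp
    _ ≤ ∫⁻ x, truncationLoss η r G (ρ x) + ENNReal.ofReal (r / θ) ∂μ := lintegral_mono hpt
    _ = ∫⁻ x, truncationLoss η r G (ρ x) ∂μ + ENNReal.ofReal (r / θ) := by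
        rw [lintegral_add_right _ measurable_const]; simp
    _ ≤ _ := add_le_add (lintegral_truncationLoss_le μ hρ hr hθ hs hs1 hs') le_rfl

end Covering

/-! ### Exponential moments of the information density. -/

section InformationDensity

variable {X Y : Type*} [MeasurableSpace X] [MeasurableSpace Y] (P : Measure X)
  [IsProbabilityMeasure P] (W : Kernel X Y) [IsMarkovKernel W] {f : X → Y → ℝ≥0∞}

/-- The likelihood ratio with the value `∞` replaced by `0`. -/
def finiteRatio (f : X → Y → ℝ≥0∞) (x : X) (y : Y) : ℝ≥0∞ := ENNReal.ofReal (f x y).toReal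

theorem finiteRatio_ne_top (x : X) (y : Y) : finiteRatio f x y ≠ ∞ := ENNReal.ofReal_ne_top

theorem measurable_finiteRatio (hf : Measurable (Function.uncurry f)) :
    Measurable (Function.uncurry (finiteRatio f)) := hf.ennreal_toReal.ennreal_ofReal

theorem lintegral_finiteRatio_le (hf : IsOutputDensity P W f) :
    ∀ᵐ x ∂P, ∫⁻ y, finiteRatio f x y ∂(W ∘ₘ P) ≤ 1 := by
  filter_upwards [hf.ae_eq_rnDeriv] with x hx
  calc ∫⁻ y, finiteRatio f x y ∂(W ∘ₘ P) ≤ ∫⁻ y, f x y ∂(W ∘ₘ P) :=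
        lintegral_mono fun y => ENNReal.ofReal_toReal_le
    _ = ∫⁻ y, (W x).rnDeriv (W ∘ₘ P) y ∂(W ∘ₘ P) := lintegral_congr_ae hx
    _ ≤ W x Set.univ := Measure.lintegral_rnDeriv_le
    _ = 1 := measure_univ

/-- The codeword `x'` is independent of the channel output, so averaging over `x` replaces `W x` by
the output law, against which the density of `W x'` integrates to at most one. -/
theorem lintegral_lintegral_finiteRatio_le (hf : IsOutputDensity P W f) :
    ∫⁻ x, ∫⁻ x', ∫⁻ y, finiteRatio f x' y ∂(W x) ∂P ∂P ≤ 1 := by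
  have hm := measurable_finiteRatio hf.measurable
  have h1 : Measurable fun p : X × X => ∫⁻ y, finiteRatio f p.2 y ∂(W p.1) :=
    Measurable.lintegral_kernel_prod_right (κ := W.comap Prod.fst measurable_fst)
      (f := fun (p : X × X) (y : Y) => finiteRatio f p.2 y)
      (hm.comp ((measurable_snd.comp measurable_fst).prodMk measurable_snd))
  rw [lintegral_lintegral_swap h1.aemeasurable]
  calc ∫⁻ x', ∫⁻ x, ∫⁻ y, finiteRatio f x' y ∂(W x) ∂P ∂P
      = ∫⁻ x', ∫⁻ y, finiteRatio f x' y ∂(W ∘ₘ P) ∂P := by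
        refine lintegral_congr fun x' => ?_
        have hx : Measurable (finiteRatio f x') := hm.comp measurable_prodMk_left
        rw [Measure.lintegral_bind W.measurable.aemeasurable hx.aemeasurable]
    _ ≤ ∫⁻ _, 1 ∂P := lintegral_mono_ae (lintegral_finiteRatio_le P W hf)
    _ = 1 := by simp

theorem ae_density_pos_lt_top (hf : IsOutputDensity P W f) :
    ∀ᵐ p ∂(P ⊗ₘ W), 0 < f p.1 p.2 ∧ f p.1 p.2 < ∞ := by
  refine Measure.ae_compProd_of_ae_ae ?_ ?_
  · exact (measurableSet_lt measurable_const hf.measurable).inter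
      (measurableSet_lt hf.measurable measurable_const)
  · filter_upwards [hf.absolutelyContinuous, hf.ae_eq_rnDeriv] with x hx1 hx2
    filter_upwards [hx1.ae_le hx2, Measure.rnDeriv_pos hx1,
      hx1.ae_le (Measure.rnDeriv_lt_top (W x) (W ∘ₘ P))] with y h1 h2 h3
    rw [h1]
    exact ⟨h2, h3⟩

/-- The left side is `√a`, except that it is `0` at `a = ∞`. -/
theorem mul_rpow_neg_half_le (a : ℝ≥0∞) : a * a ^ (-(1 / 2) : ℝ) ≤ 1 + a := by
  rcases eq_or_ne a 0 with rfl | h0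
  · simp
  rcases eq_or_ne a ∞ with rfl | h1
  · simp
  conv_lhs => enter [1]; rw [← ENNReal.rpow_one a]
  rw [← ENNReal.rpow_add _ _ h0 h1]
  rcases le_total a 1 with h | h
  · exact (ENNReal.rpow_le_one h (by norm_num)).trans le_self_add
  · refine le_trans ?_ le_add_self
    conv_rhs => rw [← ENNReal.rpow_one a]
    exact ENNReal.rpow_le_rpow_of_exponent_le h (by norm_num)

/-- A change of measure gives `∫ f ^ (-1/2) dW = ∫ f ^ (1/2) dP̂ ≤ 2`. Negative exponential moments
of order `1/2` are thus finite for free, and with the assumed positive ones `0` is interior to the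
domain of the moment generating function. -/
theorem lintegral_density_rpow_neg_half_lt_top (hf : IsOutputDensity P W f) :
    ∫⁻ p, f p.1 p.2 ^ (-(1 / 2) : ℝ) ∂(P ⊗ₘ W) < ∞ := by
  have hm : Measurable fun p : X × Y => f p.1 p.2 ^ (-(1 / 2) : ℝ) :=
    hf.measurable.pow_const _
  rw [Measure.lintegral_compProd hm]
  refine lt_of_le_of_lt (b := ∫⁻ _, 2 ∂P) (lintegral_mono_ae ?_) (by simp)
  filter_upwards [hf.absolutelyContinuous, hf.ae_eq_rnDeriv] with x hx1 hx2
  have hmx : Measurable fun y => f x y ^ (-(1 / 2) : ℝ) := hm.comp measurable_prodMk_left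
  rw [← lintegral_rnDeriv_mul hx1 hmx.aemeasurable]
  calc ∫⁻ y, (W x).rnDeriv (W ∘ₘ P) y * f x y ^ (-(1 / 2) : ℝ) ∂(W ∘ₘ P)
      ≤ ∫⁻ y, 1 + (W x).rnDeriv (W ∘ₘ P) y ∂(W ∘ₘ P) := by
        refine lintegral_mono_ae ?_
        filter_upwards [hx2] with y hy
        rw [hy]
        exact mul_rpow_neg_half_le _
    _ = 1 + ∫⁻ y, (W x).rnDeriv (W ∘ₘ P) y ∂(W ∘ₘ P) := by
        rw [lintegral_add_left measurable_const]; simp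
    _ ≤ 1 + W x Set.univ := add_le_add le_rfl Measure.lintegral_rnDeriv_le
    _ = 2 := by rw [measure_univ]; norm_num

theorem ofReal_exp_mul_infoDensity {x : X} {y : Y} (h0 : 0 < f x y) (h1 : f x y < ∞) (s : ℝ) :
    ENNReal.ofReal (Real.exp (s * infoDensity f x y)) = f x y ^ s := by
  have h2 : 0 < (f x y).toReal := ENNReal.toReal_pos h0.ne' h1.ne
  rw [infoDensity, mul_comm, ← Real.rpow_def_of_pos h2, ← ENNReal.ofReal_rpow_of_pos h2,
    ENNReal.ofReal_toReal h1.ne]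

theorem measurable_infoDensity (hf : Measurable (Function.uncurry f)) :
    Measurable fun p : X × Y => infoDensity f p.1 p.2 :=
  Real.measurable_log.comp hf.ennreal_toReal

/-- The moment generating function has value one and derivative `𝔼 Z` at `0`, so at `-s` it is at
most `1 - s * (𝔼 Z - δ)` for small `s > 0`, and `1 + u ≤ exp u`. -/
theorem exists_mgf_neg_le {Ω : Type*} [MeasurableSpace Ω] {μ : Measure Ω} [IsProbabilityMeasure μ]
    {Z : Ω → ℝ} {t u : ℝ} (ht : 0 < t) (hu : u < 0)
    (hti : Integrable (fun ω => Real.exp (t * Z ω)) μ)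
    (hui : Integrable (fun ω => Real.exp (u * Z ω)) μ) {δ : ℝ} (hδ : 0 < δ) :
    ∃ s, 0 < s ∧ Integrable (fun ω => Real.exp (-s * Z ω)) μ
      ∧ ∫ ω, Real.exp (-s * Z ω) ∂μ ≤ Real.exp (-s * (∫ ω, Z ω ∂μ - δ)) := by
  have hsub : Set.Icc u t ⊆ integrableExpSet Z μ :=
    (convex_integrableExpSet (X := Z) (μ := μ)).ordConnected.out hui hti
  have hint : (0 : ℝ) ∈ interior (integrableExpSet Z μ) :=
    interior_mono hsub (by rw [interior_Icc]; exact ⟨hu, ht⟩)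
  have hder : HasDerivAt (mgf Z μ) (∫ ω, Z ω ∂μ) 0 := by
    rw [← deriv_mgf_zero hint]
    exact (differentiableAt_mgf hint).hasDerivAt
  have hlo := hasDerivAt_iff_isLittleO.1 hder
  have hev := hlo.def hδ
  have hmem : ∀ᶠ x in nhds (0 : ℝ), x ∈ integrableExpSet Z μ := mem_interior_iff_mem_nhds.1 hint
  have hneg : Tendsto (fun s : ℝ => -s) (nhdsWithin 0 (Set.Ioi 0)) (nhds 0) := by
    have : Tendsto (fun s : ℝ => -s) (nhds 0) (nhds (-0)) := tendsto_neg 0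
    rw [neg_zero] at this
    exact this.mono_left nhdsWithin_le_nhds
  obtain ⟨s, ⟨h1, h2⟩, hs⟩ :=
    ((hneg.eventually (hev.and hmem)).and self_mem_nhdsWithin).exists
  have hs' : 0 < s := hs
  refine ⟨s, hs', h2, ?_⟩
  change mgf Z μ (-s) ≤ _
  rw [mgf_zero, sub_zero, smul_eq_mul, Real.norm_eq_abs, Real.norm_eq_abs, abs_neg,
    abs_of_pos hs'] at h1
  have h3 := le_of_abs_le h1
  have h4 := Real.add_one_le_exp (-s * (∫ ω, Z ω ∂μ - δ))
  nlinarith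

/-- For small `s > 0` the expectation of `f^{-s}` is at most `exp (-s (I(P, W) - δ))`. -/
theorem exists_lintegral_finiteRatio_rpow_neg_le (hf : IsOutputDensity P W f) {t : ℝ} (ht : 0 < t)
    (hti : Integrable (fun p : X × Y => Real.exp (t * infoDensity f p.1 p.2)) (P ⊗ₘ W))
    {δ : ℝ} (hδ : 0 < δ) :
    ∃ s, 0 < s ∧ ∫⁻ x, ∫⁻ y, finiteRatio f x y ^ (-s) ∂(W x) ∂P
      ≤ ENNReal.ofReal (Real.exp (-s * (mutualInfo P W f - δ))) := by
  have hmi := measurable_infoDensity hf.measurable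
  have hae := ae_density_pos_lt_top P W hf
  have hui : Integrable (fun p : X × Y => Real.exp (-(1 / 2) * infoDensity f p.1 p.2))
      (P ⊗ₘ W) := by
    refine ⟨(hmi.const_mul _).exp.aestronglyMeasurable, ?_⟩
    rw [hasFiniteIntegral_iff_ofReal (Eventually.of_forall fun p => (Real.exp_pos _).le)]
    refine lt_of_le_of_lt (le_of_eq (lintegral_congr_ae ?_))
      (lintegral_density_rpow_neg_half_lt_top P W hf)
    filter_upwards [hae] with p hp
    exact ofReal_exp_mul_infoDensity hp.1 hp.2 _
  obtain ⟨s, hs, hsi, hle⟩ := exists_mgf_neg_le ht (by norm_num) hti hui hδ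
  refine ⟨s, hs, ?_⟩
  have hm : Measurable fun p : X × Y => finiteRatio f p.1 p.2 ^ (-s) :=
    (measurable_finiteRatio hf.measurable).pow_const _
  rw [← Measure.lintegral_compProd hm]
  refine le_trans (le_of_eq ?_) (ENNReal.ofReal_le_ofReal hle)
  rw [ofReal_integral_eq_lintegral_ofReal hsi (Eventually.of_forall fun p => (Real.exp_pos _).le)]
  refine lintegral_congr_ae ?_
  filter_upwards [hae] with p hp
  rw [ofReal_exp_mul_infoDensity hp.1 hp.2, finiteRatio, ENNReal.ofReal_toReal hp.2.ne]

end InformationDensity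

/-! ### Integrals over product measures. -/

section ProductMeasures

theorem lintegral_pi_prod {ι : Type*} [Fintype ι] {Y : Type*} [MeasurableSpace Y]
    (μ : ι → Measure Y) [∀ i, IsProbabilityMeasure (μ i)] {g : ι → Y → ℝ≥0∞}
    (hg : ∀ i, Measurable (g i)) :
    ∫⁻ y, ∏ i, g i (y i) ∂(Measure.pi μ) = ∏ i, ∫⁻ y, g i y ∂(μ i) := by
  have hind := iIndepFun_pi (μ := μ) (X := g) fun i => (hg i).aemeasurable
  have h := lintegral_prod_eq_prod_lintegral_of_indepFun Finset.univ
    (fun (i : ι) (x : ι → Y) => g i (x i)) hind fun i => (hg i).comp (measurable_pi_apply i)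
  rw [h]
  exact Finset.prod_congr rfl fun i _ => (measurePreserving_eval μ i).lintegral_comp (hg i)

theorem lintegral_pi_pair {J Ω : Type*} [Fintype J] [MeasurableSpace Ω] (μ : Measure Ω)
    [IsProbabilityMeasure μ] {j k : J} (hjk : j ≠ k) {g : Ω → Ω → ℝ≥0∞}
    (hg : Measurable (Function.uncurry g)) :
    ∫⁻ c : J → Ω, g (c j) (c k) ∂(Measure.pi fun _ => μ) = ∫⁻ x, ∫⁻ x', g x x' ∂μ ∂μ := by
  have hind := (iIndepFun_pi (μ := fun _ : J => μ) (X := fun _ => id)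
    fun _ => aemeasurable_id).indepFun hjk
  have h := (indepFun_iff_map_prod_eq_prod_map_map
    (measurable_pi_apply j).aemeasurable (measurable_pi_apply k).aemeasurable).1 hind
  have hj : (Measure.pi fun _ : J => μ).map (fun c => c j) = μ :=
    (measurePreserving_eval (fun _ : J => μ) j).map_eq
  have hk : (Measure.pi fun _ : J => μ).map (fun c => c k) = μ :=
    (measurePreserving_eval (fun _ : J => μ) k).map_eq
  rw [hj, hk] at h
  have h2 := lintegral_prod (μ := μ) (ν := μ) (Function.uncurry g) hg.aemeasurable
  rw [← h, lintegral_map hg ((measurable_pi_apply j).prodMk (measurable_pi_apply k))] at h2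
  exact h2

end ProductMeasures

/-! ### Expected decoding error of a random codebook. -/

section ErrorBounds

variable {X Y : Type*} [MeasurableSpace X] [MeasurableSpace Y] (P : Measure X)
  [IsProbabilityMeasure P] (W : Kernel X Y) [IsMarkovKernel W] {h : X → Y → ℝ≥0∞} {n : ℕ}

/-- The likelihood ratio of blocks. -/
def blockRatio (h : X → Y → ℝ≥0∞) (x : Fin n → X) (y : Fin n → Y) : ℝ≥0∞ := ∏ i, h (x i) (y i)

/-- Upper bound for the probability that the likelihood ratio of the transmitted codeword `x` is at
most `τ`. -/
def missBound (h : X → Y → ℝ≥0∞) (τ : ℝ≥0∞) (s : ℝ) (x : Fin n → X) : ℝ≥0∞ :=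
  (∏ i, ∫⁻ y, h (x i) y ^ (-s) ∂(W (x i))) / τ ^ (-s)

/-- Upper bound for the probability that the likelihood ratio of the wrong codeword `x'` exceeds `τ`
if `x` is transmitted. -/
def confusionBound (h : X → Y → ℝ≥0∞) (τ : ℝ≥0∞) (x x' : Fin n → X) : ℝ≥0∞ :=
  (∏ i, ∫⁻ y, h (x' i) y ∂(W (x i))) / τ

theorem measurable_blockRatio (hh : Measurable (Function.uncurry h)) (x : Fin n → X) :
    Measurable (blockRatio h x) :=
  Finset.measurable_fun_prod _ fun i _ =>
    (hh.comp measurable_prodMk_left).comp (measurable_pi_apply i)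

/-- Markov's inequality for the power `-s` of the ratio. Finiteness of `h` is what lets a negative
power commute with the product, as factors `0` and `∞` would conflict. -/
theorem channelPower_le_missBound (hh : Measurable (Function.uncurry h)) (hfin : ∀ x y, h x y ≠ ∞)
    {τ : ℝ≥0∞} (hτ : τ ≠ 0) (hτ' : τ ≠ ∞) {s : ℝ} (hs : 0 < s) (x : Fin n → X) :
    channelPower W x {y | blockRatio h x y ≤ τ} ≤ missBound W h τ s x := by
  have hm : ∀ i, Measurable fun y => h (x i) y ^ (-s) :=
    fun i => (hh.comp measurable_prodMk_left).pow_const _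
  have h1 : {y | blockRatio h x y ≤ τ} ⊆ {y | τ ^ (-s) ≤ ∏ i, h (x i) (y i) ^ (-s)} := by
    intro y hy
    have hy' : blockRatio h x y ≤ τ := hy
    change τ ^ (-s) ≤ ∏ i, h (x i) (y i) ^ (-s)
    rw [ENNReal.prod_rpow_of_ne_top (fun i _ => hfin _ _) (-s), ENNReal.rpow_neg,
      ENNReal.rpow_neg]
    exact ENNReal.inv_le_inv.2 (ENNReal.rpow_le_rpow hy' hs.le)
  refine (measure_mono h1).trans ?_
  rw [missBound, ← lintegral_pi_prod _ hm]
  refine meas_ge_le_lintegral_div ?_ ?_ ?_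
  · exact (Finset.measurable_fun_prod _ fun i _ =>
      (hm i).comp (measurable_pi_apply i)).aemeasurable
  · rw [ENNReal.rpow_neg]
    exact ENNReal.inv_ne_zero.2 (ENNReal.rpow_ne_top_of_nonneg hs.le hτ')
  · rw [ENNReal.rpow_neg]
    exact ENNReal.inv_ne_top.2 (ENNReal.rpow_pos (pos_iff_ne_zero.2 hτ) hτ').ne'

theorem channelPower_le_confusionBound (hh : Measurable (Function.uncurry h))
    {τ : ℝ≥0∞} (hτ : τ ≠ 0) (hτ' : τ ≠ ∞) (x x' : Fin n → X) :
    channelPower W x {y | τ < blockRatio h x' y} ≤ confusionBound W h τ x x' := by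
  have hm : ∀ i, Measurable fun y => h (x' i) y := fun i => hh.comp measurable_prodMk_left
  refine (measure_mono fun y (hy : τ < blockRatio h x' y) => hy.le).trans
    ((meas_ge_le_lintegral_div (measurable_blockRatio hh x').aemeasurable hτ hτ').trans
      (le_of_eq ?_))
  rw [confusionBound, ← lintegral_pi_prod _ hm]
  rfl

theorem measurable_lintegral_kernel {g : X → Y → ℝ≥0∞} (hg : Measurable (Function.uncurry g)) :
    Measurable fun x => ∫⁻ y, g x y ∂(W x) :=
  Measurable.lintegral_kernel_prod_right hg

theorem measurable_lintegral_kernel_pair (hh : Measurable (Function.uncurry h)) :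
    Measurable fun p : X × X => ∫⁻ y, h p.2 y ∂(W p.1) :=
  Measurable.lintegral_kernel_prod_right (κ := W.comap Prod.fst measurable_fst)
    (f := fun (p : X × X) (y : Y) => h p.2 y)
    (hh.comp ((measurable_snd.comp measurable_fst).prodMk measurable_snd))

theorem measurable_missBound (hh : Measurable (Function.uncurry h)) (τ : ℝ≥0∞) (s : ℝ) :
    Measurable (missBound W h τ s (n := n)) :=
  (Finset.measurable_fun_prod _ fun i _ =>
    (measurable_lintegral_kernel W (g := fun x y => h x y ^ (-s)) (hh.pow_const _)).comp
      (measurable_pi_apply i)).div_const _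

theorem measurable_confusionBound (hh : Measurable (Function.uncurry h)) (τ : ℝ≥0∞) :
    Measurable (Function.uncurry (confusionBound W h τ (n := n))) := by
  have hp : Measurable fun p : (Fin n → X) × (Fin n → X) =>
      ∏ i, ∫⁻ y, h (p.2 i) y ∂(W (p.1 i)) := by
    refine Finset.measurable_fun_prod _ fun i _ => ?_
    have hi : Measurable fun p : (Fin n → X) × (Fin n → X) => (p.1 i, p.2 i) :=
      ((measurable_pi_apply i).comp measurable_fst).prodMk
        ((measurable_pi_apply i).comp measurable_snd)
    exact (measurable_lintegral_kernel_pair W hh).comp hi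
  exact hp.div_const _

theorem lintegral_missBound (hh : Measurable (Function.uncurry h)) (τ : ℝ≥0∞) (s : ℝ) :
    ∫⁻ x : Fin n → X, missBound W h τ s x ∂(Measure.pi fun _ => P)
      = (∫⁻ x, ∫⁻ y, h x y ^ (-s) ∂(W x) ∂P) ^ n / τ ^ (-s) := by
  have hm := measurable_lintegral_kernel W (g := fun x y => h x y ^ (-s)) (hh.pow_const _)
  unfold missBound
  simp_rw [div_eq_mul_inv]
  have hp : Measurable fun x : Fin n → X => ∏ i, ∫⁻ y, h (x i) y ^ (-s) ∂(W (x i)) :=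
    Finset.measurable_fun_prod _ fun i _ => hm.comp (measurable_pi_apply i)
  rw [lintegral_mul_const _ hp,
    lintegral_pi_prod (fun _ : Fin n => P) fun _ => hm]
  simp

/-- Both integrals factorize over the letters, and each letter contributes at most one by `h1`. -/
theorem lintegral_confusionBound_le (hh : Measurable (Function.uncurry h)) (τ : ℝ≥0∞)
    (h1 : ∫⁻ x, ∫⁻ x', ∫⁻ y, h x' y ∂(W x) ∂P ∂P ≤ 1) :
    ∫⁻ x : Fin n → X, ∫⁻ x' : Fin n → X, confusionBound W h τ x x' ∂(Measure.pi fun _ => P)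
      ∂(Measure.pi fun _ => P) ≤ τ⁻¹ := by
  have hm := measurable_lintegral_kernel_pair W hh
  have hm1 : ∀ x, Measurable fun x' => ∫⁻ y, h x' y ∂(W x) := fun x => hm.comp measurable_prodMk_left
  have hm2 : Measurable fun x => ∫⁻ x', ∫⁻ y, h x' y ∂(W x) ∂P := hm.lintegral_prod_right'
  unfold confusionBound
  simp_rw [div_eq_mul_inv]
  have e1 : ∀ x : Fin n → X, ∫⁻ x' : Fin n → X, (∏ i, ∫⁻ y, h (x' i) y ∂(W (x i))) * τ⁻¹
      ∂(Measure.pi fun _ => P) = (∏ i, ∫⁻ x', ∫⁻ y, h x' y ∂(W (x i)) ∂P) * τ⁻¹ := by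
    intro x
    have hp : Measurable fun x' : Fin n → X => ∏ i, ∫⁻ y, h (x' i) y ∂(W (x i)) :=
      Finset.measurable_fun_prod _ fun i _ => (hm1 (x i)).comp (measurable_pi_apply i)
    rw [lintegral_mul_const _ hp,
      lintegral_pi_prod (fun _ : Fin n => P) fun i => hm1 (x i)]
  simp_rw [e1]
  have hp : Measurable fun x : Fin n → X => ∏ i, ∫⁻ x', ∫⁻ y, h x' y ∂(W (x i)) ∂P :=
    Finset.measurable_fun_prod _ fun i _ => hm2.comp (measurable_pi_apply i)
  rw [lintegral_mul_const _ hp,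
    lintegral_pi_prod (fun _ : Fin n => P) fun _ => hm2]
  refine mul_le_of_le_one_left' (Finset.prod_le_one' fun _ _ => h1)

variable {J : Type*} [Fintype J] [DecidableEq J]

/-- Upper bound for the sum of the error probabilities of all the codewords of a codebook. -/
def errorBound (h : X → Y → ℝ≥0∞) (τ : ℝ≥0∞) (s : ℝ) (c : J → Fin n → X) : ℝ≥0∞ :=
  ∑ j, (missBound W h τ s (c j) + ∑ k ∈ Finset.univ.erase j, confusionBound W h τ (c j) (c k))

theorem measurable_confusionBound_apply (hh : Measurable (Function.uncurry h)) (τ : ℝ≥0∞) (j k : J) :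
    Measurable fun c : J → Fin n → X => confusionBound W h τ (c j) (c k) := by
  have hpair : Measurable fun c : J → Fin n → X => (c j, c k) :=
    (measurable_pi_apply j).prodMk (measurable_pi_apply k)
  exact (measurable_confusionBound W hh τ).comp hpair

theorem measurable_errorBound (hh : Measurable (Function.uncurry h)) (τ : ℝ≥0∞) (s : ℝ) :
    Measurable (errorBound W h τ s (n := n) (J := J)) :=
  Finset.measurable_sum _ fun j _ =>
    ((measurable_missBound W hh τ s).comp (measurable_pi_apply j)).add
      (Finset.measurable_sum _ fun k _ => measurable_confusionBound_apply W hh τ j k)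

/-- A union bound over all other codewords. Those of the same message are included, which only
weakens the estimate; distinct codewords are independent, so each pair contributes at most `τ⁻¹`. -/
theorem lintegral_errorBound_le (hh : Measurable (Function.uncurry h)) (τ : ℝ≥0∞) (s : ℝ)
    (h1 : ∫⁻ x, ∫⁻ x', ∫⁻ y, h x' y ∂(W x) ∂P ∂P ≤ 1) :
    ∫⁻ c : J → Fin n → X, errorBound W h τ s c ∂(Measure.pi fun _ => Measure.pi fun _ => P)
      ≤ Fintype.card J * ((∫⁻ x, ∫⁻ y, h x y ^ (-s) ∂(W x) ∂P) ^ n / τ ^ (-s)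
        + Fintype.card J * τ⁻¹) := by
  have hmm : ∀ j : J, Measurable fun c : J → Fin n → X => missBound W h τ s (c j) :=
    fun j => (measurable_missBound W hh τ s).comp (measurable_pi_apply j)
  have hmc : ∀ j k : J, Measurable fun c : J → Fin n → X => confusionBound W h τ (c j) (c k) :=
    measurable_confusionBound_apply W hh τ
  unfold errorBound
  have hms : ∀ j : J, Measurable fun c : J → Fin n → X => missBound W h τ s (c j)
      + ∑ k ∈ Finset.univ.erase j, confusionBound W h τ (c j) (c k) :=
    fun j => (hmm j).add (Finset.measurable_fun_sum _ fun k _ => hmc j k)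
  rw [lintegral_finsetSum _ fun j _ => hms j]
  refine (Finset.sum_le_card_nsmul _ _ ((∫⁻ x, ∫⁻ y, h x y ^ (-s) ∂(W x) ∂P) ^ n / τ ^ (-s)
    + Fintype.card J * τ⁻¹) fun j _ => ?_).trans (le_of_eq ?_)
  · rw [lintegral_add_left (hmm j), lintegral_finsetSum _ fun k _ => hmc j k]
    refine add_le_add (le_of_eq ?_) ?_
    · rw [(measurePreserving_eval (fun _ : J => Measure.pi fun _ : Fin n => P) j).lintegral_comp
        (measurable_missBound W hh τ s)]
      exact lintegral_missBound P W hh τ s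
    · refine (Finset.sum_le_card_nsmul _ _ τ⁻¹ fun k hk => ?_).trans ?_
      · rw [lintegral_pi_pair _ (Finset.ne_of_mem_erase hk).symm
          (measurable_confusionBound W hh τ)]
        exact lintegral_confusionBound_le P W hh τ h1
      · rw [nsmul_eq_mul]
        refine mul_le_mul' ?_ le_rfl
        exact_mod_cast Finset.card_le_univ _
  · rw [nsmul_eq_mul, Finset.card_univ]

end ErrorBounds

/-! ### The code attached to a codebook. -/

section Codebook

variable {X Y : Type*} [MeasurableSpace X] [MeasurableSpace Y] {n M M' L : ℕ}

open Classical in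
/-- The index at which a predicate is satisfied, if there is exactly one. -/
def uniqueIndex [NeZero M] (p : Fin M → Prop) : Fin M :=
  if hp : ∃ m, p m ∧ ∀ m', p m' → m' = m then hp.choose else 0

theorem uniqueIndex_eq [NeZero M] {p : Fin M → Prop} {m : Fin M} (h1 : p m)
    (h2 : ∀ m', p m' → m' = m) : uniqueIndex p = m := by
  have hp : ∃ m, p m ∧ ∀ m', p m' → m' = m := ⟨m, h1, h2⟩
  rw [uniqueIndex, dif_pos hp]
  exact h2 _ hp.choose_spec.1

/-- The uniform distribution on the codewords of a message. -/
def uniformOn (c : Fin L → Fin n → X) : Measure (Fin n → X) :=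
  (L : ℝ≥0∞)⁻¹ • ∑ l, Measure.dirac (c l)

instance [NeZero L] (c : Fin L → Fin n → X) : IsProbabilityMeasure (uniformOn c) := by
  refine ⟨?_⟩
  rw [uniformOn, Measure.smul_apply, Measure.finsetSum_apply]
  simp only [measure_univ, Finset.sum_const, Finset.card_univ, Fintype.card_fin, nsmul_eq_mul,
    mul_one, smul_eq_mul]
  exact ENNReal.inv_mul_cancel (by exact_mod_cast NeZero.ne L) (ENNReal.natCast_ne_top L)

/-- Valid for arbitrary `g`, so the error probability need not be shown measurable in the codeword.
-/
theorem lintegral_dirac_le {Ω : Type*} [MeasurableSpace Ω] (a : Ω) (g : Ω → ℝ≥0∞) :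
    ∫⁻ x, g x ∂(Measure.dirac a) ≤ g a := by
  obtain ⟨g', hg', hle, heq⟩ := exists_measurable_le_lintegral_eq (Measure.dirac a) g
  rw [heq, lintegral_dirac' a hg']
  exact hle a

theorem lintegral_uniformOn_le (c : Fin L → Fin n → X) (g : (Fin n → X) → ℝ≥0∞) :
    ∫⁻ x, g x ∂(uniformOn c) ≤ (L : ℝ≥0∞)⁻¹ * ∑ l, g (c l) := by
  rw [uniformOn, lintegral_smul_measure, lintegral_finsetSum_measure, smul_eq_mul]
  exact mul_le_mul' le_rfl (Finset.sum_le_sum fun l _ => lintegral_dirac_le _ _)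

theorem integral_uniformOn {E : Type*} [NormedAddCommGroup E] [NormedSpace ℝ E] [CompleteSpace E]
    (c : Fin L → Fin n → X) {g : (Fin n → X) → E} (hg : StronglyMeasurable g) :
    ∫ x, g x ∂(uniformOn c) = (L : ℝ)⁻¹ • ∑ l, g (c l) := by
  rw [uniformOn, integral_smul_measure, integral_finsetSum_measure]
  · simp [integral_dirac' _ _ hg]
  · intro l _
    exact integrable_dirac' hg (by simp)

/-- The wiretap code with uniform random choice among the codewords of a message and with threshold
decoding, for a subset of the messages of a codebook. -/
def codebookCode [NeZero M] [NeZero L] (h : X → Y → ℝ≥0∞) (hh : Measurable (Function.uncurry h))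
    (τ : ℝ≥0∞) (c : Fin M' × Fin L → Fin n → X) (e : Fin M → Fin M') : WiretapCode X Y n M where
  enc := ⟨fun m => uniformOn fun l => c (e m, l), Measurable.of_discrete⟩
  isMarkovKernel_enc := ⟨fun m => inferInstanceAs (IsProbabilityMeasure (uniformOn _))⟩
  dec := fun y => uniqueIndex fun m => ∃ l, τ < blockRatio h (c (e m, l)) y
  measurable_dec := by
    have h1 : Measurable fun (y : Fin n → Y) (m : Fin M) => ∃ l, τ < blockRatio h (c (e m, l)) y := by
      refine measurable_pi_lambda _ fun m => ?_
      refine Measurable.exists fun l => ?_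
      exact measurableSet_setOfPred.1
        (measurableSet_lt measurable_const (measurable_blockRatio hh _))
    exact (Measurable.of_discrete (f := uniqueIndex (M := M))).comp h1

/-- If decoding fails, either the sent codeword is below the threshold or a codeword of another
retained message is above it; otherwise the sent message is the unique index. -/
theorem codebookCode_averageError_le [NeZero M] [NeZero L] {h : X → Y → ℝ≥0∞}
    (hh : Measurable (Function.uncurry h)) (hfin : ∀ x y, h x y ≠ ∞) {τ : ℝ≥0∞} (hτ : τ ≠ 0)
    (hτ' : τ ≠ ∞) (c : Fin M' × Fin L → Fin n → X) {e : Fin M → Fin M'}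
    (he : Function.Injective e) (W : Kernel X Y) [IsMarkovKernel W] {s : ℝ} (hs : 0 < s) :
    (codebookCode h hh τ c e).averageError W ≤ errorBound W h τ s c / (M * L) := by
  set C := codebookCode h hh τ c e with hC
  have key : ∀ m l, channelPower W (c (e m, l)) {y | C.dec y ≠ m}
      ≤ missBound W h τ s (c (e m, l))
        + ∑ k ∈ Finset.univ.erase (e m, l), confusionBound W h τ (c (e m, l)) (c k) := by
    intro m l
    have hsub : {y | C.dec y ≠ m} ⊆ {y | blockRatio h (c (e m, l)) y ≤ τ}
        ∪ ⋃ k ∈ Finset.univ.erase (e m, l), {y | τ < blockRatio h (c k) y} := by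
      intro y hy
      by_contra hcon
      rw [Set.mem_union, not_or] at hcon
      obtain ⟨h1, h2⟩ := hcon
      refine hy (uniqueIndex_eq ⟨l, not_le.1 h1⟩ ?_)
      rintro m' ⟨l', hl'⟩
      by_contra hne
      refine h2 (Set.mem_biUnion (x := (e m', l')) ?_ hl')
      have : (e m', l') ≠ (e m, l) := fun hx => hne (he (Prod.ext_iff.1 hx).1)
      simpa using this
    refine (measure_mono hsub).trans ((measure_union_le _ _).trans (add_le_add ?_ ?_))
    · exact channelPower_le_missBound W hh hfin hτ hτ' hs _
    · refine (measure_biUnion_finset_le _ _).trans (Finset.sum_le_sum fun k _ => ?_)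
      exact channelPower_le_confusionBound W hh hτ hτ' _ _
  have h1 : ∑ m, ∫⁻ x, channelPower W x {y | C.dec y ≠ m} ∂(C.enc m)
      ≤ (L : ℝ≥0∞)⁻¹ * errorBound W h τ s c := by
    calc ∑ m, ∫⁻ x, channelPower W x {y | C.dec y ≠ m} ∂(C.enc m)
        ≤ ∑ m, (L : ℝ≥0∞)⁻¹ * ∑ l, channelPower W (c (e m, l)) {y | C.dec y ≠ m} :=
          Finset.sum_le_sum fun m _ => lintegral_uniformOn_le (fun l => c (e m, l)) _
      _ ≤ (L : ℝ≥0∞)⁻¹ * ∑ m, ∑ l, (missBound W h τ s (c (e m, l))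
            + ∑ k ∈ Finset.univ.erase (e m, l), confusionBound W h τ (c (e m, l)) (c k)) := by
          rw [← Finset.mul_sum]
          exact mul_le_mul' le_rfl
            (Finset.sum_le_sum fun m _ => Finset.sum_le_sum fun l _ => key m l)
      _ ≤ _ := by
          refine mul_le_mul' le_rfl ?_
          rw [errorBound, Fintype.sum_prod_type]
          -- As `e` is injective, the retained messages form part of the sum over the whole
          -- codebook.
          rw [← Finset.sum_image (s := Finset.univ) (g := e)
            (f := fun m' => ∑ l, (missBound W h τ s (c (m', l))
              + ∑ k ∈ Finset.univ.erase (m', l), confusionBound W h τ (c (m', l)) (c k)))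
            fun _ _ _ _ hxy => he hxy]
          exact Finset.sum_le_sum_of_subset (Finset.subset_univ _)
  rw [WiretapCode.averageError]
  refine (ENNReal.div_le_div_right h1 _).trans (le_of_eq ?_)
  rw [div_eq_mul_inv, div_eq_mul_inv, ENNReal.mul_inv (by simp) (by simp)]
  ring

variable {H : Type*} [NormedAddCommGroup H] [InnerProductSpace ℂ H] [CompleteSpace H]
  [TopologicalSpace.SeparableSpace H]

theorem codebookCode_eavesdropperState [NeZero M] [NeZero L] {h : X → Y → ℝ≥0∞}
    (hh : Measurable (Function.uncurry h)) (τ : ℝ≥0∞) (c : Fin M' × Fin L → Fin n → X)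
    (e : Fin M → Fin M') {D : X → DensityOp H} (hD : Measurable D) (m : Fin M) :
    (codebookCode h hh τ c e).eavesdropperState D m
      = (L : ℝ)⁻¹ • ∑ l, (productState n fun i => D (c (e m, l) i)).1 :=
  integral_uniformOn (fun l => c (e m, l))
    (stronglyMeasurable_density (measurable_productState hD n))

/-- The trivial code with a single message. -/
def trivialCode (x : Fin n → X) : WiretapCode X Y n 1 where
  enc := Kernel.const _ (Measure.dirac x)
  isMarkovKernel_enc := inferInstance
  dec := fun _ => 0
  measurable_dec := measurable_const

theorem trivialCode_averageError (x : Fin n → X) (W : Kernel X Y) :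
    (trivialCode (Y := Y) x).averageError W = 0 := by
  have h1 : ∀ m : Fin 1, {y : Fin n → Y | (trivialCode x).dec y ≠ m} = ∅ := by
    intro m
    ext y
    simpa using Subsingleton.elim _ _
  rw [WiretapCode.averageError]
  simp [h1]

end Codebook

/-! ### Selection of a codebook and expurgation. -/

section Expurgation

/-- The sum `f / a + g / b` has mean at most two, and some point does not exceed the mean. -/
theorem exists_le_two_mul_of_lintegral_le {Ω : Type*} [MeasurableSpace Ω] (μ : Measure Ω)
    [IsProbabilityMeasure μ] {f g : Ω → ℝ≥0∞} (hf : Measurable f) (hg : Measurable g)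
    {a b : ℝ≥0∞} (ha : a ≠ 0) (ha' : a ≠ ∞) (hb : b ≠ 0) (hb' : b ≠ ∞)
    (hfa : ∫⁻ x, f x ∂μ ≤ a) (hgb : ∫⁻ x, g x ∂μ ≤ b) :
    ∃ x, f x ≤ 2 * a ∧ g x ≤ 2 * b := by
  have hF : Measurable fun x => f x / a + g x / b := (hf.div_const a).add (hg.div_const b)
  obtain ⟨x, hx⟩ := exists_le_lintegral (μ := μ) hF.aemeasurable
  have h2 : ∫⁻ x, f x / a + g x / b ∂μ ≤ 2 := by
    rw [lintegral_add_left (hf.div_const a)]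
    simp_rw [div_eq_mul_inv]
    rw [lintegral_mul_const _ hf, lintegral_mul_const _ hg, ← div_eq_mul_inv, ← div_eq_mul_inv,
      ← one_add_one_eq_two]
    refine add_le_add ?_ ?_
    · exact ENNReal.div_le_of_le_mul (by rwa [one_mul])
    · exact ENNReal.div_le_of_le_mul (by rwa [one_mul])
  refine ⟨x, ?_, ?_⟩
  · exact (ENNReal.div_le_iff ha ha').1 (le_self_add.trans (hx.trans h2))
  · exact (ENNReal.div_le_iff hb hb').1 (le_add_self.trans (hx.trans h2))

/-- Markov's inequality: if the average of `2 M` numbers is at most `b`, then `M` of them are at most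
`2 b`. -/
theorem exists_injective_le_of_sum_le {M : ℕ} {t : Fin (2 * M) → ℝ≥0∞} {b : ℝ≥0∞}
    (hb : b ≠ 0) (hb' : b ≠ ∞) (ht : ∑ m, t m ≤ 2 * M * b) :
    ∃ e : Fin M → Fin (2 * M), Function.Injective e ∧ ∀ m, t (e m) ≤ 2 * b := by
  classical
  have hcard : M ≤ (Finset.univ.filter fun m => t m ≤ 2 * b).card := by
    by_contra! hlt
    have h1 := Finset.card_filter_add_card_filter_not (s := (Finset.univ : Finset (Fin (2 * M))))
      (fun m => t m ≤ 2 * b)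
    rw [Finset.card_univ, Fintype.card_fin] at h1
    -- At least `M + 1` of the numbers would exceed `2 * b`, and `(M + 1) * (2 * b)` is strictly
    -- above the total.
    have h2 : M + 1 ≤ (Finset.univ.filter fun m => ¬ t m ≤ 2 * b).card := by omega
    have h3 : ((M + 1 : ℕ) : ℝ≥0∞) * (2 * b) ≤ 2 * M * b :=
      calc ((M + 1 : ℕ) : ℝ≥0∞) * (2 * b)
          ≤ ((Finset.univ.filter fun m => ¬ t m ≤ 2 * b).card : ℝ≥0∞) * (2 * b) :=
            mul_le_mul' (by exact_mod_cast h2) le_rfl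
        _ = (Finset.univ.filter fun m => ¬ t m ≤ 2 * b).card • (2 * b) := (nsmul_eq_mul _ _).symm
        _ ≤ ∑ m ∈ Finset.univ.filter fun m => ¬ t m ≤ 2 * b, t m :=
            Finset.card_nsmul_le_sum _ _ _ fun m hm => (not_le.1 (Finset.mem_filter.1 hm).2).le
        _ ≤ ∑ m, t m := Finset.sum_le_sum_of_subset (Finset.filter_subset _ _)
        _ ≤ _ := ht
    have h4 : ((M + 1 : ℕ) : ℝ≥0∞) * (2 * b) = 2 * M * b + 2 * b := by push_cast; ring
    rw [h4] at h3
    have h5 : 2 * M * b ≠ ∞ := ENNReal.mul_ne_top (by finiteness) hb'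
    have h6 : 2 * M * b < 2 * M * b + 2 * b := ENNReal.lt_add_right h5 (by simpa using hb)
    exact absurd h3 (not_le.2 h6)
  refine ⟨fun m => (Finset.univ.filter fun m => t m ≤ 2 * b).orderEmbOfCardLe hcard m,
    (Finset.orderEmbOfCardLe _ hcard).injective, fun m => ?_⟩
  exact (Finset.mem_filter.1 (Finset.orderEmbOfCardLe_mem _ hcard m)).2

variable {M L : ℕ}

/-- The weights of the difference of the codeword averages of two messages. -/
def messageWeight (L : ℕ) (m m₀ : Fin M) (j : Fin M × Fin L) : ℝ :=
  (L : ℝ)⁻¹ * ((if j.1 = m then 1 else 0) - (if j.1 = m₀ then 1 else 0))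

theorem sum_ite_fst_eq (m : Fin M) : ∑ j : Fin M × Fin L, (if j.1 = m then (1 : ℝ) else 0) = L := by
  rw [Fintype.sum_prod_type_right]
  simp

/-- Comparing two messages directly gives centred weights, so the common mean never has to be
subtracted. -/
theorem sum_messageWeight (m m₀ : Fin M) : ∑ j, messageWeight L m m₀ j = 0 := by
  unfold messageWeight
  rw [← Finset.mul_sum, Finset.sum_sub_distrib, sum_ite_fst_eq, sum_ite_fst_eq, sub_self, mul_zero]

theorem sum_abs_messageWeight_le (m m₀ : Fin M) : ∑ j, |messageWeight L m m₀ j| ≤ 2 := by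
  have h1 : ∀ j, |messageWeight L m m₀ j|
      ≤ (L : ℝ)⁻¹ * ((if j.1 = m then 1 else 0) + (if j.1 = m₀ then 1 else 0)) := by
    intro j
    rw [messageWeight, abs_mul, abs_of_nonneg (by positivity : (0 : ℝ) ≤ (L : ℝ)⁻¹)]
    refine mul_le_mul_of_nonneg_left ?_ (by positivity)
    split_ifs <;> norm_num
  refine (Finset.sum_le_sum fun j _ => h1 j).trans ?_
  rw [← Finset.mul_sum, Finset.sum_add_distrib, sum_ite_fst_eq, sum_ite_fst_eq, ← two_mul,
    mul_left_comm]
  have := inv_mul_le_one (a := (L : ℝ))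
  linarith

theorem sum_messageWeight_sq_le (m m₀ : Fin M) : ∑ j, messageWeight L m m₀ j ^ 2 ≤ 2 / L := by
  have h1 : ∀ j, messageWeight L m m₀ j ^ 2 ≤ ((L : ℝ)⁻¹ * (L : ℝ)⁻¹)
      * ((if j.1 = m then 1 else 0) + (if j.1 = m₀ then 1 else 0)) := by
    intro j
    rw [messageWeight, mul_pow, sq (L : ℝ)⁻¹]
    refine mul_le_mul_of_nonneg_left ?_ (by positivity)
    split_ifs <;> norm_num
  refine (Finset.sum_le_sum fun j _ => h1 j).trans (le_of_eq ?_)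
  rw [← Finset.mul_sum, Finset.sum_add_distrib, sum_ite_fst_eq, sum_ite_fst_eq, ← two_mul]
  rcases eq_or_ne (L : ℝ) 0 with h | h
  · simp [h]
  · field_simp

theorem sum_messageWeight_smul {V : Type*} [AddCommGroup V] [Module ℂ V] (m m₀ : Fin M)
    (v : Fin M × Fin L → V) :
    ∑ j, (messageWeight L m m₀ j : ℂ) • v j
      = (L : ℂ)⁻¹ • ∑ l, v (m, l) - (L : ℂ)⁻¹ • ∑ l, v (m₀, l) := by
  have h1 : ∀ m' : Fin M, ∑ j : Fin M × Fin L, (if j.1 = m' then (1 : ℂ) else 0) • v j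
      = ∑ l, v (m', l) := by
    intro m'
    rw [Fintype.sum_prod_type]
    simp [ite_smul]
  have h2 : ∀ j, (messageWeight L m m₀ j : ℂ) • v j
      = (L : ℂ)⁻¹ • ((if j.1 = m then (1 : ℂ) else 0) • v j)
        - (L : ℂ)⁻¹ • ((if j.1 = m₀ then (1 : ℂ) else 0) • v j) := by
    intro j
    rw [← smul_sub, ← sub_smul, smul_smul, messageWeight]
    split_ifs <;> simp
  simp_rw [h2]
  rw [Finset.sum_sub_distrib, ← Finset.smul_sum, ← Finset.smul_sum, h1, h1]

end Expurgation

/-! ### Existence of a code at fixed block length. -/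

section RandomCoding

variable {X Y : Type*} [MeasurableSpace X] [MeasurableSpace Y] (P : Measure X)
  [IsProbabilityMeasure P] (W : Kernel X Y) [IsMarkovKernel W]
  {H : Type*} [NormedAddCommGroup H] [InnerProductSpace ℂ H] [CompleteSpace H]
  [TopologicalSpace.SeparableSpace H] {D : X → DensityOp H} {n M L : ℕ}

theorem TraceClass.op_sum_smul {J : Type*} [Fintype J] (w : J → ℂ) (A : J → TraceClass H) :
    (∑ j, w j • A j).op = ∑ j, w j • (A j).op :=
  map_sum (traceClassSubmodule H).subtype (fun j => w j • A j) Finset.univ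

theorem TraceClass.traceNorm_op_eq (A : TraceClass H) : traceNorm A.op = ENNReal.ofReal ‖A‖ :=
  (ENNReal.ofReal_toReal A.isTraceClass.ne).symm

/-- Random coding with expurgation, at a fixed block length. -/
theorem exists_wiretapCode (hD : Measurable D) {h : X → Y → ℝ≥0∞}
    (hh : Measurable (Function.uncurry h)) (hfin : ∀ x y, h x y ≠ ∞)
    (h1 : ∫⁻ x, ∫⁻ x', ∫⁻ y, h x' y ∂(W x) ∂P ∂P ≤ 1) {τ : ℝ≥0∞} (hτ : τ ≠ 0) (hτ' : τ ≠ ∞)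
    {σ : ℝ} (hσ : 0 < σ) (hM : 0 < M) (hL : 0 < L) {η r θ s s' : ℝ} (hη : 0 < η) (hr : 0 < r)
    (hθ : 0 < θ) (hs : 0 ≤ s) (hs1 : s ≤ 1) (hs' : 0 ≤ s') {a b : ℝ} (ha : 0 < a) (hb : 0 < b)
    (herr : (∫⁻ x, ∫⁻ y, h x y ^ (-σ) ∂(W x) ∂P) ^ n / τ ^ (-σ) + ((2 * M * L : ℕ) : ℝ≥0∞) * τ⁻¹
      ≤ ENNReal.ofReal a)
    (hsec : 2 * averageLoss (Measure.pi fun _ : Fin n => P) η r θ s s' (measurable_productState hD n)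
      + ENNReal.ofReal (η + 2 / L * r / (η * θ)) ≤ ENNReal.ofReal b) :
    ∃ C : WiretapCode X Y n M, C.averageError W ≤ ENNReal.ofReal (4 * a) ∧
      C.HasSecurityLevel D (8 * b) := by
  have : NeZero M := ⟨hM.ne'⟩
  have : NeZero L := ⟨hL.ne'⟩
  set ρ : (Fin n → X) → DensityOp (TensorPower H n) := fun x => productState n fun i => D (x i)
    with hρ
  have hρm : Measurable ρ := measurable_productState hD n
  set μ : Measure (Fin (2 * M) × Fin L → Fin n → X) := Measure.pi fun _ => Measure.pi fun _ => P
    with hμ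
  -- A fixed reference message: one distance per message is controlled instead of one per pair. It
  -- need not survive expurgation.
  let m₀ : Fin (2 * M) := ⟨0, by omega⟩
  let T : Fin (2 * M) → (Fin (2 * M) × Fin L → Fin n → X) → TraceClass (TensorPower H n) :=
    fun m c => ∑ j, (messageWeight L m m₀ j : ℂ) • (ρ (c j)).1
  have hTm : ∀ m, Measurable (T m) := fun m => Finset.measurable_fun_sum _ fun j _ =>
    ((measurable_subtype_coe.comp hρm).comp (measurable_pi_apply j)).const_smul
      (messageWeight L m m₀ j : ℂ)
  have hTn : ∀ m, Measurable fun c => ENNReal.ofReal ‖T m c‖ := fun m =>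
    (hTm m).norm.ennreal_ofReal
  have hTi : ∀ m, ∫⁻ c, ENNReal.ofReal ‖T m c‖ ∂μ ≤ ENNReal.ofReal b := by
    intro m
    have h2 := lintegral_traceNorm_weighted_sum_le (Measure.pi fun _ : Fin n => P) hρm
      (sum_messageWeight (L := L) m m₀) hη hr hθ hs hs1 hs'
    have h3 : ∀ c, ENNReal.ofReal ‖T m c‖
        = traceNorm (∑ j, (messageWeight L m m₀ j : ℂ) • (ρ (c j)).op) := by
      intro c
      rw [← TraceClass.traceNorm_op_eq, TraceClass.op_sum_smul]
      rfl
    simp_rw [h3]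
    refine h2.trans ((add_le_add (mul_le_mul' ?_ le_rfl) (ENNReal.ofReal_le_ofReal ?_)).trans hsec)
    · refine (ENNReal.ofReal_le_ofReal (sum_abs_messageWeight_le m m₀)).trans (by simp)
    · have := sum_messageWeight_sq_le (L := L) m m₀
      gcongr
  have hJ : Fintype.card (Fin (2 * M) × Fin L) = 2 * M * L := by simp
  have hE : ∫⁻ c, errorBound W h τ σ c ∂μ
      ≤ ((2 * M * L : ℕ) : ℝ≥0∞) * ENNReal.ofReal a := by
    have h2 := lintegral_errorBound_le (n := n) (J := Fin (2 * M) × Fin L) P W hh τ σ h1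
    rw [hJ] at h2
    exact h2.trans (mul_le_mul' le_rfl herr)
  have hS : ∫⁻ c, ∑ m, ENNReal.ofReal ‖T m c‖ ∂μ ≤ ((2 * M : ℕ) : ℝ≥0∞) * ENNReal.ofReal b := by
    rw [lintegral_finsetSum _ fun m _ => hTn m]
    refine (Finset.sum_le_card_nsmul _ _ _ fun m _ => hTi m).trans (le_of_eq ?_)
    rw [Finset.card_univ, Fintype.card_fin, nsmul_eq_mul]
  have hb0 : ENNReal.ofReal b ≠ 0 := (ENNReal.ofReal_pos.2 hb).ne'
  have ha0 : ENNReal.ofReal a ≠ 0 := (ENNReal.ofReal_pos.2 ha).ne'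
  obtain ⟨c, hc1, hc2⟩ := exists_le_two_mul_of_lintegral_le μ (measurable_errorBound W hh τ σ)
    (Finset.measurable_fun_sum _ fun m _ => hTn m)
    (mul_ne_zero (by exact_mod_cast (by positivity : 2 * M * L ≠ 0)) ha0)
    (ENNReal.mul_ne_top (ENNReal.natCast_ne_top _) ENNReal.ofReal_ne_top)
    (mul_ne_zero (by exact_mod_cast (by positivity : 2 * M ≠ 0)) hb0)
    (ENNReal.mul_ne_top (ENNReal.natCast_ne_top _) ENNReal.ofReal_ne_top) hE hS
  -- The average distance is at most `2 * b`, so half of the messages have distance at most `4 * b`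
  -- to the reference, hence `8 * b` to each other. The error sum, at most `2 * (2 * M * L) * a`, is
  -- now divided by `M * L`, which gives `4 * a`.
  obtain ⟨e, he, hle⟩ := exists_injective_le_of_sum_le
    (b := 2 * ENNReal.ofReal b) (mul_ne_zero two_ne_zero hb0)
    (ENNReal.mul_ne_top ENNReal.ofNat_ne_top ENNReal.ofReal_ne_top)
    (hc2.trans (le_of_eq (by push_cast; ring)))
  refine ⟨codebookCode h hh τ c e, ?_, ?_⟩
  · refine (codebookCode_averageError_le hh hfin hτ hτ' c he W hσ).trans ?_
    refine ENNReal.div_le_of_le_mul (hc1.trans (le_of_eq ?_))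
    rw [ENNReal.ofReal_mul (by norm_num), ENNReal.ofReal_ofNat]
    push_cast
    ring
  · have hT : ∀ m, ‖T (e m) c‖ ≤ 4 * b := by
      intro m
      have h2 := hle m
      rw [← mul_assoc, (by norm_num : (2 * 2 : ℝ≥0∞) = 4),
        (by simp : (4 : ℝ≥0∞) = ENNReal.ofReal 4), ← ENNReal.ofReal_mul (by norm_num)] at h2
      exact (ENNReal.ofReal_le_ofReal_iff (by positivity)).1 h2
    intro m₁ m₂
    have h2 : (codebookCode h hh τ c e).eavesdropperState D m₁
        - (codebookCode h hh τ c e).eavesdropperState D m₂ = T (e m₁) c - T (e m₂) c := by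
      rw [codebookCode_eavesdropperState, codebookCode_eavesdropperState]
      · change _ = (∑ j, (messageWeight L (e m₁) m₀ j : ℂ) • (ρ (c j)).1)
          - ∑ j, (messageWeight L (e m₂) m₀ j : ℂ) • (ρ (c j)).1
        rw [sum_messageWeight_smul (e m₁) m₀ fun j => (ρ (c j)).1,
          sum_messageWeight_smul (e m₂) m₀ fun j => (ρ (c j)).1, sub_sub_sub_cancel_right,
          ← Complex.coe_smul, ← Complex.coe_smul]
        push_cast
        rfl
      · exact hD
      · exact hD
    rw [h2]
    refine (norm_sub_le _ _).trans ?_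
    linarith [hT m₁, hT m₂]

end RandomCoding

/-! ### Choice of exponents and asymptotics. -/

section Exponents

variable {X Y : Type*} [MeasurableSpace X] [MeasurableSpace Y] (P : Measure X)
  [IsProbabilityMeasure P]
  {H : Type*} [NormedAddCommGroup H] [InnerProductSpace ℂ H] [CompleteSpace H]
  [TopologicalSpace.SeparableSpace H] {D : X → DensityOp H}

theorem traceNorm_opRpow_averageDensity_productState (hD : Measurable D) (n : ℕ) {m : ℕ}
    (hm : 0 < m) :
    traceNorm (opRpow (averageDensity (Measure.pi fun _ : Fin n => P)
      (measurable_productState hD n)).op (1 - 1 / (m : ℝ)))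
      = traceNorm ((averageDensity P hD).op ^ (1 - 1 / (m : ℝ))) ^ n := by
  have h1 : averageDensity (Measure.pi fun _ : Fin n => P) (measurable_productState hD n)
      = productState n fun _ => averageDensity P hD := Subtype.ext (averageState_productState P hD n)
  have h2 : 1 - 1 / (m : ℝ) = ((m - 1 : ℕ) : ℝ) / m := by
    have : (m : ℝ) ≠ 0 := by positivity
    rw [Nat.cast_sub hm]
    field_simp
    norm_num
  rw [h1, h2, traceNorm_opRpow_productState n _ _ hm, Finset.prod_const, Finset.card_univ,
    Fintype.card_fin]
  rfl

theorem lintegral_traceNorm_opRpow_productState (hD : Measurable D) (n : ℕ) {m : ℕ} (hm : 0 < m) :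
    ∫⁻ x, traceNorm (opRpow (productState n fun i => D (x i)).op (1 + 1 / (m : ℝ)))
      ∂(Measure.pi fun _ : Fin n => P)
      = (∫⁻ x, traceNorm ((D x).op ^ (1 + 1 / (m : ℝ))) ∂P) ^ n := by
  have h2 : 1 + 1 / (m : ℝ) = ((m + 1 : ℕ) : ℝ) / m := by
    have : (m : ℝ) ≠ 0 := by positivity
    push_cast
    field_simp
  have hmeas : Measurable fun x => traceNorm ((D x).op ^ (1 + 1 / (m : ℝ))) := by
    simp_rw [fun x => rpow_eq_cfc (D x).op_nonneg (1 + 1 / (m : ℝ))]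
    exact (measurable_traceNorm_cfc _
      (Real.continuous_rpow_const (by positivity)).continuousOn).comp hD
  have h3 : ∀ x : Fin n → X,
      traceNorm (opRpow (productState n fun i => D (x i)).op (1 + 1 / (m : ℝ)))
        = ∏ i, traceNorm ((D (x i)).op ^ (1 + 1 / (m : ℝ))) := by
    intro x
    rw [h2, traceNorm_opRpow_productState n _ _ hm]
    rfl
  simp_rw [h3]
  rw [lintegral_pi_prod (fun _ : Fin n => P) fun _ => hmeas]
  simp

theorem ofReal_exp_pow (x : ℝ) (n : ℕ) :
    ENNReal.ofReal (Real.exp x) ^ n = ENNReal.ofReal (Real.exp (n * x)) := by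
  rw [← ENNReal.ofReal_pow (Real.exp_pos _).le, Real.exp_nat_mul]

/-- The average truncation error of product states decays exponentially. -/
theorem exists_averageLoss_le (hD : Measurable D) {α : ℝ} (hα : 0 < α) (hα1 : α < 1)
    (htr : IsTraceClass ((averageState P D).op ^ α))
    (hlog : IsTraceClass (mulLogOp (averageState P D).op)) {E S : ℝ}
    (hE : E = ∫ x, (trace (mulLogOp (D x).op)).re ∂P)
    (hS : S = -(trace (mulLogOp (averageState P D).op)).re) {δ : ℝ} (hδ : 0 < δ) :
    ∃ κ s s' : ℝ, 0 < κ ∧ κ ≤ δ ∧ 0 ≤ s ∧ s ≤ 1 ∧ 0 ≤ s' ∧ ∀ n : ℕ,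
      averageLoss (Measure.pi fun _ : Fin n => P) (Real.exp (-(κ / 2) * n))
        (Real.exp ((E + 2 * δ) * n)) (Real.exp (-(S + 2 * δ) * n)) s s'
        (measurable_productState hD n) ≤ ENNReal.ofReal (3 * Real.exp (-(κ / 2) * n)) := by
  obtain ⟨m, hm1, hm⟩ := ((eventually_traceNorm_rpow_one_sub_le (averageDensity P hD) hα hα1 htr
    hlog hδ).and (eventually_gt_atTop 0)).exists
  obtain ⟨m', hm', hm1'⟩ := exists_lintegral_traceNorm_rpow_one_add_le P hD hδ
  have hS' : -(trace (mulLogOp (averageDensity P hD).op)).re = S := hS.symm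
  rw [hS'] at hm1
  rw [← hE] at hm1'
  have hmR : (1 : ℝ) ≤ m := by exact_mod_cast hm
  have hmR' : (1 : ℝ) ≤ m' := by exact_mod_cast hm'
  -- The two power traces leave margins `δ / m` and `δ / m'`. One half of `κ` pays for the factor
  -- `η⁻¹`, the other half is the decay rate; `κ ≤ δ` is kept for the variance term.
  refine ⟨min (δ / m) (δ / m'), 1 / m, 1 / m', lt_min (by positivity) (by positivity),
    (min_le_left _ _).trans (div_le_self hδ.le hmR), by positivity,
    (div_le_one (by positivity)).2 hmR, by positivity, fun n => ?_⟩
  set κ := min (δ / m) (δ / m') with hκ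
  have hκ1 : κ ≤ δ / m := min_le_left _ _
  have hκ2 : κ ≤ δ / m' := min_le_right _ _
  have hκ0 : 0 < κ := lt_min (by positivity) (by positivity)
  have hn : (0 : ℝ) ≤ n := Nat.cast_nonneg n
  rw [averageLoss, traceNorm_opRpow_averageDensity_productState P hD n hm,
    lintegral_traceNorm_opRpow_productState P hD n hm', ← Real.exp_neg, ← Real.exp_mul,
    ← Real.exp_mul]
  have e3 : (3 : ℝ) * Real.exp (-(κ / 2) * n) = Real.exp (-(κ / 2) * n) + Real.exp (-(κ / 2) * n)
      + Real.exp (-(κ / 2) * n) := by ring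
  rw [e3, ENNReal.ofReal_add (by positivity) (by positivity),
    ENNReal.ofReal_add (by positivity) (by positivity)]
  refine add_le_add (add_le_add le_rfl ?_) ?_
  · refine (mul_le_mul' le_rfl (mul_le_mul' le_rfl (pow_le_pow_left' hm1 n))).trans ?_
    rw [ofReal_exp_pow, ← ENNReal.ofReal_mul (Real.exp_pos _).le,
      ← ENNReal.ofReal_mul (Real.exp_pos _).le, ← Real.exp_add, ← Real.exp_add]
    refine ENNReal.ofReal_le_ofReal (Real.exp_le_exp.2 ?_)
    have h1 := mul_le_mul_of_nonneg_right hκ1 hn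
    have h2 : -(S + 2 * δ) * n * (1 / m) + n * ((S + δ) / m) = -(δ / m * n) := by field_simp; ring
    rw [h2]
    linarith
  · refine (mul_le_mul' le_rfl (pow_le_pow_left' hm1' n)).trans ?_
    rw [ofReal_exp_pow, ← ENNReal.ofReal_mul (Real.exp_pos _).le, ← Real.exp_add]
    refine ENNReal.ofReal_le_ofReal (Real.exp_le_exp.2 ?_)
    have h1 := mul_le_mul_of_nonneg_right hκ2 hn
    have h2 : (E + 2 * δ) * n * -(1 / m') + n * ((E + δ) / m') = -(δ / m' * n) := by field_simp; ring
    rw [h2]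
    have := mul_nonneg hκ0.le hn
    linarith

/-- Half of the exponent absorbs the constant. -/
theorem eventually_const_mul_exp_le (c : ℝ) {γ : ℝ} (hγ : 0 < γ) :
    ∀ᶠ n : ℕ in atTop, c * Real.exp (-(2 * γ) * n) ≤ Real.exp (-γ * n) := by
  have h1 : Tendsto (fun n : ℕ => Real.exp (γ * n)) atTop atTop :=
    Real.tendsto_exp_atTop.comp (tendsto_natCast_atTop_atTop.const_mul_atTop hγ)
  filter_upwards [h1.eventually_ge_atTop c] with n hn
  calc c * Real.exp (-(2 * γ) * n) ≤ Real.exp (γ * n) * Real.exp (-(2 * γ) * n) := by gcongr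
    _ = Real.exp (-γ * n) := by rw [← Real.exp_add]; congr 1; ring

/-- Rounding up adds less than `1 ≤ exp x`. For `x < 0` this fails, hence the separate treatment of
`R ≤ 0` and the need for `0 ≤ E + S + 5 * δ`. -/
theorem natCeil_exp_le {x : ℝ} (hx : 0 ≤ x) : (⌈Real.exp x⌉₊ : ℝ) ≤ 2 * Real.exp x := by
  have h1 := (Nat.ceil_lt_add_one (Real.exp_pos x).le).le
  have h2 := Real.one_le_exp hx
  linarith

/-- The exponent of the soft-covering threshold cannot be negative, since a state of trace one is
not approximated by an operator of small trace norm. -/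
theorem add_nonneg_of_averageLoss_le (hD : Measurable D) {E S δ κ s s' : ℝ} (hκ : 0 < κ)
    (hs : 0 ≤ s) (hs1 : s ≤ 1) (hs' : 0 ≤ s') (hloss : ∀ n : ℕ,
      averageLoss (Measure.pi fun _ : Fin n => P) (Real.exp (-(κ / 2) * n))
        (Real.exp ((E + 2 * δ) * n)) (Real.exp (-(S + 2 * δ) * n)) s s'
        (measurable_productState hD n) ≤ ENNReal.ofReal (3 * Real.exp (-(κ / 2) * n))) :
    0 ≤ E + S + 4 * δ := by
  by_contra! hneg
  have h0 : ∀ {a : ℝ}, 0 < a → Tendsto (fun n : ℕ => Real.exp (-a * n)) atTop (nhds 0) := by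
    intro a ha
    have h1 : Tendsto (fun n : ℕ => -(a * n)) atTop atBot :=
      tendsto_neg_atTop_atBot.comp (tendsto_natCast_atTop_atTop.const_mul_atTop ha)
    simp_rw [neg_mul]
    exact Real.tendsto_exp_atBot.comp h1
  have h1 : Tendsto (fun n : ℕ => 3 * Real.exp (-(κ / 2) * n)
      + Real.exp (-(-(E + S + 4 * δ)) * n)) atTop (nhds (3 * 0 + 0)) :=
    ((h0 (half_pos hκ)).const_mul 3).add (h0 (neg_pos.2 hneg))
  rw [mul_zero, add_zero] at h1
  obtain ⟨n, hn⟩ := (h1.eventually_lt_const one_pos).exists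
  have h2 := one_le_averageLoss_add (Measure.pi fun _ : Fin n => P) (measurable_productState hD n)
    (Real.exp_pos (-(κ / 2) * n)) (Real.exp_pos ((E + 2 * δ) * n))
    (Real.exp_pos (-(S + 2 * δ) * n)) hs hs1 hs'
  have h3 := h2.trans (add_le_add (hloss n) le_rfl)
  rw [← Real.exp_sub, ← ENNReal.ofReal_add (by positivity) (by positivity), ENNReal.one_le_ofReal,
    (by ring : (E + 2 * δ) * n - -(S + 2 * δ) * n = -(-(E + S + 4 * δ)) * n)] at h3
  linarith

variable (W : Kernel X Y) [IsMarkovKernel W]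

theorem exists_wiretapCode_of_pos_rate (hD : Measurable D) {f : X → Y → ℝ≥0∞}
    (hf : IsOutputDensity P W f) {α : ℝ} (hα : 0 < α) (hα1 : α < 1)
    (htr : IsTraceClass ((averageState P D).op ^ α))
    (hlog : IsTraceClass (mulLogOp (averageState P D).op)) {t : ℝ} (ht : 0 < t)
    (hti : Integrable (fun p : X × Y => Real.exp (t * infoDensity f p.1 p.2)) (P ⊗ₘ W))
    {R : ℝ} (hR0 : 0 < R) (hR : R < mutualInfo P W f - (∫ x, (trace (mulLogOp (D x).op)).re ∂P
      - (trace (mulLogOp (averageState P D).op)).re)) :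
    ∃ γ₁ γ₂ : ℝ, 0 < γ₁ ∧ 0 < γ₂ ∧ ∀ᶠ n : ℕ in atTop, ∃ (M : ℕ) (C : WiretapCode X Y n M),
      R ≤ C.rate ∧ C.averageError W ≤ ENNReal.ofReal (Real.exp (-γ₁ * n)) ∧
      C.HasSecurityLevel D (Real.exp (-γ₂ * n)) := by
  set I := mutualInfo P W f with hI
  obtain ⟨E, hE⟩ : ∃ E, E = ∫ x, (trace (mulLogOp (D x).op)).re ∂P := ⟨_, rfl⟩
  obtain ⟨S, hS⟩ : ∃ S, S = -(trace (mulLogOp (averageState P D).op)).re := ⟨_, rfl⟩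
  -- The gap is split into eight parts: five go into `L`, two lower the decoding threshold, and the
  -- last one makes the codebook exponent `I - 3 * δ` smaller than the threshold exponent `I - 2 *
  -- δ`.
  obtain ⟨δ, hδe⟩ : ∃ δ, δ = (I - (E + S) - R) / 8 := ⟨_, rfl⟩
  have hδ : 0 < δ := by rw [hδe, hE, hS]; linarith
  obtain ⟨κ, s, s', hκ, hκδ, hs, hs1, hs', hloss⟩ :=
    exists_averageLoss_le P hD hα hα1 htr hlog hE hS hδ
  have hES := add_nonneg_of_averageLoss_le P hD hκ hs hs1 hs' hloss
  obtain ⟨σ, hσ, hσle⟩ := exists_lintegral_finiteRatio_rpow_neg_le P W hf ht hti hδ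
  rw [← hI] at hσle
  -- Rejection of the true codeword decays at rate `σ * δ`, confusion at rate `δ`; halving leaves
  -- room for constants.
  obtain ⟨γ, hγ⟩ : ∃ γ, γ = min (σ * δ) δ / 2 := ⟨_, rfl⟩
  have hγ0 : 0 < γ := by rw [hγ]; exact half_pos (lt_min (by positivity) hδ)
  have hγ1 : 2 * γ ≤ σ * δ := by rw [hγ, mul_div_cancel₀ _ two_ne_zero]; exact min_le_left _ _
  have hγ2 : 2 * γ ≤ δ := by rw [hγ, mul_div_cancel₀ _ two_ne_zero]; exact min_le_right _ _
  refine ⟨γ, κ / 4, hγ0, by positivity, ?_⟩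
  -- The constants are `4 * 9` for the error and `8 * 9` for the security level.
  filter_upwards [eventually_const_mul_exp_le 36 hγ0,
    eventually_const_mul_exp_le 72 (by positivity : 0 < κ / 4), eventually_gt_atTop 0]
    with n hn1 hn2 hn0
  have hnR : (0 : ℝ) < n := by exact_mod_cast hn0
  set M := ⌈Real.exp (R * n)⌉₊ with hM
  set L := ⌈Real.exp ((E + S + 5 * δ) * n)⌉₊ with hL
  have hM0 : 0 < M := Nat.ceil_pos.2 (Real.exp_pos _)
  have hL0 : 0 < L := Nat.ceil_pos.2 (Real.exp_pos _)
  have hMle : (M : ℝ) ≤ 2 * Real.exp (R * n) := natCeil_exp_le (by positivity)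
  have hLle : (L : ℝ) ≤ 2 * Real.exp ((E + S + 5 * δ) * n) :=
    natCeil_exp_le (mul_nonneg (by linarith) hnR.le)
  have hLge : Real.exp ((E + S + 5 * δ) * n) ≤ L := Nat.le_ceil _
  have hτ0 : ENNReal.ofReal (Real.exp ((I - 2 * δ) * n)) ≠ 0 :=
    (ENNReal.ofReal_pos.2 (Real.exp_pos _)).ne'
  have hcode := exists_wiretapCode (n := n) (M := M) (L := L) P W hD
    (measurable_finiteRatio hf.measurable) (fun x y => finiteRatio_ne_top x y)
    (lintegral_lintegral_finiteRatio_le P W hf)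
    (τ := ENNReal.ofReal (Real.exp ((I - 2 * δ) * n))) hτ0 ENNReal.ofReal_ne_top hσ hM0 hL0
    (Real.exp_pos (-(κ / 2) * n)) (Real.exp_pos ((E + 2 * δ) * n))
    (Real.exp_pos (-(S + 2 * δ) * n)) hs hs1 hs'
    (a := 9 * Real.exp (-(2 * γ) * n)) (b := 9 * Real.exp (-(2 * (κ / 4)) * n))
    (by positivity) (by positivity)
  obtain ⟨C, hC1, hC2⟩ := hcode (by
    -- One part is for rejection; the factor `8` in front of the confusion term comes from the
    -- doubled message set and the rounding of `M` and `L`.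
    have e9 : (9 : ℝ) * Real.exp (-(2 * γ) * n)
        = Real.exp (-(2 * γ) * n) + 8 * Real.exp (-(2 * γ) * n) := by ring
    rw [e9, ENNReal.ofReal_add (by positivity) (by positivity)]
    refine add_le_add ?_ ?_
    · refine (ENNReal.div_le_div_right (pow_le_pow_left' hσle n) _).trans ?_
      rw [ofReal_exp_pow, ENNReal.ofReal_rpow_of_pos (Real.exp_pos _), ← Real.exp_mul,
        ← ENNReal.ofReal_div_of_pos (Real.exp_pos _), ← Real.exp_sub]
      refine ENNReal.ofReal_le_ofReal (Real.exp_le_exp.2 ?_)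
      have := mul_le_mul_of_nonneg_right hγ1 hnR.le
      linarith
    · rw [← ENNReal.ofReal_natCast, ← ENNReal.ofReal_inv_of_pos (Real.exp_pos _),
        ← ENNReal.ofReal_mul (Nat.cast_nonneg _), ← Real.exp_neg]
      refine ENNReal.ofReal_le_ofReal ?_
      push_cast
      calc 2 * (M : ℝ) * L * Real.exp (-((I - 2 * δ) * n))
          ≤ 2 * (2 * Real.exp (R * n)) * (2 * Real.exp ((E + S + 5 * δ) * n))
            * Real.exp (-((I - 2 * δ) * n)) := by gcongr
        _ = 8 * (Real.exp (R * n) * Real.exp ((E + S + 5 * δ) * n)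
            * Real.exp (-((I - 2 * δ) * n))) := by ring
        _ = 8 * Real.exp (-δ * n) := by
            rw [← Real.exp_add, ← Real.exp_add]
            congr 2
            rw [hδe]
            ring
        _ ≤ 8 * Real.exp (-(2 * γ) * n) := by gcongr)
    (by
    -- Here `9 = 2 * 3 + 1 + 2`: truncation loss, `η`, and the variance term.
    refine (add_le_add (mul_le_mul' le_rfl (hloss n)) le_rfl).trans ?_
    rw [(by simp : (2 : ℝ≥0∞) = ENNReal.ofReal 2), ← ENNReal.ofReal_mul (by norm_num),
      ← ENNReal.ofReal_add (by positivity) (by positivity)]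
    refine ENNReal.ofReal_le_ofReal ?_
    have h1 : 2 / (L : ℝ) * Real.exp ((E + 2 * δ) * n)
        / (Real.exp (-(κ / 2) * n) * Real.exp (-(S + 2 * δ) * n))
        ≤ 2 * Real.exp (-(κ / 2) * n) := by
      calc 2 / (L : ℝ) * Real.exp ((E + 2 * δ) * n)
            / (Real.exp (-(κ / 2) * n) * Real.exp (-(S + 2 * δ) * n))
          ≤ 2 / Real.exp ((E + S + 5 * δ) * n) * Real.exp ((E + 2 * δ) * n)
            / (Real.exp (-(κ / 2) * n) * Real.exp (-(S + 2 * δ) * n)) := by gcongr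
        _ = 2 * Real.exp ((κ / 2 - δ) * n) := by
            rw [div_eq_mul_inv, ← Real.exp_add, ← Real.exp_neg, div_eq_mul_inv, ← Real.exp_neg,
              mul_assoc, mul_assoc, ← Real.exp_add, ← Real.exp_add]
            congr 2
            ring
        -- This is `κ / 2 - δ ≤ -(κ / 2)`, that is, `κ ≤ δ`.
        _ ≤ 2 * Real.exp (-(κ / 2) * n) := by gcongr; linarith
    have h2 : (-(2 * (κ / 4)) * n : ℝ) = -(κ / 2) * n := by ring
    rw [h2]
    linarith)
  refine ⟨M, C, ?_, hC1.trans (ENNReal.ofReal_le_ofReal ?_), fun m₁ m₂ => (hC2 m₁ m₂).trans ?_⟩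
  · rw [WiretapCode.rate, le_div_iff₀ hnR,
      Real.le_log_iff_exp_le (by exact_mod_cast hM0)]
    exact Nat.le_ceil _
  · linarith
  · linarith

end Exponents

/-! ### Infinite quantum information and nonpositive rates. -/

section EdgeCases

variable {X Y H : Type*} [MeasurableSpace X] [MeasurableSpace Y] [NormedAddCommGroup H]
  [InnerProductSpace ℂ H] [CompleteSpace H]

theorem trivialCode_rate_securityLevel (D : X → DensityOp H) {n : ℕ} (x : Fin n → X) :
    (trivialCode (Y := Y) x).rate = 0 ∧ (trivialCode (Y := Y) x).HasSecurityLevel D 0 := by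
  refine ⟨by simp [WiretapCode.rate], fun m₁ m₂ => ?_⟩
  rw [Subsingleton.elim m₁ m₂, sub_self, norm_zero]

/-- If the quantum information were `⊤`, the difference would be `⊥`, which no real `R` lies above
in the required sense; so the finite branch of the definition applies. -/
theorem quantumInfo_eq_of_lt (P : Measure X) (D : X → DensityOp H) {R I : ℝ}
    (hR : (R : EReal) < (I : EReal) - quantumInfo P D) :
    IsTraceClass (mulLogOp (averageState P D).op) ∧
      R < I - (∫ x, (trace (mulLogOp (D x).op)).re ∂P
        - (trace (mulLogOp (averageState P D).op)).re) := by
  rw [quantumInfo] at hR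
  split_ifs at hR with h
  · exact ⟨h.2, by exact_mod_cast hR⟩
  · simp at hR

end EdgeCases

end Wiretap

end

theorem theorem1 {X Y H : Type*} [MeasurableSpace X] [MeasurableSpace Y]
    [NormedAddCommGroup H] [InnerProductSpace ℂ H] [CompleteSpace H]
    [TopologicalSpace.SeparableSpace H]
    (W : Kernel X Y) [IsMarkovKernel W]
    (D : X → Wiretap.DensityOp H) (hD : Measurable D)
    (P : Measure X) [IsProbabilityMeasure P]
    (f : X → Y → ℝ≥0∞) (hf : Wiretap.IsOutputDensity P W f)
    (hα : ∃ α : ℝ, 0 < α ∧ α < 1 ∧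
      (∀ᵐ x ∂P, Wiretap.IsTraceClass ((D x).op ^ α)) ∧
      Wiretap.IsTraceClass ((Wiretap.averageState P D).op ^ α))
    (ht : ∃ t : ℝ, 0 < t ∧
      Integrable (fun p : X × Y => Real.exp (t * Wiretap.infoDensity f p.1 p.2)) (P ⊗ₘ W))
    (R : ℝ)
    (hR : (R : EReal) < (Wiretap.mutualInfo P W f : EReal) - Wiretap.quantumInfo P D) :
    ∃ γ₁ γ₂ : ℝ, 0 < γ₁ ∧ 0 < γ₂ ∧ ∀ᶠ n : ℕ in atTop,
      ∃ (M : ℕ) (C : Wiretap.WiretapCode X Y n M),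
        R ≤ C.rate ∧
        C.averageError W ≤ ENNReal.ofReal (Real.exp (-γ₁ * n)) ∧
        C.HasSecurityLevel D (Real.exp (-γ₂ * n)) := by
  obtain ⟨α, hα0, hα1, -, htr⟩ := hα
  obtain ⟨t, ht0, hti⟩ := ht
  obtain ⟨hlog, hR'⟩ := Wiretap.quantumInfo_eq_of_lt P D hR
  rcases lt_or_ge 0 R with hR0 | hR0
  · exact Wiretap.exists_wiretapCode_of_pos_rate P W hD hf hα0 hα1 htr hlog ht0 hti hR0 hR'
  -- For `R ≤ 0` a single message suffices: rate zero, no error, and no pair of distinct messages to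
  -- distinguish.
  · obtain ⟨x⟩ := nonempty_of_isProbabilityMeasure P
    refine ⟨1, 1, one_pos, one_pos, Eventually.of_forall fun n => ?_⟩
    obtain ⟨hrate, hsec⟩ := Wiretap.trivialCode_rate_securityLevel (Y := Y) D fun _ : Fin n => x
    refine ⟨1, Wiretap.trivialCode fun _ => x, hR0.trans hrate.ge, ?_,
      fun m₁ m₂ => (hsec m₁ m₂).trans (Real.exp_pos _).le⟩
    rw [Wiretap.trivialCode_averageError]
    exact zero_le
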